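/- Let $\hbar,m,\sigma_0>0$ and $\beta\in(\mathbb R\setminus\{0\})\cup\{\infty\}$, with the convention $1/\infty=0$. Let $H_\beta$ be the $\delta'$-interaction Hamiltonian in $L^2(\mathbb R)$, $$\mathrm{dom}(H_\beta)=\Big\{\psi\in H^2(\mathbb R\setminus\{0\}) : \psi'(0^+)=\psi'(0^-)=:\psi'(0),\ \psi(0^+)-\psi(0^-)=\tfrac{2m\beta}{\hbar^2}\psi'(0)\Big\},\qquad H_\beta\psi=-\tfrac{\hbar^2}{2m}\psi''\ \text{ on }\mathbb R\setminus\{0\}$$ (for $\beta=\infty$ the last boundary condition reads $\psi'(0)=0$), which is self-adjoint. For $\sigma\in\mathbb C$ with $\operatorname{Re}\sigma=\sigma_0$ and $\xi=(q,p)\in\mathbb R^2$ let $$\psi^\hbar_{\sigma,\xi}(x)=\frac{1}{(2\pi\hbar)^{1/4}\sqrt\sigma}\exp\Big(-\frac{(x-q)^2}{4\hbar\sigma_0\sigma}+\frac i\hbar p(x-q)\Big),\qquad \phi^\hbar_{\sigma,x}(\xi)=\psi^\hbar_{\sigma,\xi}(x),$$ and put $\sigma_t=\sigma_0+\frac{it}{2m\sigma_0}$,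 $A_t=\frac{p^2t}{2m}$, $q_t=q+\frac{pt}{m}$. Let $B(p)=-\frac{2\beta}{\hbar^3}p^2$ (with $B=\infty$ if $\beta=\infty$), and let $L_B$ be the self-adjoint operator in $L^2(\mathbb R^2)$ whose resolvent is, for $z\in\mathbb C\setminus\mathbb R$, $$\big((L_B-z)^{-1}f\big)(q,p)=(R^0_zf)(q,p)+g_z(q,p)\,\frac{\frac12\big[(R^0_zf)(0,p)-(R^0_zf)(0,-p)\big]}{\frac1{B(p)}-\operatorname{sgn}(\operatorname{Im}z)\frac{im}{2|p|}},$$ where $(R^0_zf)(q,p)=\int_{\mathbb R}g_z(q-q',p)f(q',p)\,dq'$ is the resolvent of the free Liouville operator $L_0=-i\frac pm\partial_q$, with kernel $g_z(q,p)=\theta(qp\operatorname{Im}z)\operatorname{sgn}(\operatorname{Im}z)\frac{im}{|p|}e^{imzq/p}$, and $\theta$ is the Heaviside function. The unitary group $e^{itL_B}$ acts on $L^2(\mathbb R^2)$ by $$(e^{itL_B}f)(q,p)=f\big(q+\tfrac{pt}{m},p\big)-\frac{\theta(-tqp)\,\theta\big(\frac{|pt|}{m}-|q|\big)}{1-\operatorname{sgn}(t)\frac{2i|p|}{mB(p)}}\Big[f\big(q+\tfrac{pt}m,p\big)-f\big(-q-\tfrac{pt}m,-p\big)\Big],$$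 and $e^{itL_B}$ is applied to the bounded functions $\phi^\hbar_{\sigma,x}$ by the same formula. Then there exists a constant $C>0$, independent of $\hbar,m,\sigma_0,\beta$, such that for every $\eta\in(0,1)$, every $t\in\mathbb R$ and every $\xi=(q,p)\in\mathbb R^2$ with $qp\neq0$, $$\begin{aligned} &\Big\|e^{-i\frac t\hbar H_\beta}\psi^\hbar_{\sigma_0,\xi}-e^{\frac i\hbar A_t}\big(e^{itL_B}\phi^\hbar_{\sigma_t,(\cdot)}\big)(\xi)\Big\|_{L^2(\mathbb R)}\\ &\le C\Bigg[\frac{\eta}{1-\eta}\,\frac{\hbar^3}{m|\beta p|}+e^{-\eta^2\frac{\sigma_0^2p^2}{2\hbar}}+e^{-\frac{q^2}{4\hbar\sigma_0^2}}+e^{-\frac{\sigma_0^2p^2}{\hbar}}\\ &\qquad+\Big(\frac{\hbar^5\sigma_0^2}{m^2\beta^2}\Big)^{1/4}e^{\frac{\hbar^5\sigma_0^2}{m^2\beta^2}}\Big(e^{-\frac{\sigma_0^2p^2}{\hbar}}+e^{-\frac{q^2}{4\hbar\sigma_0^2}}\Big)+e^{-\frac{q_t^2}{4\hbar|\sigma_t|^2}}\Bigg].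 \end{aligned}$$ -/

import Mathlib

open MeasureTheory Filter Topology Complex

noncomputable section

namespace DeltaPrime

/-- The Hilbert space `L²(ℝ)`. -/
abbrev L2Line : Type := Lp ℂ 2 (volume : Measure ℝ)

/-- The Hilbert space `L²(ℝ²)` over the classical phase space of points `(q, p)`. -/
abbrev L2Phase : Type := Lp ℂ 2 (volume : Measure (ℝ × ℝ))

/-- Let the (unbounded) operator `A` on the Hilbert space `E` be given by its graph, so that `(x, y) ∈ A` means
`x ∈ dom A` and `A x = y`. Then `IsUnitaryGroup A U` says that `U s = e^{-isA}` for all `s`: the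
maps `U s` form a strongly continuous one-parameter group of isometries (hence of unitaries),
and its generator, with its full domain, is `-iA`. By Stone's theorem such a `U` exists if and
only if `A` is self-adjoint, and it is then unique. -/
structure IsUnitaryGroup {E : Type*} [NormedAddCommGroup E] [InnerProductSpace ℂ E]
    (A : Set (E × E)) (U : ℝ → E →L[ℂ] E) : Prop where
  map_zero : ∀ x, U 0 x = x
  map_add : ∀ s t x, U (s + t) x = U s (U t x)
  norm_map : ∀ s x, ‖U s x‖ = ‖x‖
  continuous : ∀ x, Continuous fun s => U s x
  generator : ∀ x y, (x, y) ∈ A ↔ HasDerivAt (fun s => U s x) (-(I • y)) 0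

/-- The reciprocal on `ℝ ∪ {∞}`, with `1/∞ = 0`. -/
def recip (b : OnePoint ℝ) : ℝ := b.elim 0 fun x => x⁻¹

/-- The Heaviside function. -/
def heaviside (x : ℝ) : ℝ := if 0 < x then 1 else 0

/-- The graph of the `δ'` Hamiltonian `H_β`, `β ∈ ℝ ∪ {∞}`, in `L²(ℝ)`. A function of
`H²(ℝ ∖ {0})` is a `ψ ∈ L²` with a representative `u` that is differentiable off `0`, whose
derivative `v = ψ'` is locally absolutely continuous off `0` with derivative `w = ψ'' ∈ L²`. The
boundary conditions are `ψ'(0⁺) = ψ'(0⁻) = ψ'(0)` and `ψ(0⁺) - ψ(0⁻) = (2mβ/ħ²) ψ'(0)`; for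
`β = ∞` the latter means `ψ'(0) = 0`. The action is `-(ħ²/2m) ψ''`, with `ψ''` taken off `0`. -/
def hamiltonian (ħ m : ℝ) (β : OnePoint ℝ) : Set (L2Line × L2Line) :=
  {ψ | ∃ (u v : ℝ → ℂ) (w : L2Line) (uR uL v₀ : ℂ),
    ψ.1 =ᵐ[volume] u ∧
    (∀ x, x ≠ 0 → HasDerivAt u (v x) x) ∧
    (∀ a b : ℝ, (0 : ℝ) ∉ Set.uIcc a b → v b - v a = ∫ x in a..b, w x) ∧
    Tendsto v (𝓝[>] 0) (𝓝 v₀) ∧ Tendsto v (𝓝[<] 0) (𝓝 v₀) ∧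
    Tendsto u (𝓝[>] 0) (𝓝 uR) ∧ Tendsto u (𝓝[<] 0) (𝓝 uL) ∧
    β.elim (v₀ = 0) (fun b => uR - uL = (2 * m * b / ħ ^ 2 : ℝ) * v₀) ∧
    ψ.2 = (-(ħ ^ 2 / (2 * m)) : ℝ) • w}

/-- The Gaussian coherent state `ψ^ħ_{σ,ξ}`, `ξ = (q, p)`. -/
def coherentState (ħ σ₀ : ℝ) (σ : ℂ) (ξ : ℝ × ℝ) (x : ℝ) : ℂ :=
  1 / (((2 * Real.pi * ħ) ^ (1 / 4 : ℝ) : ℝ) * σ ^ (1 / 2 : ℂ)) *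
    cexp (-(1 / (4 * ħ * σ₀ * σ)) * (x - ξ.1) ^ 2 + I / ħ * ξ.2 * (x - ξ.1))

theorem memLp_coherentState {ħ σ₀ : ℝ} (hħ : 0 < ħ) (hσ₀ : 0 < σ₀) (ξ : ℝ × ℝ) :
    MemLp (coherentState ħ σ₀ σ₀ ξ) 2 volume := by
  have hc : Continuous (coherentState ħ σ₀ σ₀ ξ) := by
    unfold coherentState
    fun_prop
  rw [memLp_two_iff_integrable_sq_norm hc.aestronglyMeasurable]
  have hpos : 0 < 1 / (2 * ħ * σ₀ ^ 2) := by positivity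
  have h := ((integrable_exp_neg_mul_sq hpos).comp_sub_right ξ.1).const_mul
    (‖(1 / (((2 * Real.pi * ħ) ^ (1 / 4 : ℝ) : ℝ) * (σ₀ : ℂ) ^ (1 / 2 : ℂ)) : ℂ)‖ ^ 2)
  refine h.congr (Eventually.of_forall fun x => ?_)
  have hre : (-(1 / (4 * (ħ : ℂ) * σ₀ * σ₀)) * ((x : ℂ) - ξ.1) ^ 2
      + I / ħ * ξ.2 * ((x : ℂ) - ξ.1)).re = -(1 / (4 * ħ * σ₀ * σ₀)) * (x - ξ.1) ^ 2 := by
    have : (-(1 / (4 * (ħ : ℂ) * σ₀ * σ₀)) * ((x : ℂ) - ξ.1) ^ 2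
      + I / ħ * ξ.2 * ((x : ℂ) - ξ.1)) = ((-(1 / (4 * ħ * σ₀ * σ₀)) * (x - ξ.1) ^ 2 : ℝ) : ℂ)
        + ((1 / ħ * ξ.2 * (x - ξ.1) : ℝ) : ℂ) * I := by
      push_cast
      ring
    rw [this, add_re, ofReal_re, re_ofReal_mul, I_re, mul_zero, add_zero]
  simp only [coherentState, norm_mul, mul_pow, norm_exp, hre, ← Real.exp_nat_mul]
  congr 2
  push_cast
  field_simp
  ring

/-- The initial coherent state `ψ^ħ_{σ₀,ξ}` as an element of `L²(ℝ)`. -/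
def initialState {ħ σ₀ : ℝ} (hħ : 0 < ħ) (hσ₀ : 0 < σ₀) (ξ : ℝ × ℝ) : L2Line :=
  (memLp_coherentState hħ hσ₀ ξ).toLp (coherentState ħ σ₀ σ₀ ξ)

/-- `σ_t = σ₀ + i t / (2 m σ₀)`. -/
def sigmaT (m σ₀ t : ℝ) : ℂ := σ₀ + I * t / (2 * m * σ₀)

/-- The coupling function `B(p) = -(2β/ħ³) p²`, which is `∞` if `β = ∞`. -/
def coupling (ħ : ℝ) (β : OnePoint ℝ) (p : ℝ) : OnePoint ℝ :=
  β.elim OnePoint.infty fun b => ((-(2 * b / ħ ^ 3) * p ^ 2 : ℝ) : OnePoint ℝ)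

/-- The kernel `g_z(q, p)` of the resolvent of the free Liouville operator
`L₀ = -i (p/m) ∂_q`. -/
def freeKernel (m : ℝ) (z : ℂ) (q p : ℝ) : ℂ :=
  heaviside (q * p * z.im) * Real.sign z.im * (I * m / |p|) * cexp (I * m * z * q / p)

/-- The free resolvent `(L₀ - z)⁻¹`. -/
def freeResolvent (m : ℝ) (z : ℂ) (f : ℝ × ℝ → ℂ) (ξ : ℝ × ℝ) : ℂ :=
  ∫ q', freeKernel m z (ξ.1 - q') ξ.2 * f (q', ξ.2)

/-- Kreĭn's formula `R^B_z = R⁰_z + G_z Π' Λ^B_z Π' G_{z̄}^*`. Here `G_{z̄}^* f = γ R⁰_z f` is the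
trace of `R⁰_z f` on the line `q = 0`, `Π'` is the projection onto the odd functions of `p`,
`Λ^B_z` is the multiplication by `(1/B(p) - sgn(Im z) i m / (2|p|))⁻¹`, an even function, and
`(G_z φ)(q, p) = g_z(q, p) φ(p)`. -/
def kreinResolvent (m : ℝ) (B : ℝ → OnePoint ℝ) (z : ℂ) (f : ℝ × ℝ → ℂ) (ξ : ℝ × ℝ) : ℂ :=
  freeResolvent m z f ξ + freeKernel m z ξ.1 ξ.2 *
    ((1 / 2 * (freeResolvent m z f (0, ξ.2) - freeResolvent m z f (0, -ξ.2))) /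
      (recip (B ξ.2) - Real.sign z.im * (I * m / (2 * |ξ.2|))))

/-- The graph of the singularly perturbed Liouville operator `L_B` in `L²(ℝ²)`: the operator with
`(L_B - z)⁻¹ = R^B_z` for all `z ∈ ℂ ∖ ℝ`. -/
def liouvillian (m : ℝ) (B : ℝ → OnePoint ℝ) : Set (L2Phase × L2Phase) :=
  {f | ∀ z : ℂ, z.im ≠ 0 → f.1 =ᵐ[volume] kreinResolvent m B z (f.2 - z • f.1 : L2Phase)}

/-- The free classical evolution `(e^{itL₀} f)(q, p) = f(q + pt/m, p)`. -/
def freeEvolution (m t : ℝ) (f : ℝ × ℝ → ℂ) (ξ : ℝ × ℝ) : ℂ := f (ξ.1 + ξ.2 * t / m, ξ.2)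

/-- The evolution `e^{itL_B}` on functions on the phase space, square integrable or not. -/
def classicalEvolution (m : ℝ) (B : ℝ → OnePoint ℝ) (t : ℝ) (f : ℝ × ℝ → ℂ) (ξ : ℝ × ℝ) : ℂ :=
  freeEvolution m t f ξ -
    heaviside (-(t * ξ.1 * ξ.2)) * heaviside (|ξ.2 * t| / m - |ξ.1|) /
      (1 - Real.sign t * (2 * I * |ξ.2| / m * recip (B ξ.2))) *
    freeEvolution m t (fun ζ => f ζ - f (-ζ)) ξ

/-- The approximation `x ↦ e^{iA_t/ħ} (e^{itL_B} φ^ħ_{σ_t,x})(ξ)`, where `A_t = p² t / (2m)`,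
`B(p) = -(2β/ħ³) p²` and `φ^ħ_{σ,x}(ξ) = ψ^ħ_{σ,ξ}(x)`. -/
def approximation (ħ m σ₀ : ℝ) (β : OnePoint ℝ) (t : ℝ) (ξ : ℝ × ℝ) (x : ℝ) : ℂ :=
  cexp (I / ħ * (ξ.2 ^ 2 * t / (2 * m))) *
    classicalEvolution m (coupling ħ β) t
      (fun ζ => coherentState ħ σ₀ (sigmaT m σ₀ t) ζ x) ξ

/-- The error bound, up to the constant; `r` is `1/β`. -/
def errorBound (ħ m σ₀ r η t q p : ℝ) : ℝ :=
  η / (1 - η) * (ħ ^ 3 * |r| / (m * |p|))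
    + Real.exp (-(η ^ 2 * (σ₀ ^ 2 * p ^ 2 / (2 * ħ))))
    + Real.exp (-(q ^ 2 / (4 * ħ * σ₀ ^ 2)))
    + Real.exp (-(σ₀ ^ 2 * p ^ 2 / ħ))
    + (ħ ^ 5 * σ₀ ^ 2 * r ^ 2 / m ^ 2) ^ (1 / 4 : ℝ) * Real.exp (ħ ^ 5 * σ₀ ^ 2 * r ^ 2 / m ^ 2) *
        (Real.exp (-(σ₀ ^ 2 * p ^ 2 / ħ)) + Real.exp (-(q ^ 2 / (4 * ħ * σ₀ ^ 2))))
    + Real.exp (-((q + p * t / m) ^ 2 / (4 * ħ * ‖sigmaT m σ₀ t‖ ^ 2)))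

end DeltaPrime

end

open MeasureTheory Filter Topology Complex

noncomputable section

namespace DeltaPrime

/-! ### Multiplication operators and reflections on `L²` -/

section Multiplication

variable {X : Type*} [MeasurableSpace X] {μ : Measure X}

/-! Parity decouples the `δ'` condition. On even functions it forces `ψ'(0) = 0` without a jump, so
`e^{-isH_β}` is the free evolution there. On odd functions it is the Robin condition `ψ'(0⁺) = κ
ψ(0⁺)`, `κ = ħ²/(mβ)`, on the half-line, which a method of images solves. If `g` on the whole line
is such that `g' - κ g` is odd, then the restriction of `g` to `x > 0` satisfies the Robin
condition. In Fourier variables, `k = 2πξ`, this says that `g` is fixed by the unitary involution `J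
= R S`, where `R` is the reflection and `S` multiplies by the symbol `s(k) = (ik - κ)/(ik + κ)`.
Since `J` commutes with the free group, restriction to `x > 0` followed by odd extension carries the
free evolution of the fixed vectors of `J` to the Robin evolution. It misses only the bound state
`e^{κx}`, present when `κ < 0`, because the compression of `J` to `L²(0, ∞)` is minus the projection
onto that state (`halfProj_boundaryOp_halfProj`). The remaining operator algebra is abstract
(`HalfLineData`). The group built in this way has generator `H_β`: each of its three pieces lands in
the domain of `H_β`, and `H_β` has no non-real eigenvalue, hence is no larger than the generator
(`hamiltonian_eq_generatorGraph`).

On the classical side the free flow crosses the line `q = 0` at most once when `p ≠ 0`. Multiplying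
the odd functions of `(q, p)` by `1` where `qp ≤ 0` and by a unimodular phase where `qp > 0` is
unitary; conjugating the free flow by it gives the explicit formula for the evolution, and the
Laplace transform of that formula is Kreĭn's resolvent (`liouvillian_eq_generatorGraph`).

For the estimate, parity allows `q > 0`. Let `ψ` be the initial state and `φ` the moving Gaussian,
so that the free evolution of `ψ` is `φ` up to a phase. As `ψ` sits almost entirely in `x > 0`, its
odd part is close to the image of `ψ` under the images map; the error is the tail of `ψ` in `x < 0`
and the overlap with the bound state. Hence the perturbed evolution is governed by `φ + Jφ` on `x >
0`. As `φ` is concentrated near momentum `p`, `Jφ` is close to `s₁ Rφ`, where `s₁` is the symbol at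
`k = p/ħ`; this costs the two terms with `η`. Finally `φ` is concentrated near `q_t`: for `q_t ≥ 0`
the reflected wave is negligible on `x > 0` and the result is `φ`, while for `q_t < 0` the wave `φ`
is negligible there and the result is `φ - ((1 + s₁)/2)(φ - Rφ)`. The choice of `B(p)` makes the
reflected weight of the classical formula equal to `0` and `(1 + s₁)/2` in these two cases
(`reflectionWeight_of_nonneg`, `reflectionWeight_of_neg`), so the quantum and classical expressions
agree. -/

theorem memLp_mul_of_bound {c : X → ℂ} (hc : Measurable c) (hb : ∀ x, ‖c x‖ ≤ 1)
    (f : Lp ℂ 2 μ) : MemLp (fun x => c x * f x) 2 μ :=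
  (Lp.memLp f).of_le (hc.aestronglyMeasurable.mul (Lp.aestronglyMeasurable f))
    (Eventually.of_forall fun x => by
      rw [norm_mul]
      exact mul_le_of_le_one_left (norm_nonneg _) (hb x))

/-- Multiplication by a measurable function bounded by `1`, as an operator on `L²`. -/
def mulOp (c : X → ℂ) (hc : Measurable c) (hb : ∀ x, ‖c x‖ ≤ 1) : Lp ℂ 2 μ →L[ℂ] Lp ℂ 2 μ :=
  LinearMap.mkContinuous
    { toFun := fun f => (memLp_mul_of_bound hc hb f).toLp _
      map_add' := fun f g => by
        rw [← MemLp.toLp_add, MemLp.toLp_eq_toLp_iff]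
        filter_upwards [Lp.coeFn_add f g] with x hx
        rw [hx]
        simp [mul_add]
      map_smul' := fun a f => by
        rw [RingHom.id_apply, ← MemLp.toLp_const_smul, MemLp.toLp_eq_toLp_iff]
        filter_upwards [Lp.coeFn_smul a f] with x hx
        rw [hx]
        simp only [Pi.smul_apply, smul_eq_mul]
        ring } 1 fun f => by
    rw [one_mul]
    refine Lp.norm_le_norm_of_ae_le ?_
    filter_upwards [(memLp_mul_of_bound hc hb f).coeFn_toLp] with x hx
    simp only [LinearMap.coe_mk, AddHom.coe_mk]
    rw [hx, norm_mul]
    exact mul_le_of_le_one_left (norm_nonneg _) (hb x)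

theorem mulOp_coeFn {c : X → ℂ} (hc : Measurable c) (hb : ∀ x, ‖c x‖ ≤ 1) (f : Lp ℂ 2 μ) :
    mulOp c hc hb f =ᵐ[μ] fun x => c x * f x :=
  (memLp_mul_of_bound hc hb f).coeFn_toLp

theorem norm_mulOp_apply_le {c : X → ℂ} (hc : Measurable c) (hb : ∀ x, ‖c x‖ ≤ 1)
    (f : Lp ℂ 2 μ) : ‖mulOp c hc hb f‖ ≤ ‖f‖ := by
  refine Lp.norm_le_norm_of_ae_le ?_
  filter_upwards [mulOp_coeFn hc hb f] with x hx
  rw [hx, norm_mul]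
  exact mul_le_of_le_one_left (norm_nonneg _) (hb x)

theorem mulOp_mulOp {c d e : X → ℂ} (hc : Measurable c) (hcb : ∀ x, ‖c x‖ ≤ 1)
    (hd : Measurable d) (hdb : ∀ x, ‖d x‖ ≤ 1) (he : Measurable e) (heb : ∀ x, ‖e x‖ ≤ 1)
    (h : ∀ᵐ x ∂μ, c x * d x = e x) (f : Lp ℂ 2 μ) :
    mulOp c hc hcb (mulOp d hd hdb f) = mulOp e he heb f := by
  refine Lp.ext ?_
  filter_upwards [mulOp_coeFn hc hcb (mulOp d hd hdb f), mulOp_coeFn hd hdb f,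
    mulOp_coeFn he heb f, h] with x h1 h2 h3 h4
  rw [h1, h2, h3, ← mul_assoc, h4]

theorem mulOp_eq_self {c : X → ℂ} (hc : Measurable c) (hcb : ∀ x, ‖c x‖ ≤ 1)
    (h : ∀ᵐ x ∂μ, c x = 1) (f : Lp ℂ 2 μ) : mulOp c hc hcb f = f := by
  refine Lp.ext ?_
  filter_upwards [mulOp_coeFn hc hcb f, h] with x h1 h2
  rw [h1, h2, one_mul]

theorem norm_mulOp_apply {c : X → ℂ} (hc : Measurable c) (hb : ∀ x, ‖c x‖ ≤ 1)
    (h : ∀ x, ‖c x‖ = 1) (f : Lp ℂ 2 μ) : ‖mulOp c hc hb f‖ = ‖f‖ := by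
  refine le_antisymm (norm_mulOp_apply_le hc hb f) (Lp.norm_le_norm_of_ae_le ?_)
  filter_upwards [mulOp_coeFn hc hb f] with x hx
  rw [hx, norm_mul, h, one_mul]

theorem inner_mulOp {c d : X → ℂ} (hc : Measurable c) (hcb : ∀ x, ‖c x‖ ≤ 1)
    (hd : Measurable d) (hdb : ∀ x, ‖d x‖ ≤ 1) (h : ∀ x, starRingEnd ℂ (c x) = d x)
    (f g : Lp ℂ 2 μ) :
    inner ℂ (mulOp c hc hcb f) g = inner ℂ f (mulOp d hd hdb g) := by
  rw [L2.inner_def, L2.inner_def]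
  refine integral_congr_ae ?_
  filter_upwards [mulOp_coeFn hc hcb f, mulOp_coeFn hd hdb g] with x h1 h2
  rw [h1, h2, ← h x]
  simp only [RCLike.inner_apply, map_mul]
  ring

end Multiplication

section Reflection

variable {X : Type*} [MeasurableSpace X] [AddGroup X] [MeasurableNeg X] (μ : Measure X)
  [μ.IsNegInvariant]

/-- The reflection `f ↦ f(-·)` on `L²`. -/
def reflOp : Lp ℂ 2 μ →L[ℂ] Lp ℂ 2 μ :=
  (Lp.compMeasurePreservingₗᵢ ℂ Neg.neg (Measure.measurePreserving_neg μ)).toContinuousLinearMap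

variable {μ}

theorem reflOp_coeFn (f : Lp ℂ 2 μ) : reflOp μ f =ᵐ[μ] fun x => f (-x) :=
  Lp.coeFn_compMeasurePreserving f (Measure.measurePreserving_neg μ)

theorem norm_reflOp (f : Lp ℂ 2 μ) : ‖reflOp μ f‖ = ‖f‖ :=
  (Lp.compMeasurePreservingₗᵢ ℂ Neg.neg (Measure.measurePreserving_neg μ)).norm_map f

theorem ae_comp_neg {P : X → Prop} (h : ∀ᵐ x ∂μ, P x) : ∀ᵐ x ∂μ, P (-x) :=
  (Measure.measurePreserving_neg μ).quasiMeasurePreserving.ae h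

theorem reflOp_reflOp (f : Lp ℂ 2 μ) : reflOp μ (reflOp μ f) = f := by
  refine Lp.ext ?_
  filter_upwards [reflOp_coeFn (reflOp μ f), ae_comp_neg (reflOp_coeFn f)] with x h1 h2
  rw [h1, h2, neg_neg]

theorem inner_reflOp_reflOp (f g : Lp ℂ 2 μ) :
    inner ℂ (reflOp μ f) (reflOp μ g) = inner ℂ f g :=
  (Lp.compMeasurePreservingₗᵢ ℂ Neg.neg (Measure.measurePreserving_neg μ)).inner_map_map f g

theorem inner_reflOp (f g : Lp ℂ 2 μ) : inner ℂ (reflOp μ f) g = inner ℂ f (reflOp μ g) := by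
  conv_lhs => rw [← reflOp_reflOp g]
  exact inner_reflOp_reflOp _ _

theorem reflOp_mulOp {c d : X → ℂ} (hc : Measurable c) (hcb : ∀ x, ‖c x‖ ≤ 1)
    (hd : Measurable d) (hdb : ∀ x, ‖d x‖ ≤ 1) (h : ∀ᵐ x ∂μ, c (-x) = d x) (f : Lp ℂ 2 μ) :
    reflOp μ (mulOp c hc hcb f) = mulOp d hd hdb (reflOp μ f) := by
  refine Lp.ext ?_
  filter_upwards [reflOp_coeFn (mulOp c hc hcb f), ae_comp_neg (mulOp_coeFn hc hcb f),
    mulOp_coeFn hd hdb (reflOp μ f), reflOp_coeFn f, h] with x h1 h2 h3 h4 h5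
  rw [h1, h2, h3, h4, h5]

end Reflection

/-! ### The Fourier transform on `L²(ℝ)` -/

open scoped FourierTransform SchwartzMap

theorem integral_mul_fourier_eq {f g : ℝ → ℂ} (hf : Integrable f) (hg : Integrable g) :
    ∫ x, 𝓕 f x * g x = ∫ x, f x * 𝓕 g x := by
  have := VectorFourier.integral_fourierIntegral_smul_eq_flip (L := innerₗ ℝ) (μ := volume)
    (ν := volume) Real.continuous_fourierChar continuous_inner hf hg
  rw [flip_innerₗ] at this
  simp only [smul_eq_mul] at this
  exact this

theorem integral_mul_fourierInv_eq {f g : ℝ → ℂ} (hf : Integrable f) (hg : Integrable g) :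
    ∫ x, 𝓕⁻ f x * g x = ∫ x, f x * 𝓕⁻ g x := by
  have h := integral_mul_fourier_eq hf (hg.comp_neg)
  have hgn : ∀ x, 𝓕 (fun y => g (-y)) x = 𝓕⁻ g x := fun x => by
    rw [Real.fourierInv_eq_fourier_comp_neg]
  simp only [hgn] at h
  rw [← h, ← integral_neg_eq_self (fun x => 𝓕 f x * g (-x))]
  simp only [neg_neg, Real.fourierInv_eq_fourier_neg]

theorem locallyIntegrable_coeFn (f : L2Line) : LocallyIntegrable f volume :=
  (Lp.memLp f).locallyIntegrable (by norm_num)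

theorem continuous_fourier_of_integrable {f : ℝ → ℂ} (hf : Integrable f) : Continuous (𝓕 f) :=
  VectorFourier.fourierIntegral_continuous Real.continuous_fourierChar continuous_inner hf

theorem continuous_fourierInv_of_integrable {f : ℝ → ℂ} (hf : Integrable f) :
    Continuous (𝓕⁻ f) := by
  have : 𝓕⁻ f = fun x => 𝓕 f (-x) := funext fun x => Real.fourierInv_eq_fourier_neg f x
  rw [this]
  exact (continuous_fourier_of_integrable hf).comp continuous_neg

/-- The `L²` transform is accessible through tempered distributions, so both sides are tested
against smooth compactly supported functions. Moving the transform onto the test function, on one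
side by duality and on the other by Fubini, gives the same pairing. -/
theorem fourier_toLp_ae {f : ℝ → ℂ} (h1 : Integrable f) (h2 : MemLp f 2 volume) :
    Lp.fourierTransformₗᵢ ℝ ℂ (h2.toLp f) =ᵐ[volume] 𝓕 f := by
  refine ae_eq_of_integral_contDiff_smul_eq (locallyIntegrable_coeFn _)
    (continuous_fourier_of_integrable h1).locallyIntegrable fun g hg hgc => ?_
  have hg' : ContDiff ℝ (⊤ : ℕ∞) fun x => (g x : ℂ) := ofRealCLM.contDiff.comp hg
  have hgc' : HasCompactSupport fun x => (g x : ℂ) := hgc.comp_left (g := ofReal) ofReal_zero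
  have key := DFunLike.congr_fun (Lp.fourier_toTemperedDistribution_eq (h2.toLp f))
    (hgc'.toSchwartzMap hg')
  rw [TemperedDistribution.fourier_apply, Lp.toTemperedDistribution_apply,
    Lp.toTemperedDistribution_apply] at key
  simp only [HasCompactSupport.toSchwartzMap_toFun, smul_eq_mul,
    SchwartzMap.fourier_coe] at key
  simp only [real_smul]
  refine key.symm.trans ?_
  have hcoe : ((hgc'.toSchwartzMap hg' : 𝓢(ℝ, ℂ)) : ℝ → ℂ) = fun x => (g x : ℂ) := rfl
  rw [hcoe]
  have := integral_mul_fourier_eq (hgc'.toSchwartzMap hg').integrable h1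
  rw [hcoe] at this
  rw [← this]
  refine integral_congr_ae ?_
  filter_upwards [h2.coeFn_toLp] with x hx
  rw [hx]

theorem fourier_symm_toLp_ae {f : ℝ → ℂ} (h1 : Integrable f) (h2 : MemLp f 2 volume) :
    (Lp.fourierTransformₗᵢ ℝ ℂ).symm (h2.toLp f) =ᵐ[volume] 𝓕⁻ f := by
  refine ae_eq_of_integral_contDiff_smul_eq (locallyIntegrable_coeFn _)
    (continuous_fourierInv_of_integrable h1).locallyIntegrable fun g hg hgc => ?_
  have hg' : ContDiff ℝ (⊤ : ℕ∞) fun x => (g x : ℂ) := ofRealCLM.contDiff.comp hg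
  have hgc' : HasCompactSupport fun x => (g x : ℂ) := hgc.comp_left (g := ofReal) ofReal_zero
  have key := DFunLike.congr_fun (Lp.fourierInv_toTemperedDistribution_eq (h2.toLp f))
    (hgc'.toSchwartzMap hg')
  rw [TemperedDistribution.fourierInv_apply, Lp.toTemperedDistribution_apply,
    Lp.toTemperedDistribution_apply] at key
  simp only [HasCompactSupport.toSchwartzMap_toFun, smul_eq_mul,
    SchwartzMap.fourierInv_coe] at key
  simp only [real_smul]
  refine key.symm.trans ?_
  have hcoe : ((hgc'.toSchwartzMap hg' : 𝓢(ℝ, ℂ)) : ℝ → ℂ) = fun x => (g x : ℂ) := rfl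
  rw [hcoe]
  have := integral_mul_fourierInv_eq (hgc'.toSchwartzMap hg').integrable h1
  rw [hcoe] at this
  rw [← this]
  refine integral_congr_ae ?_
  filter_upwards [h2.coeFn_toLp] with x hx
  rw [hx]

/-- The Fourier transform of `L²(ℝ)` as a continuous linear map. -/
def fourierOp : L2Line →L[ℂ] L2Line :=
  (Lp.fourierTransformₗᵢ ℝ ℂ).toContinuousLinearEquiv.toContinuousLinearMap

/-- The inverse Fourier transform of `L²(ℝ)` as a continuous linear map. -/
def fourierInvOp : L2Line →L[ℂ] L2Line :=
  (Lp.fourierTransformₗᵢ ℝ ℂ).symm.toContinuousLinearEquiv.toContinuousLinearMap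

theorem fourierOp_fourierInvOp (f : L2Line) : fourierOp (fourierInvOp f) = f :=
  (Lp.fourierTransformₗᵢ ℝ ℂ).apply_symm_apply f

theorem fourierInvOp_fourierOp (f : L2Line) : fourierInvOp (fourierOp f) = f :=
  (Lp.fourierTransformₗᵢ ℝ ℂ).symm_apply_apply f

theorem norm_fourierOp (f : L2Line) : ‖fourierOp f‖ = ‖f‖ :=
  (Lp.fourierTransformₗᵢ ℝ ℂ).norm_map f

theorem inner_fourierOp_fourierOp (f g : L2Line) :
    inner ℂ (fourierOp f) (fourierOp g) = inner ℂ f g :=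
  (Lp.fourierTransformₗᵢ ℝ ℂ).inner_map_map f g

theorem fourierOp_injective {f g : L2Line} (h : fourierOp f = fourierOp g) : f = g := by
  rw [← fourierInvOp_fourierOp f, h, fourierInvOp_fourierOp]

theorem fourierOp_toLp_ae {f : ℝ → ℂ} (h1 : Integrable f) (h2 : MemLp f 2 volume) :
    fourierOp (h2.toLp f) =ᵐ[volume] 𝓕 f := fourier_toLp_ae h1 h2

theorem fourierInvOp_toLp_ae {f : ℝ → ℂ} (h1 : Integrable f) (h2 : MemLp f 2 volume) :
    fourierInvOp (h2.toLp f) =ᵐ[volume] 𝓕⁻ f := fourier_symm_toLp_ae h1 h2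

theorem fourierOp_reflOp (f : L2Line) :
    fourierOp (reflOp volume f) = reflOp volume (fourierOp f) := by
  refine DenseRange.induction_on (p := fun f : L2Line => fourierOp (reflOp volume f)
    = reflOp volume (fourierOp f)) (SchwartzMap.denseRange_toLpCLM (F := ℂ) (E := ℝ) (p := 2)
      (μ := volume) ENNReal.ofNat_ne_top) f ?_ ?_
  · exact isClosed_eq (by fun_prop) (by fun_prop)
  · intro g
    have hL : SchwartzMap.toLpCLM ℝ ℂ 2 volume g = (g.memLp 2 volume).toLp g := rfl
    have h2 : MemLp (fun x => g (-x)) 2 volume :=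
      (g.memLp 2 volume).comp_measurePreserving (Measure.measurePreserving_neg volume)
    have hR : reflOp volume ((g.memLp 2 volume).toLp g) = h2.toLp _ := rfl
    rw [hL, hR]
    refine Lp.ext ?_
    filter_upwards [fourierOp_toLp_ae g.integrable.comp_neg h2, reflOp_coeFn
      (fourierOp ((g.memLp 2 volume).toLp g)),
      ae_comp_neg (fourierOp_toLp_ae g.integrable (g.memLp 2 volume))] with x h1 h2 h3
    rw [h1, h2, h3, ← Real.fourierInv_eq_fourier_comp_neg, Real.fourierInv_eq_fourier_neg]

/-- A function of the Sobolev space `H¹(ℝ)` has a continuous representative, which is a primitive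
of its derivative. -/
theorem exists_primitive_of_fourier {h g : L2Line}
    (hg : ∀ᵐ ξ : ℝ, fourierOp g ξ = 2 * Real.pi * ξ * I * fourierOp h ξ) :
    ∃ u : ℝ → ℂ, Continuous u ∧ h =ᵐ[volume] u ∧ ∀ a b, u b - u a = ∫ x in a..b, g x := by
  obtain ⟨φ, hφ⟩ : ∃ φ : ℝ → ℂ, (fourierOp h : ℝ → ℂ) = φ := ⟨_, rfl⟩
  rw [hφ] at hg
  have hφ2 : MemLp φ 2 volume := hφ ▸ Lp.memLp _
  -- Both `1/(1 + |ξ|)` and `(1 + |ξ|) φ` are in `L²`, so `φ` is integrable and its inverse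
  -- transform is continuous.
  have hwt : MemLp (fun ξ : ℝ => ((1 + ‖ξ‖ : ℝ))⁻¹) 2 volume := by
    have hc : Continuous fun ξ : ℝ => ((1 + ‖ξ‖ : ℝ))⁻¹ :=
      (continuous_const.add continuous_norm).inv₀ fun x =>
        (by positivity : (0 : ℝ) < 1 + ‖x‖).ne'
    rw [memLp_two_iff_integrable_sq hc.aestronglyMeasurable]
    refine (integrable_one_add_norm (E := ℝ) (μ := volume) (r := 2) (by simp)).congr
      (Eventually.of_forall fun x => ?_)
    simp only [inv_pow]
    rw [Real.rpow_neg (by positivity), Real.rpow_two]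
  have hprod : MemLp (fun ξ : ℝ => ((1 + ‖ξ‖ : ℝ) : ℂ) * φ ξ) 2 volume := by
    have hle := (hφ2.norm.add ((Lp.memLp (fourierOp g)).norm))
    refine hle.of_le ?_ ?_
    · exact ((by fun_prop : Continuous fun ξ : ℝ => ((1 + ‖ξ‖ : ℝ) : ℂ)).aestronglyMeasurable).mul
        hφ2.1
    · filter_upwards [hg] with ξ hξ
      rw [Pi.add_apply, hξ, norm_mul, Complex.norm_real]
      simp only [norm_mul, Complex.norm_real, norm_I, mul_one, Complex.norm_ofNat]
      have hpi : 1 ≤ 2 * ‖Real.pi‖ := by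
        rw [Real.norm_of_nonneg Real.pi_pos.le]
        linarith [Real.two_le_pi]
      have h1 : ‖(1 + ‖ξ‖ : ℝ)‖ = 1 + ‖ξ‖ := Real.norm_of_nonneg (by positivity)
      have h2 : ‖ξ‖ * ‖φ ξ‖ ≤ 2 * ‖Real.pi‖ * (‖ξ‖ * ‖φ ξ‖) :=
        le_mul_of_one_le_left (by positivity) hpi
      rw [h1]
      refine le_trans ?_ (Real.le_norm_self _)
      linarith
  have hφ1 : Integrable φ := by
    have := hwt.integrable_mul hprod.norm
    refine (this.mono' hφ2.1 (Eventually.of_forall fun ξ => ?_))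
    simp only [Pi.mul_apply, norm_mul, Complex.norm_real]
    rw [Real.norm_of_nonneg (by positivity : (0 : ℝ) ≤ 1 + ‖ξ‖), inv_mul_cancel_left₀]
    positivity
  refine ⟨𝓕⁻ φ, continuous_fourierInv_of_integrable hφ1, ?_, ?_⟩
  · have := fourierInvOp_toLp_ae hφ1 hφ2
    rwa [show hφ2.toLp φ = fourierOp h by subst hφ; exact Lp.toLp_coeFn _ _, fourierInvOp_fourierOp] at this
  · suffices hle : ∀ a b : ℝ, a ≤ b → 𝓕⁻ φ b - 𝓕⁻ φ a = ∫ x in a..b, g x by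
      intro a b
      rcases le_total a b with hab | hab
      · exact hle a b hab
      · rw [intervalIntegral.integral_symm, ← hle b a hab, neg_sub]
    intro a b hab
    have hfin : volume (Set.Ioc a b) ≠ ⊤ := by simp
    -- The integral of `g` is its inner product with the indicator of `(a, b]`, computed on the
    -- Fourier side. The transform of the indicator is left as an integral, so that nothing is
    -- divided by `ξ`.
    have h1 : ∫ x in a..b, g x = inner ℂ (fourierOp (indicatorConstLp 2 (measurableSet_Ioc)
        hfin (1 : ℂ))) (fourierOp g) := by
      rw [inner_fourierOp_fourierOp, L2.inner_indicatorConstLp_one,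
        intervalIntegral.integral_of_le hab]
    have hind : ∀ᵐ ξ : ℝ, fourierOp (indicatorConstLp 2 (measurableSet_Ioc)
        hfin (1 : ℂ)) ξ = ∫ x in a..b, cexp (-2 * Real.pi * ξ * I * x) := by
      have hi1 : Integrable ((Set.Ioc a b).indicator fun _ : ℝ => (1 : ℂ)) := by
        rw [integrable_indicator_iff measurableSet_Ioc]
        exact integrableOn_const hfin
      have hi2 : MemLp ((Set.Ioc a b).indicator fun _ : ℝ => (1 : ℂ)) 2 volume :=
        memLp_indicator_const 2 measurableSet_Ioc 1 (Or.inr hfin)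
      filter_upwards [fourierOp_toLp_ae hi1 hi2] with ξ hξ
      refine hξ.trans ?_
      rw [Real.fourier_eq', intervalIntegral.integral_of_le hab, ← integral_indicator
        measurableSet_Ioc]
      congr 1
      ext x
      by_cases hx : x ∈ Set.Ioc a b
      · simp only [Set.indicator_of_mem hx, smul_eq_mul, mul_one]
        congr 1
        simp
        ring
      · simp [Set.indicator_of_notMem hx]
    rw [h1, L2.inner_def]
    have hint : ∀ x : ℝ, Integrable fun ξ : ℝ => cexp (2 * Real.pi * ξ * I * x) * φ ξ := fun x => by
      refine hφ1.bdd_mul (c := 1) (by fun_prop) (Eventually.of_forall fun ξ => ?_)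
      rw [show 2 * Real.pi * ξ * I * x = ((2 * Real.pi * ξ * x : ℝ) : ℂ) * I by push_cast; ring,
        Complex.norm_exp_ofReal_mul_I]
    have hinv : ∀ x : ℝ, 𝓕⁻ φ x = ∫ ξ : ℝ, cexp (2 * Real.pi * ξ * I * x) * φ ξ := fun x => by
      rw [Real.fourierInv_eq']
      congr 1
      ext ξ
      rw [smul_eq_mul]
      congr 2
      simp
      ring
    rw [hinv, hinv, ← integral_sub (hint b) (hint a)]
    refine integral_congr_ae ?_
    filter_upwards [hg, hind] with ξ h1 h2
    rw [h1, h2, RCLike.inner_apply, ← sub_mul]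
    have hconj : (starRingEnd ℂ) (∫ x in a..b, cexp (-2 * Real.pi * ξ * I * x))
        = ∫ x in a..b, cexp (2 * Real.pi * ξ * I * x) := by
      rw [intervalIntegral.integral_of_le hab, intervalIntegral.integral_of_le hab,
        ← integral_conj]
      congr 1
      ext x
      rw [← Complex.exp_conj]
      simp [map_ofNat]
    rw [hconj]
    have hder : ∫ x in a..b, 2 * Real.pi * ξ * I * cexp (2 * Real.pi * ξ * I * x)
        = cexp (2 * Real.pi * ξ * I * b) - cexp (2 * Real.pi * ξ * I * a) := by
      refine intervalIntegral.integral_eq_sub_of_hasDerivAt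
        (f := fun x : ℝ => cexp (2 * Real.pi * ξ * I * x)) (fun x _ => ?_)
        (Continuous.intervalIntegrable (by fun_prop) _ _)
      have := ((hasDerivAt_id x).ofReal_comp.const_mul (2 * Real.pi * ξ * I : ℂ)).cexp
      simpa [mul_comm] using this
    rw [intervalIntegral.integral_const_mul] at hder
    rw [← hder]
    ring

end DeltaPrime

end


open MeasureTheory Filter Topology Complex

noncomputable section

namespace DeltaPrime

/-! ### One-parameter unitary groups and their resolvents -/

section Groups

variable {E : Type*} [NormedAddCommGroup E] [InnerProductSpace ℂ E]

/-- A strongly continuous one-parameter group of isometries. -/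
structure IsIsometryGroup (U : ℝ → E →L[ℂ] E) : Prop where
  map_zero : ∀ x, U 0 x = x
  map_add : ∀ s t x, U (s + t) x = U s (U t x)
  norm_map : ∀ s x, ‖U s x‖ = ‖x‖
  continuous : ∀ x, Continuous fun s => U s x

/-- The graph of the operator `A` with `U s = e^{-isA}`. -/
def generatorGraph (U : ℝ → E →L[ℂ] E) : Set (E × E) :=
  {x | HasDerivAt (fun s => U s x.1) (-(I • x.2)) 0}

theorem IsIsometryGroup.isUnitaryGroup {U : ℝ → E →L[ℂ] E} (hU : IsIsometryGroup U)
    {A : Set (E × E)} (hA : A = generatorGraph U) : IsUnitaryGroup A U where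
  map_zero := hU.map_zero
  map_add := hU.map_add
  norm_map := hU.norm_map
  continuous := hU.continuous
  generator := fun x y => by rw [hA]; exact Iff.rfl

theorem IsIsometryGroup.neg {U : ℝ → E →L[ℂ] E} (hU : IsIsometryGroup U) :
    IsIsometryGroup fun s => U (-s) where
  map_zero := fun x => by rw [neg_zero, hU.map_zero]
  map_add := fun s t x => by rw [neg_add, hU.map_add]
  norm_map := fun s x => hU.norm_map _ x
  continuous := fun x => (hU.continuous x).comp continuous_neg

theorem generatorGraph_neg {U : ℝ → E →L[ℂ] E} {x y : E} (h : (x, y) ∈ generatorGraph U) :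
    (x, -y) ∈ generatorGraph fun s => U (-s) := by
  have h' : HasDerivAt (fun s => U s x) (-(I • y)) (-0) := by rw [neg_zero]; exact h
  have := h'.scomp (0 : ℝ) (hasDerivAt_neg (0 : ℝ))
  simp only [generatorGraph, Set.mem_ofPred_eq]
  convert! this using 1
  simp

theorem generatorGraph_neg_iff {U : ℝ → E →L[ℂ] E} {x y : E} :
    (x, y) ∈ generatorGraph U ↔ (x, -y) ∈ generatorGraph fun s => U (-s) := by
  refine ⟨generatorGraph_neg, fun h => ?_⟩
  have := generatorGraph_neg h
  simpa using this

theorem generatorGraph_sub {U : ℝ → E →L[ℂ] E} {x y x' y' : E}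
    (h : (x, y) ∈ generatorGraph U) (h' : (x', y') ∈ generatorGraph U) :
    (x - x', y - y') ∈ generatorGraph U := by
  have : HasDerivAt (fun s => U s x - U s x') (-(I • y) - -(I • y')) 0 := HasDerivAt.fun_sub h h'
  simp only [generatorGraph, Set.mem_ofPred_eq, map_sub, smul_sub]
  convert this using 1
  abel

/-- A generator has no non-real eigenvalues. -/
theorem IsIsometryGroup.eq_zero_of_eigenvector {U : ℝ → E →L[ℂ] E} (hU : IsIsometryGroup U)
    {z : ℂ} (hz : z.im ≠ 0) {x : E} (h : (x, z • x) ∈ generatorGraph U) : x = 0 := by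
  -- The squared norm of `U s x` is constant, whereas its derivative at `0` is `2 (Im z) ‖x‖²`.
  have h' : HasDerivAt (fun s => U s x) (-(I • z • x)) 0 := h
  have h1 := h'.inner ℂ h'
  have h2 : (fun s => inner ℂ (U s x) (U s x)) = fun _ => ((‖x‖ : ℂ) ^ 2) := by
    ext s
    rw [inner_self_eq_norm_sq_to_K, hU.norm_map]
    rfl
  rw [h2, hU.map_zero] at h1
  have h3 := h1.unique (hasDerivAt_const _ _)
  simp only [inner_neg_right, inner_neg_left, inner_smul_right, inner_smul_left,
    inner_self_eq_norm_sq_to_K] at h3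
  have h4 := congrArg Complex.re h3
  have h5 : (-(I * (z * ((‖x‖ : ℂ)) ^ 2)) +
      -((starRingEnd ℂ) I * ((starRingEnd ℂ) z * ((‖x‖ : ℂ)) ^ 2))).re = 2 * z.im * ‖x‖ ^ 2 := by
    have : ((‖x‖ : ℂ)) ^ 2 = ((‖x‖ ^ 2 : ℝ) : ℂ) := by push_cast; rfl
    rw [this]
    simp only [add_re, neg_re, mul_re, I_re, I_im, mul_im, ofReal_re, ofReal_im, conj_re, conj_im]
    ring
  have h6 : 2 * z.im * ‖x‖ ^ 2 = 0 := h5.symm.trans h4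
  simpa [hz] using h6

theorem IsIsometryGroup.integrableOn_laplace {U : ℝ → E →L[ℂ] E} (hU : IsIsometryGroup U)
    {z : ℂ} (hz : 0 < z.im) (f : E) (a : ℝ) :
    IntegrableOn (fun s : ℝ => cexp (I * z * s) • U s f) (Set.Ioi a) := by
  have hc : Continuous fun s : ℝ => cexp (I * z * s) • U s f :=
    (by fun_prop : Continuous fun s : ℝ => cexp (I * z * s)).smul (hU.continuous f)
  have h1 := (exp_neg_integrableOn_Ioi a hz).mul_const ‖f‖
  refine h1.mono' hc.aestronglyMeasurable (Eventually.of_forall fun s => ?_)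
  rw [norm_smul, hU.norm_map, Complex.norm_exp]
  simp

variable [CompleteSpace E]

theorem setIntegral_Ioi_comp_add_right {F : Type*} [NormedAddCommGroup F] [NormedSpace ℝ F]
    (g : ℝ → F) (a s : ℝ) : ∫ r in Set.Ioi a, g (r + s) = ∫ r in Set.Ioi (a + s), g r := by
  rw [← (measurePreserving_add_right volume s).setIntegral_preimage_emb
    (measurableEmbedding_addRight s) g]
  simp

/-- The Laplace transform of a group, which for `Im z > 0` is the resolvent at `z`. -/
def laplaceResolvent (U : ℝ → E →L[ℂ] E) (z : ℂ) (f : E) : E :=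
  I • ∫ s in Set.Ioi (0 : ℝ), cexp (I * z * s) • U s f

/-- Shifting the integration variable turns the orbit of the Laplace transform into `i e^{-izs}`
times an integral over `(s, ∞)`, which is differentiated by the product rule and the fundamental
theorem of calculus. -/
theorem IsIsometryGroup.laplaceResolvent_mem {U : ℝ → E →L[ℂ] E} (hU : IsIsometryGroup U)
    {z : ℂ} (hz : 0 < z.im) (f : E) :
    (laplaceResolvent U z f, f + z • laplaceResolvent U z f) ∈ generatorGraph U := by
  set g : ℝ → E := fun s => cexp (I * z * s) • U s f with hg
  have hgc : Continuous g :=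
    (by fun_prop : Continuous fun s : ℝ => cexp (I * z * s)).smul (hU.continuous f)
  have hgi : ∀ a, IntegrableOn g (Set.Ioi a) := hU.integrableOn_laplace hz f
  have key : ∀ s : ℝ, U s (laplaceResolvent U z f)
      = I • cexp (-(I * z * s)) • ((∫ r in Set.Ioi (0 : ℝ), g r) - ∫ r in (0 : ℝ)..s, g r) := by
    intro s
    rw [laplaceResolvent, map_smul, ← ContinuousLinearMap.integral_comp_comm _ (hgi 0)]
    congr 1
    have h1 : ∀ r : ℝ, U s (g r) = cexp (-(I * z * s)) • g (r + s) := by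
      intro r
      simp only [hg]
      rw [map_smul, ← hU.map_add, smul_smul, ← Complex.exp_add, add_comm s r]
      congr 2
      push_cast
      ring
    simp_rw [h1]
    rw [integral_smul]
    congr 1
    rw [setIntegral_Ioi_comp_add_right g, zero_add, eq_sub_iff_add_eq, add_comm]
    exact intervalIntegral.integral_interval_add_Ioi (hgi 0) (hgi s)
  have hFTC : HasDerivAt (fun s => ∫ r in (0 : ℝ)..s, g r) (g 0) 0 :=
    intervalIntegral.integral_hasDerivAt_right (hgc.intervalIntegrable _ _)
      hgc.aestronglyMeasurable.stronglyMeasurableAtFilter hgc.continuousAt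
  have hexp : HasDerivAt (fun s : ℝ => cexp (-(I * z * s))) (-(I * z)) 0 := by
    have := ((hasDerivAt_id (0 : ℝ)).ofReal_comp.const_mul (-(I * z))).cexp
    simpa [neg_mul] using this
  have hd := (hexp.smul (hFTC.const_sub (∫ r in Set.Ioi (0 : ℝ), g r))).const_smul I
  simp only [generatorGraph, Set.mem_ofPred_eq]
  rw [funext key]
  refine hd.congr_deriv ?_
  have hg0 : g 0 = f := by simp [hg, hU.map_zero]
  simp only [ofReal_zero, mul_zero, neg_zero, Complex.exp_zero, one_smul, hg0,
    intervalIntegral.integral_same, sub_zero]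
  rw [laplaceResolvent]
  change _ = -(I • (f + z • I • ∫ s in Set.Ioi (0 : ℝ), g s))
  module

theorem IsIsometryGroup.inner_laplaceResolvent {U : ℝ → E →L[ℂ] E} (hU : IsIsometryGroup U)
    {z : ℂ} (hz : 0 < z.im) (g f : E) :
    inner ℂ g (laplaceResolvent U z f)
      = I * ∫ s in Set.Ioi (0 : ℝ), cexp (I * z * s) * inner ℂ g (U s f) := by
  rw [laplaceResolvent, inner_smul_right,
    ← integral_inner (𝕜 := ℂ) (hU.integrableOn_laplace hz f 0)]
  simp only [inner_smul_right]

/-- The resolvent at a single point determines the generator: two candidates for `x` differ by an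
eigenvector with eigenvalue `z`, which vanishes. Identifying a generator thus reduces to computing a
Laplace transform. -/
theorem IsIsometryGroup.mem_generatorGraph_iff {U : ℝ → E →L[ℂ] E} (hU : IsIsometryGroup U)
    {z : ℂ} (hz : 0 < z.im) (x y : E) :
    (x, y) ∈ generatorGraph U ↔ x = laplaceResolvent U z (y - z • x) := by
  constructor
  · intro h
    have h1 := generatorGraph_sub h (hU.laplaceResolvent_mem hz (y - z • x))
    refine sub_eq_zero.1 (hU.eq_zero_of_eigenvector hz.ne' ?_)
    convert h1 using 2
    module
  · intro h
    have h1 := hU.laplaceResolvent_mem hz (y - z • x)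
    rw [← h] at h1
    simpa using h1

end Groups

/-! ### Pointwise form of the Laplace transform in `L²` -/

section Pointwise

variable {X : Type*} [MeasurableSpace X] {μ : Measure X} [SigmaFinite μ]

/-- Passes from the Bochner integral in `L²` to an integral at each point. The two are compared
through their integrals over sets of finite measure, where Fubini applies. -/
theorem laplaceResolvent_ae {U : ℝ → Lp ℂ 2 μ →L[ℂ] Lp ℂ 2 μ} (hU : IsIsometryGroup U)
    {z : ℂ} (hz : 0 < z.im) (f : Lp ℂ 2 μ) {K : ℝ × X → ℂ} (hK : Measurable K)
    (hUK : ∀ s, U s f =ᵐ[μ] fun x => K (s, x)) :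
    ((laplaceResolvent U z f : Lp ℂ 2 μ) : X → ℂ) =ᵐ[μ]
      fun x => I * ∫ s in Set.Ioi (0 : ℝ), cexp (I * z * s) * K (s, x) := by
  have hfin : ∀ (A : Set X), MeasurableSet A → μ A < ⊤ → Integrable
      (fun p : ℝ × X => cexp (I * z * p.1) * K p)
        ((volume.restrict (Set.Ioi (0 : ℝ))).prod (μ.restrict A)) := by
    intro A hA hμA
    have hfinA : IsFiniteMeasure (μ.restrict A) := ⟨by simpa using hμA⟩
    have hm : Measurable fun p : ℝ × X => cexp (I * z * p.1) * K p := by fun_prop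
    have hKs : ∀ s, MemLp (fun x => K (s, x)) 2 (μ.restrict A) := fun s =>
      ((Lp.memLp (U s f)).ae_eq (hUK s)).mono_measure Measure.restrict_le_self
    have hKi : ∀ s, Integrable (fun x => K (s, x)) (μ.restrict A) := fun s =>
      (hKs s).integrable one_le_two
    rw [integrable_prod_iff hm.aestronglyMeasurable]
    refine ⟨Eventually.of_forall fun s => (hKi s).const_mul (cexp (I * z * s)), ?_⟩
    have h1 := (exp_neg_integrableOn_Ioi 0 hz).mul_const ((μ.real A + ‖f‖ ^ 2) / 2)
    refine h1.mono' (hm.norm.stronglyMeasurable.integral_prod_right').aestronglyMeasurable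
      (Eventually.of_forall fun s => ?_)
    rw [Real.norm_of_nonneg (integral_nonneg fun _ => norm_nonneg _)]
    have h2 : ∀ x, ‖cexp (I * z * s) * K (s, x)‖ = Real.exp (-z.im * s) * ‖K (s, x)‖ := by
      intro x
      rw [norm_mul, Complex.norm_exp]
      simp
    simp only [h2]
    rw [integral_const_mul]
    refine mul_le_mul_of_nonneg_left ?_ (Real.exp_pos _).le
    have hsq : Integrable (fun x => ‖K (s, x)‖ ^ 2) (μ.restrict A) := (hKs s).integrable_norm_pow
      (by norm_num)
    have hsq' : Integrable (fun x => ‖K (s, x)‖ ^ 2) μ :=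
      ((Lp.memLp (U s f)).ae_eq (hUK s)).integrable_norm_pow (by norm_num)
    -- The inequality `r ≤ (1 + r²)/2` bounds the `L¹` norm on `A` by the `L²` norm of `U s f`,
    -- which does not depend on `s`.
    calc ∫ x in A, ‖K (s, x)‖ ∂μ ≤ ∫ x in A, (1 + ‖K (s, x)‖ ^ 2) / 2 ∂μ := by
          refine integral_mono (hKi s).norm (((integrable_const _).add hsq).div_const 2) fun x => ?_
          change ‖K (s, x)‖ ≤ (1 + ‖K (s, x)‖ ^ 2) / 2
          nlinarith [sq_nonneg (‖K (s, x)‖ - 1)]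
      _ = (μ.real A + ∫ x in A, ‖K (s, x)‖ ^ 2 ∂μ) / 2 := by
          rw [integral_div, integral_add (integrable_const _) hsq]
          simp
      _ ≤ (μ.real A + ‖f‖ ^ 2) / 2 := by
          have h3 : ∫ x in A, ‖K (s, x)‖ ^ 2 ∂μ ≤ ∫ x, ‖K (s, x)‖ ^ 2 ∂μ :=
            setIntegral_le_integral hsq' (Eventually.of_forall fun x => by positivity)
          have h4 : ∫ x, ‖K (s, x)‖ ^ 2 ∂μ = ‖f‖ ^ 2 := by
            rw [← hU.norm_map s f, ← @inner_self_eq_norm_sq ℂ, L2.inner_def, ← integral_re]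
            · refine integral_congr_ae ?_
              filter_upwards [hUK s] with x hx
              rw [hx, inner_self_eq_norm_sq]
            · exact L2.integrable_inner _ _
          linarith
  refine ae_eq_of_forall_setIntegral_eq_of_sigmaFinite ?_ ?_ ?_
  · intro A hA hμA
    have hfinA : IsFiniteMeasure (μ.restrict A) := ⟨by simpa using hμA⟩
    exact ((Lp.memLp _).mono_measure Measure.restrict_le_self).integrable one_le_two
  · intro A hA hμA
    exact ((hfin A hA hμA).integral_prod_right).const_mul I
  · intro A hA hμA
    rw [← L2.inner_indicatorConstLp_one (𝕜 := ℂ) hA hμA.ne, hU.inner_laplaceResolvent hz, integral_const_mul,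
      integral_integral_swap]
    · congr 1
      refine integral_congr_ae (Eventually.of_forall fun s => ?_)
      simp only
      rw [L2.inner_indicatorConstLp_one, integral_const_mul]
      congr 1
      exact integral_congr_ae (ae_restrict_of_ae (hUK s))
    · exact (hfin A hA hμA).swap

end Pointwise

end DeltaPrime

end


open MeasureTheory Filter Topology Complex

noncomputable section

namespace DeltaPrime

/-! ### The free classical flow -/

/-- The flow of the free classical particle, at the time `-s`. -/
def backwardFlow (m s : ℝ) (ξ : ℝ × ℝ) : ℝ × ℝ := (ξ.1 + ξ.2 * (-s) / m, ξ.2)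

theorem continuous_backwardFlow (m : ℝ) :
    Continuous fun x : ℝ × (ℝ × ℝ) => backwardFlow m x.1 x.2 := by
  unfold backwardFlow
  fun_prop

theorem measurePreserving_backwardFlow (m s : ℝ) :
    MeasurePreserving (backwardFlow m s) volume volume := by
  -- With the coordinates exchanged, the flow is a skew product whose fibre maps are translations.
  have h1 : MeasurePreserving (fun x : ℝ × ℝ => (x.1, x.2 + x.1 * (-s) / m))
      (volume.prod volume) (volume.prod volume) :=
    (MeasurePreserving.id (volume : Measure ℝ)).skew_product
      (g := fun p q : ℝ => q + p * (-s) / m) (by fun_prop)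
      (Eventually.of_forall fun p => (measurePreserving_add_right volume (p * (-s) / m)).map_eq)
  exact Measure.measurePreserving_swap.comp (h1.comp Measure.measurePreserving_swap)

/-- The free classical evolution `e^{-isL₀}`. -/
def freeGroup (m s : ℝ) : L2Phase →L[ℂ] L2Phase :=
  (Lp.compMeasurePreservingₗᵢ ℂ (backwardFlow m s)
    (measurePreserving_backwardFlow m s)).toContinuousLinearMap

theorem freeGroup_coeFn (m s : ℝ) (f : L2Phase) :
    freeGroup m s f =ᵐ[volume] fun ξ => f (backwardFlow m s ξ) :=
  Lp.coeFn_compMeasurePreserving f (measurePreserving_backwardFlow m s)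

theorem isIsometryGroup_freeGroup (m : ℝ) : IsIsometryGroup (freeGroup m) where
  map_zero := fun f => Lp.ext <| by
    filter_upwards [freeGroup_coeFn m 0 f] with ξ h
    rw [h]
    simp [backwardFlow]
  map_add := fun s t f => Lp.ext <| by
    filter_upwards [freeGroup_coeFn m (s + t) f, freeGroup_coeFn m s (freeGroup m t f),
      (measurePreserving_backwardFlow m s).quasiMeasurePreserving.ae (freeGroup_coeFn m t f)]
      with ξ h1 h2 h3
    rw [h1, h2, h3]
    congr 1
    ext
    · simp only [backwardFlow]
      ring
    · rfl
  norm_map := fun s f => (Lp.compMeasurePreservingₗᵢ ℂ (backwardFlow m s)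
    (measurePreserving_backwardFlow m s)).norm_map f
  continuous := fun f => by
    -- Composition in `L²` depends continuously on the measure-preserving map in the compact-open
    -- topology, and the flow is continuous in time for it.
    let g : ℝ → C(ℝ × ℝ, ℝ × ℝ) := fun s =>
      ⟨backwardFlow m s, (continuous_backwardFlow m).comp (Continuous.prodMk_right s)⟩
    have hg : Continuous g :=
      ContinuousMap.continuous_of_continuous_uncurry g (continuous_backwardFlow m)
    exact (continuous_const (y := f)).compMeasurePreservingLp hg
      (fun s => measurePreserving_backwardFlow m s) ENNReal.ofNat_ne_top

/-! ### The collision phase -/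

/-- The phase acquired on the odd functions by crossing the line `q = 0`. -/
def collisionPhase (m : ℝ) (B : ℝ → OnePoint ℝ) (p : ℝ) : ℂ :=
  -((1 - 2 * I * |p| / m * recip (B p)) / (1 + 2 * I * |p| / m * recip (B p)))

/-- The gauge function: `1` before the collision, the collision phase after it. -/
def gauge (m : ℝ) (B : ℝ → OnePoint ℝ) (ξ : ℝ × ℝ) : ℂ :=
  if 0 < ξ.1 * ξ.2 then collisionPhase m B ξ.2 else 1

theorem conj_collisionPhase_denominator (x m r : ℝ) :
    (starRingEnd ℂ) (1 + 2 * I * x / m * r) = 1 - 2 * I * x / m * r := by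
  simp [map_ofNat]
  ring

theorem one_add_ne_zero (x m r : ℝ) : (1 + 2 * I * x / m * r : ℂ) ≠ 0 := by
  intro h
  have h1 : (1 + 2 * I * x / m * r : ℂ) = 1 + ((2 * x / m * r : ℝ) : ℂ) * I := by
    push_cast
    ring
  rw [h1] at h
  have := congrArg Complex.re h
  simp at this

theorem one_sub_ne_zero (x m r : ℝ) : (1 - 2 * I * x / m * r : ℂ) ≠ 0 := by
  rw [← conj_collisionPhase_denominator]
  exact (map_ne_zero _).2 (one_add_ne_zero x m r)

theorem conj_collisionPhase (m : ℝ) (B : ℝ → OnePoint ℝ) (p : ℝ) :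
    (starRingEnd ℂ) (collisionPhase m B p) =
      -((1 + 2 * I * |p| / m * recip (B p)) / (1 - 2 * I * |p| / m * recip (B p))) := by
  rw [collisionPhase, map_neg, map_div₀, conj_collisionPhase_denominator,
    ← conj_collisionPhase_denominator, Complex.conj_conj]

theorem norm_collisionPhase (m : ℝ) (B : ℝ → OnePoint ℝ) (p : ℝ) :
    ‖collisionPhase m B p‖ = 1 := by
  rw [collisionPhase, norm_neg, norm_div, ← conj_collisionPhase_denominator, RCLike.norm_conj,
    div_self]
  exact norm_ne_zero_iff.2 (one_add_ne_zero _ _ _)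

theorem norm_gauge (m : ℝ) (B : ℝ → OnePoint ℝ) (ξ : ℝ × ℝ) : ‖gauge m B ξ‖ = 1 := by
  unfold gauge
  split_ifs
  · exact norm_collisionPhase m B _
  · simp

theorem gauge_neg {m : ℝ} {B : ℝ → OnePoint ℝ} (hB : ∀ p, B (-p) = B p) (ξ : ℝ × ℝ) :
    gauge m B (-ξ) = gauge m B ξ := by
  simp [gauge, collisionPhase, hB]

theorem measurable_gauge (m : ℝ) {B : ℝ → OnePoint ℝ} (hB : Measurable fun p => recip (B p)) :
    Measurable (gauge m B) := by
  unfold gauge collisionPhase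
  refine Measurable.ite (measurableSet_lt measurable_const (by fun_prop)) ?_ measurable_const
  have h1 : Measurable fun ξ : ℝ × ℝ => 2 * I * ((|ξ.2| : ℝ) : ℂ) / m * (recip (B ξ.2) : ℂ) := by
    have h2 : Measurable fun ξ : ℝ × ℝ => ((recip (B ξ.2) : ℝ) : ℂ) :=
      measurable_ofReal.comp (hB.comp measurable_snd)
    have h3 : Measurable fun ξ : ℝ × ℝ => ((|ξ.2| : ℝ) : ℂ) :=
      measurable_ofReal.comp (continuous_abs.measurable.comp measurable_snd)
    exact ((h3.const_mul _).div_const _).mul h2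
  exact ((h1.const_sub 1).div (h1.const_add 1)).neg

/-- Everything is decided by the signs of `x = qp` and of `q_t p = x + (p²/m) t`. The gauges cancel
unless these signs differ, that is, unless the line `q = 0` is crossed. A crossing forward in time
leaves `1 - c̄`, one backward leaves `1 - c`, where `c` is the collision phase; this is the origin
of `sgn t` in the denominator. -/
theorem gauge_mul_conj_gauge {m : ℝ} (hm : 0 < m) (B : ℝ → OnePoint ℝ) (t : ℝ) {ξ : ℝ × ℝ}
    (hq : ξ.1 ≠ 0) (hp : ξ.2 ≠ 0) (hqt : ξ.1 + ξ.2 * t / m ≠ 0) :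
    (1 - gauge m B ξ * (starRingEnd ℂ) (gauge m B (ξ.1 + ξ.2 * t / m, ξ.2))) / 2 =
      heaviside (-(t * ξ.1 * ξ.2)) * heaviside (|ξ.2 * t| / m - |ξ.1|) /
      (1 - Real.sign t * (2 * I * |ξ.2| / m * recip (B ξ.2))) := by
  obtain ⟨q, p⟩ := ξ
  simp only at hq hp hqt ⊢
  have hgg : collisionPhase m B p * (starRingEnd ℂ) (collisionPhase m B p) = 1 := by
    rw [Complex.mul_conj, Complex.normSq_eq_norm_sq, norm_collisionPhase]
    simp
  have e2 : (q + p * t / m) * p = q * p + p ^ 2 * t / m := by ring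
  have hpp : 0 < p ^ 2 := by positivity
  have hx : q * p ≠ 0 := mul_ne_zero hq hp
  have hy : (q + p * t / m) * p ≠ 0 := mul_ne_zero hqt hp
  -- Multiplying by `|p|` expresses the crossing condition through `qp` and `p²/m` alone.
  have hcr : 0 < |p * t| / m - |q| ↔ |q * p| < p ^ 2 * |t| / m := by
    have : |p| * (|p * t| / m - |q|) = p ^ 2 * |t| / m - |q * p| := by
      rw [abs_mul, abs_mul, ← sq_abs p]
      ring
    rw [← sub_pos (a := p ^ 2 * |t| / m), ← this]
    exact (mul_pos_iff_of_pos_left (abs_pos.2 hp)).symm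
  have htx : -(t * q * p) = -(t * (q * p)) := by ring
  simp only [gauge, heaviside, hcr, htx, e2] at hy ⊢
  have hpt : 0 < p ^ 2 / m := by positivity
  rw [show p ^ 2 * t / m = p ^ 2 / m * t by ring] at hy ⊢
  rw [show p ^ 2 * |t| / m = p ^ 2 / m * |t| by ring]
  generalize q * p = x at *
  generalize p ^ 2 / m = k at *
  have hc1 : 1 - collisionPhase m B p = 2 / (1 + 2 * I * |p| / m * recip (B p)) := by
    rw [collisionPhase]
    have h := one_add_ne_zero |p| m (recip (B p))
    rw [sub_neg_eq_add, eq_div_iff h, add_mul, div_mul_cancel₀ _ h]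
    ring
  have hc2 : 1 - (starRingEnd ℂ) (collisionPhase m B p)
      = 2 / (1 - 2 * I * |p| / m * recip (B p)) := by
    rw [conj_collisionPhase]
    have h := one_sub_ne_zero |p| m (recip (B p))
    rw [sub_neg_eq_add, eq_div_iff h, add_mul, div_mul_cancel₀ _ h]
    ring
  rcases lt_trichotomy t 0 with ht | ht | ht
  · have hkt : k * t < 0 := mul_neg_of_pos_of_neg hpt ht
    rw [Real.sign_of_neg ht, abs_of_neg ht]
    by_cases h1 : 0 < x
    · have ha : 0 < -(t * x) := by nlinarith
      rw [if_pos h1, if_pos ha, abs_of_pos h1]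
      by_cases h2 : 0 < x + k * t
      · rw [if_pos h2, if_neg (by linarith), hgg]
        simp
      · rw [if_neg h2, if_pos (by
          have := lt_of_le_of_ne (not_lt.1 h2) hy
          linarith), map_one, mul_one, hc1]
        push_cast
        ring
    · have ha : ¬ 0 < -(t * x) := by nlinarith
      rw [if_neg h1, if_neg ha, if_neg (by linarith)]
      simp
  · subst ht
    by_cases h1 : 0 < x <;> simp [h1, hgg]
  · have hkt : 0 < k * t := mul_pos hpt ht
    rw [Real.sign_of_pos ht, abs_of_pos ht]
    by_cases h1 : 0 < x
    · have ha : ¬ 0 < -(t * x) := by nlinarith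
      rw [if_pos h1, if_neg ha, if_pos (by linarith), hgg]
      simp
    · have hx' : x < 0 := lt_of_le_of_ne (not_lt.1 h1) hx
      have ha : 0 < -(t * x) := by nlinarith
      rw [if_neg h1, if_pos ha, abs_of_neg hx']
      by_cases h2 : 0 < x + k * t
      · rw [if_pos h2, if_pos (by linarith), one_mul, hc2]
        push_cast
        ring
      · rw [if_neg h2, if_neg (by linarith)]
        simp

/-! ### The group generated by the Liouvillian -/

section Evolution

variable {m : ℝ} {B : ℝ → OnePoint ℝ}

/-- Multiplication by `c` on the odd functions, the identity on the even ones. -/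
def oddMul (c : ℝ × ℝ → ℂ) (hc : Measurable c) (hb : ∀ ξ, ‖c ξ‖ ≤ 1) : L2Phase →L[ℂ] L2Phase :=
  (1 / 2 : ℂ) • (1 + reflOp volume) +
    (1 / 2 : ℂ) • (mulOp c hc hb ∘L (1 - reflOp volume))

theorem oddMul_coeFn {c : ℝ × ℝ → ℂ} (hc : Measurable c) (hb : ∀ ξ, ‖c ξ‖ ≤ 1) (f : L2Phase) :
    oddMul c hc hb f =ᵐ[volume]
      fun ξ => 1 / 2 * (f ξ + f (-ξ)) + 1 / 2 * (c ξ * (f ξ - f (-ξ))) := by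
  have e : oddMul c hc hb f = (1 / 2 : ℂ) • (f + reflOp volume f) +
    (1 / 2 : ℂ) • (mulOp c hc hb (f - reflOp volume f)) := rfl
  rw [e]
  filter_upwards [Lp.coeFn_add ((1 / 2 : ℂ) • (f + reflOp volume f))
      ((1 / 2 : ℂ) • (mulOp c hc hb (f - reflOp volume f))),
    Lp.coeFn_smul (1 / 2 : ℂ) (f + reflOp volume f),
    Lp.coeFn_smul (1 / 2 : ℂ) (mulOp c hc hb (f - reflOp volume f)),
    Lp.coeFn_add f (reflOp volume f), Lp.coeFn_sub f (reflOp volume f),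
    mulOp_coeFn hc hb (f - reflOp volume f), reflOp_coeFn f] with ξ h1 h2 h3 h4 h5 h6 h7
  rw [h1, Pi.add_apply, h2, h3]
  simp only [Pi.smul_apply, smul_eq_mul]
  rw [h4, h6, h5, Pi.add_apply, Pi.sub_apply, h7]

theorem oddMul_oddMul {c d : ℝ × ℝ → ℂ} (hc : Measurable c) (hcb : ∀ ξ, ‖c ξ‖ ≤ 1)
    (hd : Measurable d) (hdb : ∀ ξ, ‖d ξ‖ ≤ 1) (hcd : ∀ ξ, c ξ * d ξ = 1)
    (hde : ∀ ξ, d (-ξ) = d ξ) (f : L2Phase) :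
    oddMul c hc hcb (oddMul d hd hdb f) = f := by
  refine Lp.ext ?_
  filter_upwards [oddMul_coeFn hc hcb (oddMul d hd hdb f), oddMul_coeFn hd hdb f,
    ae_comp_neg (oddMul_coeFn hd hdb f)] with ξ h1 h2 h3
  rw [h1, h2, h3, hde, neg_neg]
  linear_combination (1 / 2 * (f ξ - f (-ξ))) * hcd ξ

/-- An even unimodular multiplier maps odd functions isometrically to odd functions, and these are
orthogonal to the even ones. -/
theorem norm_oddMul {c : ℝ × ℝ → ℂ} (hc : Measurable c) (hcb : ∀ ξ, ‖c ξ‖ ≤ 1)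
    (hcn : ∀ ξ, ‖c ξ‖ = 1) (hce : ∀ ξ, c (-ξ) = c ξ) (f : L2Phase) :
    ‖oddMul c hc hcb f‖ = ‖f‖ := by
  have e : oddMul c hc hcb f = (1 / 2 : ℂ) • (f + reflOp volume f) +
    (1 / 2 : ℂ) • (mulOp c hc hcb (f - reflOp volume f)) := rfl
  set g := mulOp c hc hcb (f - reflOp volume f) with hg
  have hRg : reflOp volume g = -g := by
    rw [hg, reflOp_mulOp hc hcb hc hcb (Eventually.of_forall hce), map_sub, reflOp_reflOp,
      ← map_neg, neg_sub]
  have orth : ∀ v : L2Phase, reflOp volume v = -v → inner ℂ (f + reflOp volume f) v = 0 := by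
    intro v hv
    have h1 := inner_reflOp (f + reflOp volume f) v
    rw [hv, map_add, reflOp_reflOp, inner_neg_right, add_comm (reflOp volume f)] at h1
    exact self_eq_neg.1 h1
  have hgn : ‖g‖ = ‖f - reflOp volume f‖ := norm_mulOp_apply hc hcb hcn _
  have e2 : f = (1 / 2 : ℂ) • (f + reflOp volume f) + (1 / 2 : ℂ) • (f - reflOp volume f) := by
    module
  have o1 : inner ℂ ((1 / 2 : ℂ) • (f + reflOp volume f)) ((1 / 2 : ℂ) • g) = 0 := by
    rw [inner_smul_left, inner_smul_right, orth g hRg]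
    simp
  have o2 : inner ℂ ((1 / 2 : ℂ) • (f + reflOp volume f))
      ((1 / 2 : ℂ) • (f - reflOp volume f)) = 0 := by
    rw [inner_smul_left, inner_smul_right, orth _ (by rw [map_sub, reflOp_reflOp, neg_sub])]
    simp
  have n1 := norm_add_sq_eq_norm_sq_add_norm_sq_of_inner_eq_zero _ _ o1
  have n2 := norm_add_sq_eq_norm_sq_add_norm_sq_of_inner_eq_zero _ _ o2
  rw [← e2] at n2
  rw [← e] at n1
  have hgn' : ‖(1 / 2 : ℂ) • g‖ = ‖(1 / 2 : ℂ) • (f - reflOp volume f)‖ := by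
    rw [norm_smul, norm_smul, hgn]
  rw [hgn', ← n2] at n1
  nlinarith [norm_nonneg f, norm_nonneg (oddMul c hc hcb f)]

theorem measurable_conj_gauge (m : ℝ) (hB : Measurable fun p => recip (B p)) :
    Measurable fun ξ => (starRingEnd ℂ) (gauge m B ξ) :=
  continuous_conj.measurable.comp (measurable_gauge m hB)

theorem norm_gauge_le (m : ℝ) (B : ℝ → OnePoint ℝ) (ξ : ℝ × ℝ) : ‖gauge m B ξ‖ ≤ 1 :=
  (norm_gauge m B ξ).le

theorem norm_conj_gauge_le (m : ℝ) (B : ℝ → OnePoint ℝ) (ξ : ℝ × ℝ) :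
    ‖(starRingEnd ℂ) (gauge m B ξ)‖ ≤ 1 := by
  rw [RCLike.norm_conj]
  exact norm_gauge_le m B ξ

theorem gauge_mul_conj_self (m : ℝ) (B : ℝ → OnePoint ℝ) (ξ : ℝ × ℝ) :
    gauge m B ξ * (starRingEnd ℂ) (gauge m B ξ) = 1 := by
  rw [Complex.mul_conj, Complex.normSq_eq_norm_sq, norm_gauge]
  simp

variable (m) in
/-- The group `e^{-isL_B}`. -/
def liouvilleGroup (hB : Measurable fun p => recip (B p)) (s : ℝ) : L2Phase →L[ℂ] L2Phase :=
  oddMul (gauge m B) (measurable_gauge m hB) (norm_gauge_le m B) ∘L freeGroup m s ∘L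
    oddMul (fun ξ => (starRingEnd ℂ) (gauge m B ξ)) (measurable_conj_gauge m hB)
      (norm_conj_gauge_le m B)

theorem isIsometryGroup_liouvilleGroup (m : ℝ) (hB : Measurable fun p => recip (B p))
    (hBe : ∀ p, B (-p) = B p) : IsIsometryGroup (liouvilleGroup m hB) := by
  have hge : ∀ ξ, (starRingEnd ℂ) (gauge m B (-ξ)) = (starRingEnd ℂ) (gauge m B ξ) :=
    fun ξ => by rw [gauge_neg hBe]
  have hcan : ∀ f, oddMul (gauge m B) (measurable_gauge m hB) (norm_gauge_le m B)
      (oddMul (fun ξ => (starRingEnd ℂ) (gauge m B ξ)) (measurable_conj_gauge m hB)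
      (norm_conj_gauge_le m B) f) = f :=
    oddMul_oddMul _ _ _ _ (gauge_mul_conj_self m B) hge
  have hcan' : ∀ f, oddMul (fun ξ => (starRingEnd ℂ) (gauge m B ξ)) (measurable_conj_gauge m hB)
      (norm_conj_gauge_le m B) (oddMul (gauge m B) (measurable_gauge m hB) (norm_gauge_le m B)
      f) = f :=
    oddMul_oddMul _ _ _ _ (fun ξ => by rw [mul_comm, gauge_mul_conj_self]) (gauge_neg hBe)
  have h0 := isIsometryGroup_freeGroup m
  constructor
  · intro f
    simp only [liouvilleGroup, ContinuousLinearMap.comp_apply, h0.map_zero, hcan]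
  · intro s t f
    simp only [liouvilleGroup, ContinuousLinearMap.comp_apply, h0.map_add, hcan']
  · intro s f
    simp only [liouvilleGroup, ContinuousLinearMap.comp_apply]
    rw [norm_oddMul _ _ (norm_gauge m B) (gauge_neg hBe), h0.norm_map, norm_oddMul _ _
      (fun ξ => by rw [RCLike.norm_conj]; exact norm_gauge m B ξ) hge]
  · intro f
    exact (oddMul (gauge m B) (measurable_gauge m hB) (norm_gauge_le m B)).continuous.comp
      (h0.continuous (oddMul (fun ξ => (starRingEnd ℂ) (gauge m B ξ)) (measurable_conj_gauge m hB)
        (norm_conj_gauge_le m B) f))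

/-- Between the two gauges the flow multiplies the odd part by the gauge at the endpoint times the
conjugate gauge at the starting point. Half of one minus this product is the reflected weight. -/
theorem liouvilleGroup_coeFn (hm : 0 < m) (hB : Measurable fun p => recip (B p))
    (hBe : ∀ p, B (-p) = B p) (s : ℝ) (f : L2Phase) :
    liouvilleGroup m hB s f =ᵐ[volume] classicalEvolution m B (-s) f := by
  set g := oddMul (fun ξ => (starRingEnd ℂ) (gauge m B ξ)) (measurable_conj_gauge m hB)
    (norm_conj_gauge_le m B) f with hg
  have hg1 : g =ᵐ[volume] fun ξ => 1 / 2 * (f ξ + f (-ξ))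
      + 1 / 2 * ((starRingEnd ℂ) (gauge m B ξ) * (f ξ - f (-ξ))) :=
    oddMul_coeFn (measurable_conj_gauge m hB) (norm_conj_gauge_le m B) f
  have e : liouvilleGroup m hB s f =
    oddMul (gauge m B) (measurable_gauge m hB) (norm_gauge_le m B) (freeGroup m s g) := rfl
  rw [e]
  have hflow := measurePreserving_backwardFlow m s
  have hq : ∀ᵐ ξ : ℝ × ℝ, ξ.1 ≠ 0 :=
    Measure.quasiMeasurePreserving_fst.ae (Measure.ae_ne volume (0 : ℝ))
  have hp : ∀ᵐ ξ : ℝ × ℝ, ξ.2 ≠ 0 :=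
    Measure.quasiMeasurePreserving_snd.ae (Measure.ae_ne volume (0 : ℝ))
  filter_upwards [oddMul_coeFn (measurable_gauge m hB) (norm_gauge_le m B) (freeGroup m s g),
    freeGroup_coeFn m s g, ae_comp_neg (freeGroup_coeFn m s g),
    hflow.quasiMeasurePreserving.ae hg1,
    ae_comp_neg (hflow.quasiMeasurePreserving.ae hg1), hq, hp,
    hflow.quasiMeasurePreserving.ae hq] with ξ h1 h2 h3 h4 h5 hq hp hqt
  have hneg : backwardFlow m s (-ξ) = -backwardFlow m s ξ := by
    ext
    · simp only [backwardFlow, Prod.fst_neg, Prod.snd_neg]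
      ring
    · rfl
  rw [h1, h2, h3, h4, h5, hneg, neg_neg, gauge_neg hBe]
  have key := gauge_mul_conj_gauge hm B (-s) hq hp hqt
  rw [classicalEvolution, ← key]
  simp only [freeEvolution]
  change _ = f (backwardFlow m s ξ) - (1 - gauge m B ξ * (starRingEnd ℂ)
    (gauge m B (backwardFlow m s ξ))) / 2 * (f (backwardFlow m s ξ) - f (-backwardFlow m s ξ))
  ring

/-! ### Kreĭn's formula -/

/-- The substitution `q' = q - εps/m` parametrizes the integral by time along a trajectory; its
Jacobian `|p|/m` cancels the prefactor of the kernel. The sign `ε` of `Im z` treats both half-planes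
together. -/
theorem freeResolvent_eq (hm : 0 < m) {z : ℂ} {ε : ℝ} (hε : ε = 1 ∨ ε = -1)
    (hz : 0 < ε * z.im) (f : ℝ × ℝ → ℂ) {q p : ℝ} (hp : p ≠ 0) :
    freeResolvent m z f (q, p) =
      ε * I * ∫ s in Set.Ioi (0 : ℝ), cexp (I * (ε * z) * s) * f (q - ε * p * s / m, p) := by
  have hεε : ε * ε = 1 := by rcases hε with h | h <;> simp [h]
  have hε0 : ε ≠ 0 := by rcases hε with h | h <;> simp [h]
  have hsign : Real.sign z.im = ε := by
    rcases hε with h | h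
    · rw [h, one_mul] at hz; rw [Real.sign_of_pos hz, h]
    · rw [Real.sign_of_neg (by rw [h] at hz; linarith), h]
  have ha : -(ε * p / m) ≠ 0 := neg_ne_zero.2 (div_ne_zero (mul_ne_zero hε0 hp) hm.ne')
  have hcv := Measure.integral_comp_mul_left
    (fun y => freeKernel m z (q - (q + y)) p * f (q + y, p)) (-(ε * p / m))
  rw [integral_add_left_eq_self (fun y => freeKernel m z (q - y) p * f (y, p)) q] at hcv
  have habs : |(-(ε * p / m))⁻¹| = m / |p| := by
    rw [abs_inv, abs_neg, abs_div, abs_mul, abs_of_pos hm]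
    have : |ε| = 1 := by rcases hε with h | h <;> simp [h]
    rw [this, one_mul, inv_div]
  rw [habs] at hcv
  have hpa : 0 < |p| := abs_pos.2 hp
  have hm' : (m : ℂ) ≠ 0 := ofReal_ne_zero.2 hm.ne'
  have hpc : ((|p| : ℝ) : ℂ) ≠ 0 := ofReal_ne_zero.2 hpa.ne'
  have h1 : freeResolvent m z f (q, p) = ((|p| / m : ℝ) : ℂ) * ∫ s : ℝ,
      freeKernel m z (q - (q + -(ε * p / m) * s)) p * f (q + -(ε * p / m) * s, p) := by
    rw [hcv, freeResolvent, real_smul, ← mul_assoc, ← ofReal_mul, div_mul_div_cancel₀ hm.ne',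
      div_self hpa.ne', ofReal_one, one_mul]
  rw [h1, ← integral_indicator measurableSet_Ioi, ← integral_const_mul, ← integral_const_mul]
  congr 1
  ext s
  have hker : q - (q + -(ε * p / m) * s) = ε * p * s / m := by ring
  have harg : q + -(ε * p / m) * s = q - ε * p * s / m := by ring
  have hhv : heaviside (ε * p * s / m * p * z.im) = if 0 < s then 1 else 0 := by
    have : ε * p * s / m * p * z.im = (p ^ 2 / m * (ε * z.im)) * s := by ring
    rw [heaviside, this]
    have hpos : 0 < p ^ 2 / m * (ε * z.im) := by positivity
    simp only [mul_pos_iff_of_pos_left hpos]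
  rw [hker, harg, freeKernel, hhv, hsign]
  by_cases hs : 0 < s
  · rw [Set.indicator_of_mem (show s ∈ Set.Ioi 0 from hs), if_pos hs]
    have hpc' : (p : ℂ) ≠ 0 := ofReal_ne_zero.2 hp
    have hexp : I * m * z * ((ε * p * s / m : ℝ) : ℂ) / p = I * (ε * z) * s := by
      push_cast
      field_simp
    rw [hexp]
    push_cast
    field_simp
  · rw [Set.indicator_of_notMem (show s ∉ Set.Ioi 0 from hs), if_neg hs]
    simp

theorem integrableOn_exp_mul {z : ℂ} (hz : 0 < z.im) {f : ℝ → ℂ} (hf : MemLp f 2 volume)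
    {a : ℝ} (ha : a ≠ 0) (q : ℝ) :
    IntegrableOn (fun s : ℝ => cexp (I * z * s) * f (q + a * s)) (Set.Ioi 0) := by
  have h1 : MemLp (fun s : ℝ => f (q + a * s)) 2 volume := by
    have h2 : MemLp (fun s : ℝ => f (q + s)) 2 volume :=
      hf.comp_measurePreserving (measurePreserving_add_left volume q)
    have hq : AEStronglyMeasurable (fun s : ℝ => f (q + a * s)) volume :=
      h2.1.comp_quasiMeasurePreserving (Measure.quasiMeasurePreserving_smul volume ha)
    rw [memLp_two_iff_integrable_sq_norm hq]
    have h3 := (memLp_two_iff_integrable_sq_norm h2.1).1 h2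
    exact h3.comp_mul_left' ha
  have h4 : MemLp (fun s : ℝ => cexp (I * z * s)) 2 (volume.restrict (Set.Ioi 0)) := by
    have hc : Continuous fun s : ℝ => cexp (I * z * s) := by fun_prop
    rw [memLp_two_iff_integrable_sq_norm hc.aestronglyMeasurable]
    refine (exp_neg_integrableOn_Ioi 0 (by positivity : 0 < 2 * z.im)).congr
      (Eventually.of_forall fun s => ?_)
    simp only [Complex.norm_exp, ← Real.exp_nat_mul]
    congr 1
    simp
    ring
  exact h4.integrable_mul (h1.mono_measure Measure.restrict_le_self)

/-- In the Laplace transform the reflected term is present only after the collision time. Shifting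
time by it extracts the free kernel `e^{imzq/p}` and leaves Laplace transforms along the
trajectories started on the line `q = 0`, which are the traces of the free resolvent. -/
theorem kreinResolvent_eq (hm : 0 < m) {z : ℂ} {ε : ℝ} (hε : ε = 1 ∨ ε = -1)
    (hz : 0 < ε * z.im) {f : ℝ × ℝ → ℂ} {q p : ℝ} (hq : q ≠ 0) (hp : p ≠ 0)
    (hf : MemLp (fun x => f (x, p)) 2 volume) (hf' : MemLp (fun x => f (x, -p)) 2 volume) :
    ε * I * ∫ s in Set.Ioi (0 : ℝ),
        cexp (I * (ε * z) * s) * classicalEvolution m B (-(ε * s)) f (q, p)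
      = kreinResolvent m B z f (q, p) := by
  have hεε : ε * ε = 1 := by rcases hε with h | h <;> simp [h]
  have hε0 : ε ≠ 0 := by rcases hε with h | h <;> simp [h]
  have hεa : |ε| = 1 := by rcases hε with h | h <;> simp [h]
  have hsign : Real.sign z.im = ε := by
    rcases hε with h | h
    · rw [h, one_mul] at hz; rw [Real.sign_of_pos hz, h]
    · rw [Real.sign_of_neg (by rw [h] at hz; linarith), h]
  have hzim : 0 < ((ε : ℂ) * z).im := by simpa using hz
  have hpa : 0 < |p| := abs_pos.2 hp
  -- The time needed to travel from `q` to the line `q = 0`.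
  set τ : ℝ := m * |q| / |p| with hτ
  have hτ0 : 0 ≤ τ := by positivity
  set X : ℂ := 2 * I * |p| / m * recip (B p) with hX
  set F : ℝ → ℂ := fun s => cexp (I * (ε * z) * s) * f (q - ε * p * s / m, p) with hF
  set G : ℝ → ℂ := fun s => cexp (I * (ε * z) * s) * f (-(q - ε * p * s / m), -p) with hG
  have hFi : IntegrableOn F (Set.Ioi 0) := by
    have := integrableOn_exp_mul hzim hf (a := -(ε * p / m))
      (neg_ne_zero.2 (div_ne_zero (mul_ne_zero hε0 hp) hm.ne')) q
    refine this.congr_fun (fun s _ => ?_) measurableSet_Ioi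
    simp only [hF]
    congr 3
    ring
  have hGi : IntegrableOn G (Set.Ioi 0) := by
    have := integrableOn_exp_mul hzim hf' (a := (ε * p / m))
      ((div_ne_zero (mul_ne_zero hε0 hp) hm.ne')) (-q)
    refine this.congr_fun (fun s _ => ?_) measurableSet_Ioi
    simp only [hG]
    congr 3
    ring
  have hev : ∀ s ∈ Set.Ioi (0 : ℝ),
      cexp (I * (ε * z) * s) * classicalEvolution m B (-(ε * s)) f (q, p) = F s -
        heaviside (ε * q * p) / (1 + ε * X) *
          (Set.Ioi τ).indicator (fun s => F s - G s) s := by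
    intro s hs
    have hs' : 0 < s := hs
    have hsg : Real.sign (-(ε * s)) = -ε := by
      rcases hε with h | h
      · rw [h, Real.sign_of_neg (by linarith)]
      · rw [h, Real.sign_of_pos (by linarith)]; norm_num
    have h1 : heaviside (-(-(ε * s) * q * p)) = heaviside (ε * q * p) := by
      unfold heaviside
      rw [show -(-(ε * s) * q * p) = s * (ε * q * p) by ring]
      simp only [mul_pos_iff_of_pos_left hs']
    have h2 : heaviside (|p * (-(ε * s))| / m - |q|) = if τ < s then 1 else 0 := by
      unfold heaviside
      rw [abs_mul, abs_neg, abs_mul, hεa, one_mul, abs_of_pos hs']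
      have : 0 < |p| * s / m - |q| ↔ τ < s := by
        rw [sub_pos, lt_div_iff₀ hm, hτ, div_lt_iff₀ hpa, mul_comm m, mul_comm s]
      simp only [this]
    have h3 : q + p * (-(ε * s)) / m = q - ε * p * s / m := by ring
    simp only [classicalEvolution, freeEvolution]
    rw [hsg, h1, h2, h3]
    simp only [Prod.neg_mk]
    rw [← hX]
    by_cases hτs : τ < s
    · rw [if_pos hτs, Set.indicator_of_mem (show s ∈ Set.Ioi τ from hτs)]
      simp only [hF, hG]
      push_cast
      ring
    · rw [if_neg hτs, Set.indicator_of_notMem (show s ∉ Set.Ioi τ from hτs)]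
      simp only [hF]
      push_cast
      ring
  rw [setIntegral_congr_fun measurableSet_Ioi hev]
  have hFGi : IntegrableOn (fun s => F s - G s) (Set.Ioi 0) := hFi.sub hGi
  rw [integral_sub hFi ((hFGi.indicator measurableSet_Ioi).const_mul _), integral_const_mul,
    setIntegral_indicator measurableSet_Ioi, Set.Ioi_inter_Ioi, sup_of_le_right hτ0]
  rw [kreinResolvent, freeResolvent_eq hm hε hz f hp]
  simp only
  rw [freeResolvent_eq hm hε hz f hp, freeResolvent_eq hm hε hz f (neg_ne_zero.2 hp)]
  rw [mul_sub, sub_eq_add_neg]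
  congr 1
  rw [freeKernel, hsign]
  have hhv : heaviside (q * p * z.im) = heaviside (ε * q * p) := by
    unfold heaviside
    have : q * p * z.im = (ε * z.im) * (ε * q * p) := by
      linear_combination (-q * p * z.im) * hεε
    rw [this]
    simp only [mul_pos_iff_of_pos_left hz]
  rw [hhv]
  by_cases hc : 0 < ε * q * p
  · have hh : heaviside (ε * q * p) = 1 := by simp [heaviside, hc]
    rw [hh]
    have hqτ : ε * p * τ / m = q := by
      have hsq : q * |p| = ε * p * |q| := by
        rcases hε with h | h <;> rcases lt_or_gt_of_ne hp with hp' | hp' <;>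
          rcases lt_or_gt_of_ne hq with hq' | hq' <;>
          simp only [h, abs_of_pos, abs_of_neg, hp', hq'] at hc ⊢ <;> nlinarith
      rw [hτ]
      field_simp
      linarith
    have hsh : ∫ s in Set.Ioi τ, (F s - G s) = cexp (I * m * z * q / p) *
        ((∫ s in Set.Ioi (0 : ℝ), cexp (I * (ε * z) * s) * f (0 - ε * p * s / m, p)) -
        ∫ s in Set.Ioi (0 : ℝ), cexp (I * (ε * z) * s) * f (0 - ε * (-p) * s / m, -p)) := by
      have i1 : IntegrableOn (fun s : ℝ => cexp (I * (ε * z) * s) * f (0 - ε * p * s / m, p))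
          (Set.Ioi 0) := by
        have := integrableOn_exp_mul hzim hf (a := -(ε * p / m))
          (neg_ne_zero.2 (div_ne_zero (mul_ne_zero hε0 hp) hm.ne')) 0
        refine this.congr_fun (fun s _ => ?_) measurableSet_Ioi
        simp only
        congr 3
        ring
      have i2 : IntegrableOn
          (fun s : ℝ => cexp (I * (ε * z) * s) * f (0 - ε * (-p) * s / m, -p)) (Set.Ioi 0) := by
        have := integrableOn_exp_mul hzim hf' (a := (ε * p / m))
          ((div_ne_zero (mul_ne_zero hε0 hp) hm.ne')) 0
        refine this.congr_fun (fun s _ => ?_) measurableSet_Ioi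
        simp only
        congr 3
        ring
      rw [← integral_sub i1 i2, ← integral_const_mul, ← zero_add τ,
        ← setIntegral_Ioi_comp_add_right]
      refine integral_congr_ae (Eventually.of_forall fun s => ?_)
      simp only [hF, hG]
      have hexp : cexp (I * (ε * z) * ((s + τ : ℝ) : ℂ))
          = cexp (I * m * z * q / p) * cexp (I * (ε * z) * s) := by
        rw [← Complex.exp_add]
        congr 1
        have hτc : (ε : ℂ) * τ = m * q / p := by
          rw [← ofReal_mul, ← ofReal_mul, ← ofReal_div]
          congr 1
          rw [← hqτ]
          field_simp
        push_cast
        linear_combination (I * z) * hτc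
      have hx1 : q - ε * p * (s + τ) / m = 0 - ε * p * s / m := by
        conv_lhs => rw [← hqτ]
        ring
      have hx2 : -(0 - ε * p * s / m) = 0 - ε * (-p) * s / m := by ring
      rw [hexp, hx1, hx2]
      ring
    rw [hsh]
    have hXne : (1 + ε * X) ≠ 0 := by
      rcases hε with h | h
      · rw [h, hX, ofReal_one, one_mul]; exact one_add_ne_zero _ _ _
      · rw [h, hX]
        have := one_sub_ne_zero |p| m (recip (B p))
        convert this using 1
        push_cast; ring
    have hm' : (m : ℂ) ≠ 0 := ofReal_ne_zero.2 hm.ne'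
    have hpc : ((|p| : ℝ) : ℂ) ≠ 0 := ofReal_ne_zero.2 hpa.ne'
    have hεc : (ε : ℂ) * ε = 1 := by rw [← ofReal_mul, hεε, ofReal_one]
    -- Up to the factor `-ε i m/(2|p|)`, the denominator of Kreĭn's formula is the one of the
    -- evolution.
    have hden : (recip (B p) : ℂ) - ε * (I * m / (2 * (|p| : ℝ)))
        = -(ε * (I * m / (2 * (|p| : ℝ)))) * (1 + ε * X) := by
      rw [hX]
      field_simp
      linear_combination (2 * (recip (B p) : ℂ) * (|p| : ℝ) * I ^ 2) * hεc
        + (2 * (recip (B p) : ℂ) * (|p| : ℝ)) * I_sq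
    rw [hden]
    have hεc0 : (ε : ℂ) ≠ 0 := ofReal_ne_zero.2 hε0
    push_cast
    field_simp
  · have hh : heaviside (ε * q * p) = 0 := by simp [heaviside, hc]
    rw [hh]
    simp

/-- By Fubini; the identity for the Kreĭn resolvent requires square integrability along the lines of
momentum `p` and `-p`. -/
theorem ae_memLp_slice (f : L2Phase) :
    ∀ᵐ ξ : ℝ × ℝ, MemLp (fun x => f (x, ξ.2)) 2 volume ∧
      MemLp (fun x => f (x, -ξ.2)) 2 volume := by
  have hm : StronglyMeasurable (f : ℝ × ℝ → ℂ) := Lp.stronglyMeasurable f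
  have h1 : Integrable (fun ξ : ℝ × ℝ => ‖f ξ‖ ^ 2) (volume.prod volume) :=
    (memLp_two_iff_integrable_sq_norm hm.aestronglyMeasurable).1 (Lp.memLp f)
  have h2 : ∀ᵐ p : ℝ, MemLp (fun x => f (x, p)) 2 volume := by
    filter_upwards [h1.prod_left_ae] with p hp
    rw [memLp_two_iff_integrable_sq_norm]
    · exact hp
    · exact (hm.comp_measurable (measurable_id.prodMk measurable_const)).aestronglyMeasurable
  have h3 := h2.and (ae_comp_neg h2)
  exact Measure.quasiMeasurePreserving_snd.ae h3

theorem measurable_classicalEvolution (hB : Measurable fun p => recip (B p)) (ε : ℝ)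
    (f : L2Phase) :
    Measurable fun x : ℝ × (ℝ × ℝ) => classicalEvolution m B (-(ε * x.1)) f x.2 := by
  have hf : Measurable (f : ℝ × ℝ → ℂ) := (Lp.stronglyMeasurable f).measurable
  have hh : Measurable heaviside :=
    Measurable.ite (measurableSet_lt measurable_const measurable_id) measurable_const
      measurable_const
  have hs : Measurable Real.sign := by
    unfold Real.sign
    exact Measurable.ite (measurableSet_lt measurable_id measurable_const) measurable_const
      (Measurable.ite (measurableSet_lt measurable_const measurable_id) measurable_const
        measurable_const)
  have hB' : Measurable fun x : ℝ × (ℝ × ℝ) => ((recip (B x.2.2) : ℝ) : ℂ) :=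
    measurable_ofReal.comp (hB.comp (measurable_snd.comp measurable_snd))
  have h1 : Measurable fun x : ℝ × (ℝ × ℝ) =>
      ((heaviside (-(-(ε * x.1) * x.2.1 * x.2.2)) : ℝ) : ℂ) :=
    measurable_ofReal.comp (hh.comp (by fun_prop))
  have h2 : Measurable fun x : ℝ × (ℝ × ℝ) =>
      ((heaviside (|x.2.2 * (-(ε * x.1))| / m - |x.2.1|) : ℝ) : ℂ) :=
    measurable_ofReal.comp (hh.comp (by
      have : Continuous fun x : ℝ × (ℝ × ℝ) => |x.2.2 * (-(ε * x.1))| / m - |x.2.1| := by fun_prop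
      exact this.measurable))
  have h3 : Measurable fun x : ℝ × (ℝ × ℝ) => ((Real.sign (-(ε * x.1)) : ℝ) : ℂ) :=
    measurable_ofReal.comp (hs.comp (by fun_prop))
  have h4 : Measurable fun x : ℝ × (ℝ × ℝ) => (2 * I * (|x.2.2| : ℝ) / m : ℂ) := by
    have : Continuous fun x : ℝ × (ℝ × ℝ) => (2 * I * (|x.2.2| : ℝ) / m : ℂ) := by fun_prop
    exact this.measurable
  have h5 : Measurable fun x : ℝ × (ℝ × ℝ) => (x.2.1 + x.2.2 * (-(ε * x.1)) / m, x.2.2) := by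
    fun_prop
  unfold classicalEvolution freeEvolution
  exact (hf.comp h5).sub (((h1.mul h2).div ((h3.mul (h4.mul hB')).const_sub 1)).mul
    ((hf.comp h5).sub (hf.comp h5.neg)))

/-- For `Im z > 0` the Laplace transform of the group is Kreĭn's resolvent. For `Im z < 0` the same
holds for the time-reversed group at `-z`, with the sign of the operator changed. One inclusion uses
only `z = i`, the other all non-real `z`. -/
theorem liouvillian_eq_generatorGraph (hm : 0 < m) (hB : Measurable fun p => recip (B p))
    (hBe : ∀ p, B (-p) = B p) : liouvillian m B = generatorGraph (liouvilleGroup m hB) := by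
  have hU := isIsometryGroup_liouvilleGroup m hB hBe
  have hq : ∀ᵐ ξ : ℝ × ℝ, ξ.1 ≠ 0 :=
    Measure.quasiMeasurePreserving_fst.ae (Measure.ae_ne volume (0 : ℝ))
  have hp : ∀ᵐ ξ : ℝ × ℝ, ξ.2 ≠ 0 :=
    Measure.quasiMeasurePreserving_snd.ae (Measure.ae_ne volume (0 : ℝ))
  have hpos : ∀ (z : ℂ), 0 < z.im → ∀ f : L2Phase,
      ((laplaceResolvent (liouvilleGroup m hB) z f : L2Phase) : ℝ × ℝ → ℂ) =ᵐ[volume] kreinResolvent m B z f := by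
    intro z hz f
    refine (laplaceResolvent_ae hU hz f (measurable_classicalEvolution (m := m) hB 1 f)
      fun s => ?_).trans ?_
    · simpa using liouvilleGroup_coeFn hm hB hBe s f
    · filter_upwards [hq, hp, ae_memLp_slice f] with ξ h1 h2 h3
      have := kreinResolvent_eq (B := B) hm (z := z) (ε := 1) (Or.inl rfl) (by simpa) h1 h2
        h3.1 h3.2
      simpa using this
  have hneg : ∀ (z : ℂ), z.im < 0 → ∀ f : L2Phase,
      ((laplaceResolvent (fun s => liouvilleGroup m hB (-s)) (-z) (-f) : L2Phase) :
        ℝ × ℝ → ℂ) =ᵐ[volume]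
        kreinResolvent m B z f := by
    intro z hz f
    have hz' : 0 < (-z).im := by simpa using hz
    have hlin : laplaceResolvent (fun s => liouvilleGroup m hB (-s)) (-z) (-f)
        = -laplaceResolvent (fun s => liouvilleGroup m hB (-s)) (-z) f := by
      simp only [laplaceResolvent, map_neg, smul_neg, integral_neg]
    rw [hlin]
    refine (Lp.coeFn_neg _).trans ?_
    have h := laplaceResolvent_ae hU.neg hz' f (measurable_classicalEvolution (m := m) hB (-1) f)
      fun s => by simpa using liouvilleGroup_coeFn hm hB hBe (-s) f
    filter_upwards [h, hq, hp, ae_memLp_slice f] with ξ h0 h1 h2 h3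
    rw [Pi.neg_apply, h0]
    have := kreinResolvent_eq (B := B) hm (z := z) (ε := -1) (Or.inr rfl) (by simpa using hz) h1 h2
        h3.1 h3.2
    rw [← this]
    simp
  ext ⟨x, y⟩
  constructor
  · intro h
    rw [hU.mem_generatorGraph_iff (z := I) (by simp)]
    exact Lp.ext ((h I (by simp)).trans (hpos I (by simp) _).symm)
  · intro h z hz
    rcases lt_or_gt_of_ne hz with hz | hz
    · have h1 := generatorGraph_neg_iff.1 h
      rw [hU.neg.mem_generatorGraph_iff (z := -z) (by simpa using hz)] at h1
      have h2 := hneg z hz (y - z • x)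
      have e : -y - -z • x = -(y - z • x) := by module
      rw [e] at h1
      rw [← h1] at h2
      exact h2
    · rw [hU.mem_generatorGraph_iff hz] at h
      have h2 := hpos z hz (y - z • x)
      rw [← h] at h2
      exact h2

end Evolution

/-! ### Measurability and parity of the coupling function -/

theorem measurable_recip_coupling (ħ : ℝ) (β : OnePoint ℝ) :
    Measurable fun p => recip (coupling ħ β p) := by
  induction β using OnePoint.rec with
  | infty => exact measurable_const
  | coe b =>
    change Measurable fun p : ℝ => (-(2 * b / ħ ^ 3) * p ^ 2)⁻¹
    fun_prop

theorem coupling_neg (ħ : ℝ) (β : OnePoint ℝ) (p : ℝ) : coupling ħ β (-p) = coupling ħ β p := by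
  induction β using OnePoint.rec with
  | infty => rfl
  | coe b => simp [coupling]

end DeltaPrime

end


open MeasureTheory Filter Topology Complex

noncomputable section

namespace DeltaPrime

/-! ### The half-line reduction in abstract form -/

section Abstract

variable {H : Type*} [NormedAddCommGroup H] [InnerProductSpace ℂ H]

/-- Restriction of the fixed vectors of `J` to the half-line, followed by odd extension. -/
def oddRestriction (R Θ J : H →L[ℂ] H) : H →L[ℂ] H := (1 / 2 : ℂ) • ((1 - R) * Θ * (1 + J))

/-- The adjoint of `oddRestriction`. -/
def oddExtension (R Θ J : H →L[ℂ] H) : H →L[ℂ] H := (1 / 2 : ℂ) • ((1 + J) * Θ * (1 - R))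

/-- The projection onto the even vectors. -/
def evenProj (R : H →L[ℂ] H) : H →L[ℂ] H := (1 / 2 : ℂ) • (1 + R)

/-- The projection onto the odd bound state. -/
def boundProj (R B : H →L[ℂ] H) : H →L[ℂ] H := (1 / 2 : ℂ) • ((1 - R) * B * (1 - R))

/-- The intertwining relations of the evolution with its building blocks. -/
structure IsCommuting (R J : H →L[ℂ] H) (U₀ : ℝ → H →L[ℂ] H) : Prop where
  R_U : ∀ t, R * U₀ t = U₀ t * R
  J_U : ∀ t, J * U₀ t = U₀ t * J

theorem IsCommuting.even_U {R J : H →L[ℂ] H} {U₀ : ℝ → H →L[ℂ] H} (hc : IsCommuting R J U₀) (t : ℝ) :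
    evenProj R * U₀ t = U₀ t * evenProj R := by
  rw [evenProj, smul_mul_assoc, mul_smul_comm, add_mul, mul_add, hc.R_U, one_mul, mul_one]

theorem IsCommuting.half_U {R J : H →L[ℂ] H} {U₀ : ℝ → H →L[ℂ] H}
    (hc : IsCommuting R J U₀) (t : ℝ) :
    (1 / 2 : ℂ) • (1 + J) * U₀ t = U₀ t * ((1 / 2 : ℂ) • (1 + J)) := by
  rw [smul_mul_assoc, mul_smul_comm, add_mul, mul_add, hc.J_U, one_mul, mul_one]

variable [CompleteSpace H]

/-- The algebraic relations between the reflection `R`, the projection `Θ` onto the positive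
half-line, the involution `J` implementing the boundary condition, the projection `B` onto the
bound state of the half-line and the projection `D` onto the one of the reflected condition. -/
structure HalfLineData (R Θ J B D : H →L[ℂ] H) : Prop where
  star_R : star R = R
  star_Θ : star Θ = Θ
  star_J : star J = J
  star_B : star B = B
  R_R : R * R = 1
  J_J : J * J = 1
  R_Θ : R * Θ = R - Θ * R
  Θ_Θ : Θ * Θ = Θ
  B_B : B * B = B
  Θ_B : Θ * B = B
  J_B : J * B = -B
  J_D : J * D = -D
  Θ_J_Θ : Θ * J * Θ = -B
  Θ_J_Θ' : (1 - Θ) * J * (1 - Θ) = -D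

namespace HalfLineData

variable {R Θ J B D : H →L[ℂ] H}

theorem Θ_R_Θ (h : HalfLineData R Θ J B D) : Θ * R * Θ = 0 := by
  rw [mul_assoc, h.R_Θ, mul_sub, ← mul_assoc Θ Θ, h.Θ_Θ, sub_self]

theorem B_Θ (h : HalfLineData R Θ J B D) : B * Θ = B := by
  have := congrArg star h.Θ_B
  rwa [star_mul, h.star_B, h.star_Θ] at this

theorem B_J (h : HalfLineData R Θ J B D) : B * J = -B := by
  have := congrArg star h.J_B
  rwa [star_mul, star_neg, h.star_B, h.star_J] at this

theorem one_add_J_B (h : HalfLineData R Θ J B D) : (1 + J) * B = 0 := by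
  rw [add_mul, one_mul, h.J_B, add_neg_cancel]

theorem B_one_add_J (h : HalfLineData R Θ J B D) : B * (1 + J) = 0 := by
  rw [mul_add, mul_one, h.B_J, add_neg_cancel]

theorem one_add_J_sq (h : HalfLineData R Θ J B D) : (1 + J) * (1 + J) = (2 : ℂ) • (1 + J) := by
  rw [add_mul, mul_add, mul_add, h.J_J, one_mul, mul_one, one_mul]
  module

theorem one_sub_R_sq (h : HalfLineData R Θ J B D) : (1 - R) * (1 - R) = (2 : ℂ) • (1 - R) := by
  rw [sub_mul, mul_sub, mul_sub, h.R_R, one_mul, mul_one, one_mul]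
  module

theorem one_add_R_one_sub_R (h : HalfLineData R Θ J B D) : (1 + R) * (1 - R) = 0 := by
  rw [add_mul, mul_sub, mul_sub, h.R_R, one_mul, mul_one, one_mul]
  abel

theorem one_sub_R_one_add_R (h : HalfLineData R Θ J B D) : (1 - R) * (1 + R) = 0 := by
  rw [sub_mul, mul_add, mul_add, h.R_R, one_mul, mul_one, one_mul]
  abel

theorem one_sub_R_Θ_one_sub_R (h : HalfLineData R Θ J B D) :
    (1 - R) * Θ * (1 - R) = 1 - R := by
  rw [sub_mul, sub_mul, mul_sub, mul_sub, one_mul, h.R_Θ, mul_one, mul_one, sub_mul, mul_assoc Θ R,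
    h.R_R, mul_one]
  abel

theorem Θ_one_sub_R_B (h : HalfLineData R Θ J B D) : Θ * (1 - R) * B = B := by
  have e : Θ * R * B = 0 := by rw [← h.Θ_B, ← mul_assoc, h.Θ_R_Θ, zero_mul]
  rw [mul_sub, sub_mul, mul_one, e, h.Θ_B, sub_zero]

theorem B_one_sub_R_Θ (h : HalfLineData R Θ J B D) : B * (1 - R) * Θ = B := by
  have e : B * R * Θ = 0 := by
    conv_lhs => rw [← h.B_Θ]
    rw [mul_assoc B Θ, mul_assoc B, h.Θ_R_Θ, mul_zero]
  rw [mul_sub, sub_mul, mul_one, e, h.B_Θ, sub_zero]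

theorem B_one_sub_R_B (h : HalfLineData R Θ J B D) : B * (1 - R) * B = B := by
  calc B * (1 - R) * B = B * (1 - R) * (Θ * B) := by rw [h.Θ_B]
    _ = B := by rw [← mul_assoc, h.B_one_sub_R_Θ, h.B_B]

/-- The two diagonal compressions of `J` determine the anticommutator: `ΘJ + JΘ = J - B + D`.
Multiplying by `J` gives `JΘJ + Θ = 1 + B - D`, and in the sum `B` and `D` cancel. This is the only
role of `D`. -/
theorem one_add_J_Θ_one_add_J (h : HalfLineData R Θ J B D) :
    (1 + J) * Θ * (1 + J) = 1 + J := by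
  have h1 : Θ * J + J * Θ = J - B + D := by
    have := h.Θ_J_Θ'
    rw [sub_mul, sub_mul, mul_sub, mul_sub, h.Θ_J_Θ, one_mul, mul_one, mul_one] at this
    have h2 : D = -(J - J * Θ - (Θ * J - -B)) := by rw [this, neg_neg]
    rw [h2]
    abel
  have h2 : J * Θ * J + Θ = 1 + B - D := by
    have := congrArg (J * ·) h1
    simp only [mul_add, mul_sub, ← mul_assoc, h.J_J, one_mul, h.J_B, h.J_D] at this
    rw [this]
    abel
  have h3 : (1 + J) * Θ * (1 + J) = (Θ * J + J * Θ) + (J * Θ * J + Θ) := by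
    rw [add_mul, add_mul, mul_add, mul_add, one_mul, mul_one, mul_one]
    abel
  rw [h3, h1, h2]
  abel

/-- Together with `extension_restriction`, this makes the odd restriction a partial isometry from
the fixed vectors of `J` onto the odd vectors orthogonal to the bound state. The defect comes from
`Θ(1 + J)Θ = Θ - B`. -/
theorem restriction_extension (h : HalfLineData R Θ J B D) :
    oddRestriction R Θ J * oddExtension R Θ J = (1 / 2 : ℂ) • (1 - R) - boundProj R B := by
  have h1 : Θ * (1 + J) * Θ = Θ - B := by
    rw [mul_add, add_mul, mul_one, h.Θ_Θ, h.Θ_J_Θ, sub_eq_add_neg]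
  have h2 : (1 - R) * Θ * (1 + J) * ((1 + J) * Θ * (1 - R))
      = (2 : ℂ) • ((1 - R) * (Θ * (1 + J) * Θ) * (1 - R)) := by
    calc _ = (1 - R) * Θ * ((1 + J) * (1 + J)) * Θ * (1 - R) := by simp only [mul_assoc]
      _ = _ := by
        rw [h.one_add_J_sq]
        simp only [mul_smul_comm, smul_mul_assoc, mul_assoc]
  have h3 : (1 - R) * (Θ - B) * (1 - R) = 1 - R - (1 - R) * B * (1 - R) := by
    rw [mul_sub (1 - R) Θ B, sub_mul _ _ (1 - R), h.one_sub_R_Θ_one_sub_R]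
  rw [oddRestriction, oddExtension, smul_mul_smul_comm, h2, h1, h3, boundProj]
  module

theorem extension_restriction (h : HalfLineData R Θ J B D) :
    oddExtension R Θ J * oddRestriction R Θ J = (1 / 2 : ℂ) • (1 + J) := by
  have h1 : Θ * (1 - R) * Θ = Θ := by
    rw [mul_sub, sub_mul, mul_one, h.Θ_Θ, h.Θ_R_Θ, sub_zero]
  have h2 : (1 + J) * Θ * (1 - R) * ((1 - R) * Θ * (1 + J))
      = (2 : ℂ) • ((1 + J) * (Θ * (1 - R) * Θ) * (1 + J)) := by
    calc _ = (1 + J) * Θ * ((1 - R) * (1 - R)) * Θ * (1 + J) := by simp only [mul_assoc]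
      _ = _ := by
        rw [h.one_sub_R_sq]
        simp only [mul_smul_comm, smul_mul_assoc, mul_assoc]
  rw [oddRestriction, oddExtension, smul_mul_smul_comm, h2, h1, h.one_add_J_Θ_one_add_J]
  module

theorem half_one_add_J_extension (h : HalfLineData R Θ J B D) :
    (1 / 2 : ℂ) • (1 + J) * oddExtension R Θ J = oddExtension R Θ J := by
  rw [oddExtension, smul_mul_smul_comm, mul_assoc (1 + J), ← mul_assoc (1 + J) (1 + J),
    h.one_add_J_sq, smul_mul_assoc]
  module

theorem restriction_half_one_add_J (h : HalfLineData R Θ J B D) :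
    oddRestriction R Θ J * ((1 / 2 : ℂ) • (1 + J)) = oddRestriction R Θ J := by
  rw [oddRestriction, smul_mul_smul_comm, mul_assoc, h.one_add_J_sq, mul_smul_comm]
  module

theorem even_restriction (h : HalfLineData R Θ J B D) :
    evenProj R * oddRestriction R Θ J = 0 := by
  rw [evenProj, oddRestriction, smul_mul_smul_comm, ← mul_assoc, ← mul_assoc,
    h.one_add_R_one_sub_R, zero_mul, zero_mul, smul_zero]

theorem extension_even (h : HalfLineData R Θ J B D) :
    oddExtension R Θ J * evenProj R = 0 := by
  rw [evenProj, oddExtension, smul_mul_smul_comm, mul_assoc, h.one_sub_R_one_add_R, mul_zero,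
    smul_zero]

theorem even_bound (h : HalfLineData R Θ J B D) : evenProj R * boundProj R B = 0 := by
  rw [evenProj, boundProj, smul_mul_smul_comm, ← mul_assoc, ← mul_assoc,
    h.one_add_R_one_sub_R, zero_mul, zero_mul, smul_zero]

theorem bound_even (h : HalfLineData R Θ J B D) : boundProj R B * evenProj R = 0 := by
  rw [evenProj, boundProj, smul_mul_smul_comm, mul_assoc, h.one_sub_R_one_add_R, mul_zero,
    smul_zero]

theorem extension_bound (h : HalfLineData R Θ J B D) :
    oddExtension R Θ J * boundProj R B = 0 := by
  have : (1 + J) * Θ * (1 - R) * ((1 - R) * B * (1 - R)) = 0 := by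
    calc _ = (1 + J) * Θ * ((1 - R) * (1 - R)) * B * (1 - R) := by simp only [mul_assoc]
      _ = (2 : ℂ) • ((1 + J) * (Θ * (1 - R) * B) * (1 - R)) := by
        rw [h.one_sub_R_sq]
        simp only [mul_smul_comm, smul_mul_assoc, mul_assoc]
      _ = 0 := by rw [h.Θ_one_sub_R_B, h.one_add_J_B, zero_mul, smul_zero]
  rw [oddExtension, boundProj, smul_mul_smul_comm, this, smul_zero]

theorem bound_restriction (h : HalfLineData R Θ J B D) :
    boundProj R B * oddRestriction R Θ J = 0 := by
  have : (1 - R) * B * (1 - R) * ((1 - R) * Θ * (1 + J)) = 0 := by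
    calc _ = (1 - R) * B * ((1 - R) * (1 - R)) * Θ * (1 + J) := by simp only [mul_assoc]
      _ = (2 : ℂ) • ((1 - R) * ((B * (1 - R) * Θ) * (1 + J))) := by
        rw [h.one_sub_R_sq]
        simp only [mul_smul_comm, smul_mul_assoc, mul_assoc]
      _ = 0 := by rw [h.B_one_sub_R_Θ, h.B_one_add_J, mul_zero, smul_zero]
  rw [oddRestriction, boundProj, smul_mul_smul_comm, this, smul_zero]

theorem bound_bound (h : HalfLineData R Θ J B D) :
    boundProj R B * boundProj R B = boundProj R B := by
  have : (1 - R) * B * (1 - R) * ((1 - R) * B * (1 - R))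
      = (2 : ℂ) • ((1 - R) * B * (1 - R)) := by
    calc _ = (1 - R) * B * ((1 - R) * (1 - R)) * B * (1 - R) := by simp only [mul_assoc]
      _ = (2 : ℂ) • ((1 - R) * (B * (1 - R) * B) * (1 - R)) := by
        rw [h.one_sub_R_sq]
        simp only [mul_smul_comm, smul_mul_assoc, mul_assoc]
      _ = _ := by rw [h.B_one_sub_R_B]
  rw [boundProj, smul_mul_smul_comm, this]
  module

theorem even_even (h : HalfLineData R Θ J B D) : evenProj R * evenProj R = evenProj R := by
  rw [evenProj, smul_mul_smul_comm, add_mul, mul_add, mul_add, h.R_R, one_mul, mul_one, one_mul]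
  module

theorem resolution_of_identity (h : HalfLineData R Θ J B D) :
    evenProj R + oddRestriction R Θ J * oddExtension R Θ J + boundProj R B = 1 := by
  rw [h.restriction_extension, evenProj]
  module

theorem star_restriction (h : HalfLineData R Θ J B D) :
    star (oddRestriction R Θ J) = oddExtension R Θ J := by
  rw [oddRestriction, oddExtension, star_smul, star_mul, star_mul, star_add, star_sub, star_one,
    h.star_J, h.star_R, h.star_Θ, mul_assoc]
  simp

theorem star_extension (h : HalfLineData R Θ J B D) :
    star (oddExtension R Θ J) = oddRestriction R Θ J := by
  rw [← h.star_restriction, star_star]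

theorem star_even (h : HalfLineData R Θ J B D) : star (evenProj R) = evenProj R := by
  rw [evenProj, star_smul, star_add, star_one, h.star_R]
  simp

theorem star_bound (h : HalfLineData R Θ J B D) : star (boundProj R B) = boundProj R B := by
  rw [boundProj, star_smul, star_mul, star_mul, star_sub, star_one, h.star_R, h.star_B, mul_assoc]
  simp

end HalfLineData

/-- The evolution obtained from the free evolution `U₀`: free on the even vectors, free on the
extended odd vectors, and a phase on the bound state of energy `e`. -/
def halfLineGroup (R Θ J B : H →L[ℂ] H) (U₀ : ℝ → H →L[ℂ] H) (e t : ℝ) : H →L[ℂ] H :=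
  U₀ t * evenProj R + oddRestriction R Θ J * U₀ t * oddExtension R Θ J
    + cexp (-(I * e * t)) • boundProj R B

variable {R Θ J B D : H →L[ℂ] H} {U₀ : ℝ → H →L[ℂ] H} {e : ℝ}

theorem IsIsometryGroup.star_eq {U₀ : ℝ → H →L[ℂ] H} (hU : IsIsometryGroup U₀) (t : ℝ) :
    star (U₀ t) = U₀ (-t) := by
  have h1 : star (U₀ t) * U₀ t = 1 :=
    (ContinuousLinearMap.norm_map_iff_adjoint_comp_self (U₀ t)).1 (hU.norm_map t)
  have h2 : U₀ t * U₀ (-t) = 1 := by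
    ext x
    change U₀ t (U₀ (-t) x) = x
    rw [← hU.map_add, add_neg_cancel, hU.map_zero]
  calc star (U₀ t) = star (U₀ t) * (U₀ t * U₀ (-t)) := by rw [h2, mul_one]
    _ = U₀ (-t) := by rw [← mul_assoc, h1, one_mul]

theorem even_halfLineGroup (h : HalfLineData R Θ J B D) (hc : IsCommuting R J U₀) (t : ℝ) :
    evenProj R * halfLineGroup R Θ J B U₀ e t = U₀ t * evenProj R := by
  rw [halfLineGroup, mul_add, mul_add, mul_smul_comm, h.even_bound, smul_zero, add_zero,
    ← mul_assoc, hc.even_U, mul_assoc, h.even_even, ← mul_assoc (evenProj R), ← mul_assoc,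
    h.even_restriction, zero_mul, zero_mul, add_zero]

/-- Used twice: for the group law, and to send the domain of the perturbed generator into the domain
of the free one. -/
theorem extension_halfLineGroup (h : HalfLineData R Θ J B D) (hc : IsCommuting R J U₀) (t : ℝ) :
    oddExtension R Θ J * halfLineGroup R Θ J B U₀ e t = U₀ t * oddExtension R Θ J := by
  have h1 : oddExtension R Θ J * (oddRestriction R Θ J * U₀ t * oddExtension R Θ J)
      = U₀ t * oddExtension R Θ J := by
    calc _ = (oddExtension R Θ J * oddRestriction R Θ J) * U₀ t * oddExtension R Θ J := by
          simp only [mul_assoc]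
      _ = _ := by
        rw [h.extension_restriction, hc.half_U, mul_assoc, h.half_one_add_J_extension]
  rw [halfLineGroup, mul_add, mul_add, mul_smul_comm, h.extension_bound, smul_zero, add_zero,
    h1, ← hc.even_U, ← mul_assoc, h.extension_even, zero_mul, zero_add]

theorem bound_halfLineGroup (h : HalfLineData R Θ J B D) (hc : IsCommuting R J U₀) (t : ℝ) :
    boundProj R B * halfLineGroup R Θ J B U₀ e t = cexp (-(I * e * t)) • boundProj R B := by
  rw [halfLineGroup, mul_add, mul_add, mul_smul_comm, h.bound_bound, ← hc.even_U, ← mul_assoc,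
    h.bound_even, zero_mul, zero_add, ← mul_assoc, ← mul_assoc, h.bound_restriction, zero_mul,
    zero_mul, zero_add]

theorem halfLineGroup_restriction (h : HalfLineData R Θ J B D) (hc : IsCommuting R J U₀) (t : ℝ) :
    halfLineGroup R Θ J B U₀ e t * oddRestriction R Θ J = oddRestriction R Θ J * U₀ t := by
  have h1 : oddRestriction R Θ J * U₀ t * oddExtension R Θ J * oddRestriction R Θ J
      = oddRestriction R Θ J * U₀ t := by
    rw [mul_assoc, h.extension_restriction, mul_assoc, ← hc.half_U, ← mul_assoc,
      h.restriction_half_one_add_J]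
  rw [halfLineGroup, add_mul, add_mul, smul_mul_assoc, h.bound_restriction, smul_zero, add_zero,
    h1, mul_assoc, h.even_restriction, mul_zero, zero_add]

theorem halfLineGroup_even (h : HalfLineData R Θ J B D) (t : ℝ) :
    halfLineGroup R Θ J B U₀ e t * evenProj R = U₀ t * evenProj R := by
  rw [halfLineGroup, add_mul, add_mul, smul_mul_assoc, h.bound_even, smul_zero, add_zero,
    mul_assoc, h.even_even, mul_assoc _ (oddExtension R Θ J), h.extension_even, mul_zero, add_zero]

theorem reflection_halfLineGroup (h : HalfLineData R Θ J B D) (hc : IsCommuting R J U₀) (t : ℝ) :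
    R * halfLineGroup R Θ J B U₀ e t = halfLineGroup R Θ J B U₀ e t * R := by
  have e1 : R * (1 - R) = -(1 - R) := by
    rw [mul_sub, mul_one, h.R_R, neg_sub]
  have e2 : (1 - R) * R = -(1 - R) := by
    rw [sub_mul, one_mul, h.R_R, neg_sub]
  have r1 : R * evenProj R = evenProj R := by
    rw [evenProj, mul_smul_comm, mul_add, h.R_R, mul_one, add_comm]
  have r2 : evenProj R * R = evenProj R := by
    rw [evenProj, smul_mul_assoc, add_mul, h.R_R, one_mul, add_comm]
  have r3 : R * oddRestriction R Θ J = -oddRestriction R Θ J := by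
    rw [oddRestriction, mul_smul_comm, ← mul_assoc, ← mul_assoc, e1, neg_mul, neg_mul, smul_neg]
  have r4 : oddExtension R Θ J * R = -oddExtension R Θ J := by
    rw [oddExtension, smul_mul_assoc, mul_assoc, e2, mul_neg, smul_neg]
  have r5 : R * boundProj R B = -boundProj R B := by
    rw [boundProj, mul_smul_comm, ← mul_assoc, ← mul_assoc, e1, neg_mul, neg_mul, smul_neg]
  have r6 : boundProj R B * R = -boundProj R B := by
    rw [boundProj, smul_mul_assoc, mul_assoc, e2, mul_neg, smul_neg]
  rw [halfLineGroup, mul_add, mul_add, add_mul, add_mul, mul_smul_comm, smul_mul_assoc, r5, r6,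
    mul_assoc (U₀ t), r2, ← mul_assoc R, hc.R_U, mul_assoc (U₀ t), r1, ← mul_assoc R,
    ← mul_assoc R, r3, mul_assoc _ (oddExtension R Θ J), r4, mul_neg, neg_mul, neg_mul]

/-- The three pieces live on complementary subspaces, by the resolution of the identity, and each is
intertwined with a one-parameter group. The adjoint at time `t` is the operator at time `-t`, so the
operators are isometric. -/
theorem isIsometryGroup_halfLineGroup (h : HalfLineData R Θ J B D) (hc : IsCommuting R J U₀)
    (hU : IsIsometryGroup U₀) : IsIsometryGroup (halfLineGroup R Θ J B U₀ e) := by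
  have hU0 : U₀ 0 = 1 := ContinuousLinearMap.ext hU.map_zero
  have hUadd : ∀ s t, U₀ (s + t) = U₀ s * U₀ t := fun s t =>
    ContinuousLinearMap.ext (hU.map_add s t)
  have hzero : halfLineGroup R Θ J B U₀ e 0 = 1 := by
    rw [halfLineGroup, hU0, one_mul, mul_one, ofReal_zero, mul_zero, neg_zero, Complex.exp_zero,
      one_smul, h.resolution_of_identity]
  have hadd : ∀ s t, halfLineGroup R Θ J B U₀ e (s + t)
      = halfLineGroup R Θ J B U₀ e s * halfLineGroup R Θ J B U₀ e t := by
    intro s t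
    conv_rhs => rw [halfLineGroup]
    rw [add_mul, add_mul, mul_assoc (U₀ s), even_halfLineGroup h hc, smul_mul_assoc,
      bound_halfLineGroup h hc, mul_assoc (oddRestriction R Θ J * U₀ s),
      extension_halfLineGroup h hc, halfLineGroup, hUadd, smul_smul, ← Complex.exp_add]
    simp only [mul_assoc]
    congr 3
    push_cast
    ring
  have hstar : ∀ t, star (halfLineGroup R Θ J B U₀ e t) = halfLineGroup R Θ J B U₀ e (-t) := by
    intro t
    rw [halfLineGroup, star_add, star_add, star_smul, star_mul, star_mul, star_mul, h.star_even,
      h.star_restriction, h.star_extension, h.star_bound, hU.star_eq, hc.even_U, halfLineGroup,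
      mul_assoc]
    congr 2
    rw [RCLike.star_def, ← Complex.exp_conj]
    simp [mul_assoc]
  constructor
  · intro x
    rw [hzero]
    rfl
  · intro s t x
    rw [hadd]
    rfl
  · intro t
    refine (ContinuousLinearMap.norm_map_iff_adjoint_comp_self _).2 ?_
    change star (halfLineGroup R Θ J B U₀ e t) * halfLineGroup R Θ J B U₀ e t = 1
    rw [hstar, ← hadd, neg_add_cancel, hzero]
  · intro x
    have h1 : Continuous fun t => U₀ t (evenProj R x) := hU.continuous _
    have h2 : Continuous fun t => oddRestriction R Θ J (U₀ t (oddExtension R Θ J x)) :=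
      (oddRestriction R Θ J).continuous.comp (hU.continuous _)
    have h3 : Continuous fun t : ℝ => cexp (-(I * e * t)) • boundProj R B x := by fun_prop
    exact (h1.add h2).add h3

/-- A bounded operator preserves derivatives of orbits. Applied to the projections and the
extension, this splits a vector in the domain of the perturbed generator into pieces with known
regularity. -/
theorem mem_generatorGraph_of_intertwining {K : Type*} [NormedAddCommGroup K]
    [InnerProductSpace ℂ K] {U V : ℝ → K →L[ℂ] K} {S : K →L[ℂ] K}
    (hS : ∀ t, S * U t = V t * S) {x y : K} (hx : (x, y) ∈ generatorGraph U) :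
    (S x, S y) ∈ generatorGraph V := by
  have hx' : HasDerivAt (fun s => U s x) (-(I • y)) 0 := hx
  have h1 := (S.restrictScalars ℝ).hasFDerivAt.comp_hasDerivAt (0 : ℝ) hx'
  have h2 : (fun s => V s (S x)) = fun s => S (U s x) := by
    ext s
    exact (DFunLike.congr_fun (hS s) x).symm
  change HasDerivAt (fun s => V s (S x)) (-(I • S y)) 0
  rw [h2]
  refine h1.congr_deriv ?_
  simp

theorem boundProj_of_mem_generatorGraph (h : HalfLineData R Θ J B D) (hc : IsCommuting R J U₀)
    {x y : H} (hx : (x, y) ∈ generatorGraph (halfLineGroup R Θ J B U₀ e)) :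
    boundProj R B y = (e : ℂ) • boundProj R B x := by
  have h1 : ((boundProj R B) x, (boundProj R B) y) ∈
      generatorGraph fun t : ℝ => cexp (-(I * e * t)) • (1 : H →L[ℂ] H) := by
    refine mem_generatorGraph_of_intertwining (fun t => ?_) hx
    rw [bound_halfLineGroup h hc, smul_mul_assoc, one_mul]
  have h2 : HasDerivAt (fun t : ℝ => cexp (-(I * e * t)) • boundProj R B x)
      (-(I • boundProj R B y)) 0 := h1
  have hexp : HasDerivAt (fun s : ℝ => cexp (-(I * e * s))) (-(I * e)) 0 := by
    have := ((hasDerivAt_id (0 : ℝ)).ofReal_comp.const_mul (-(I * e))).cexp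
    simpa [neg_mul] using this
  have h3 := h2.unique (hexp.smul_const (boundProj R B x))
  rw [neg_smul, neg_inj, mul_smul] at h3
  exact smul_right_injective H I_ne_zero h3

end Abstract

end DeltaPrime

end


open MeasureTheory Filter Topology Complex

noncomputable section

namespace DeltaPrime

open scoped FourierTransform

/-! ### The boundary symbol and the involution `J` -/

/-- The symbol `(ik - κ)/(ik + κ)`, `k = 2πξ`. -/
def symbol (κ ξ : ℝ) : ℂ := (2 * Real.pi * ξ * I - κ) / (2 * Real.pi * ξ * I + κ)

theorem norm_symbol_numerator (κ x : ℝ) : ‖((x : ℂ) * I - κ)‖ = ‖((x : ℂ) * I + κ)‖ := by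
  have : (x : ℂ) * I - κ = -(starRingEnd ℂ) ((x : ℂ) * I + κ) := by
    simp
    ring
  rw [this, norm_neg, RCLike.norm_conj]

theorem symbol_eq (κ ξ : ℝ) :
    symbol κ ξ = (((2 * Real.pi * ξ : ℝ) : ℂ) * I - κ) / (((2 * Real.pi * ξ : ℝ) : ℂ) * I + κ) := by
  rw [symbol]
  push_cast
  rfl

theorem norm_symbol_le (κ ξ : ℝ) : ‖symbol κ ξ‖ ≤ 1 := by
  rw [symbol_eq, norm_div, norm_symbol_numerator]
  -- The inequality also covers `κ = ξ = 0`, where the quotient is `0/0 = 0`.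
  exact div_self_le_one _

theorem measurable_symbol (κ : ℝ) : Measurable (symbol κ) := by
  unfold symbol
  fun_prop

theorem symbol_denominator_ne_zero {κ ξ : ℝ} (hξ : ξ ≠ 0) :
    (2 * Real.pi * ξ * I + κ : ℂ) ≠ 0 := by
  intro h
  have := congrArg Complex.im h
  simp [hξ, Real.pi_ne_zero] at this

theorem symbol_numerator_ne_zero {κ ξ : ℝ} (hξ : ξ ≠ 0) :
    (2 * Real.pi * ξ * I - κ : ℂ) ≠ 0 := by
  intro h
  have := congrArg Complex.im h
  simp [hξ, Real.pi_ne_zero] at this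

theorem symbol_neg (κ ξ : ℝ) : symbol κ (-ξ) = symbol (-κ) ξ := by
  rw [symbol, symbol, ← neg_div_neg_eq]
  push_cast
  congr 1 <;> ring

theorem conj_symbol (κ ξ : ℝ) : (starRingEnd ℂ) (symbol κ ξ) = symbol κ (-ξ) := by
  rw [symbol, symbol, map_div₀]
  simp [map_ofNat]

theorem symbol_mul_symbol_neg {κ ξ : ℝ} (hξ : ξ ≠ 0) : symbol κ (-ξ) * symbol κ ξ = 1 := by
  rw [symbol_neg, symbol, symbol]
  have h1 := symbol_denominator_ne_zero (κ := κ) hξ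
  have h2 := symbol_numerator_ne_zero (κ := κ) hξ
  push_cast
  rw [sub_neg_eq_add, ← sub_eq_add_neg]
  field_simp

/-- The Fourier multiplier with the boundary symbol. -/
def symbolOp (κ : ℝ) : L2Line →L[ℂ] L2Line :=
  fourierInvOp * mulOp (symbol κ) (measurable_symbol κ) (norm_symbol_le κ) * fourierOp

/-- The reflection of `L²(ℝ)`. -/
abbrev refl : L2Line →L[ℂ] L2Line := reflOp volume

/-- The unitary involution whose fixed vectors `g` satisfy that `g' - κ g` is odd. -/
def boundaryOp (κ : ℝ) : L2Line →L[ℂ] L2Line := refl * symbolOp κ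

theorem fourierOp_symbolOp (κ : ℝ) (f : L2Line) :
    fourierOp (symbolOp κ f) = mulOp (symbol κ) (measurable_symbol κ) (norm_symbol_le κ)
      (fourierOp f) :=
  fourierOp_fourierInvOp _

theorem ae_ne_zero : ∀ᵐ ξ : ℝ, ξ ≠ 0 := Measure.ae_ne volume (0 : ℝ)

theorem refl_symbolOp (κ : ℝ) (f : L2Line) :
    refl (symbolOp κ f) = symbolOp (-κ) (refl f) := by
  apply fourierOp_injective
  rw [fourierOp_reflOp, fourierOp_symbolOp, fourierOp_symbolOp, fourierOp_reflOp,
    reflOp_mulOp _ _ (measurable_symbol (-κ)) (norm_symbol_le (-κ))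
      (Eventually.of_forall fun ξ => symbol_neg κ ξ)]

theorem symbolOp_symbolOp_neg (κ : ℝ) (f : L2Line) : symbolOp (-κ) (symbolOp κ f) = f := by
  apply fourierOp_injective
  rw [fourierOp_symbolOp, fourierOp_symbolOp,
    mulOp_mulOp _ _ _ _ (e := fun _ => 1) measurable_const (by simp), mulOp_eq_self]
  · simp
  · filter_upwards [ae_ne_zero] with ξ hξ
    rw [← symbol_neg, symbol_mul_symbol_neg hξ]

theorem inner_symbolOp (κ : ℝ) (f g : L2Line) :
    inner ℂ (symbolOp κ f) g = inner ℂ f (symbolOp (-κ) g) := by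
  rw [← inner_fourierOp_fourierOp, ← inner_fourierOp_fourierOp f, fourierOp_symbolOp,
    fourierOp_symbolOp, inner_mulOp]
  intro ξ
  rw [conj_symbol, symbol_neg]

theorem boundaryOp_apply (κ : ℝ) (f : L2Line) : boundaryOp κ f = refl (symbolOp κ f) := rfl

theorem boundaryOp_boundaryOp (κ : ℝ) (f : L2Line) : boundaryOp κ (boundaryOp κ f) = f := by
  rw [boundaryOp_apply, boundaryOp_apply, refl_symbolOp κ (refl _), reflOp_reflOp,
    symbolOp_symbolOp_neg]

theorem inner_boundaryOp (κ : ℝ) (f g : L2Line) :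
    inner ℂ (boundaryOp κ f) g = inner ℂ f (boundaryOp κ g) := by
  rw [boundaryOp_apply, boundaryOp_apply, inner_reflOp, inner_symbolOp, refl_symbolOp]

theorem refl_boundaryOp_refl (κ : ℝ) (f : L2Line) :
    refl (boundaryOp κ (refl f)) = boundaryOp (-κ) f := by
  rw [boundaryOp_apply, boundaryOp_apply, refl_symbolOp κ, reflOp_reflOp]

/-! ### The half-line projection -/

/-- The indicator function of the positive half-line. -/
def halfIndicator (x : ℝ) : ℂ := if 0 < x then 1 else 0

theorem measurable_halfIndicator : Measurable halfIndicator :=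
  Measurable.ite (measurableSet_lt measurable_const measurable_id) measurable_const measurable_const

theorem norm_halfIndicator_le (x : ℝ) : ‖halfIndicator x‖ ≤ 1 := by
  unfold halfIndicator
  split_ifs <;> simp

/-- The projection of `L²(ℝ)` onto `L²(0, ∞)`. -/
def halfProj : L2Line →L[ℂ] L2Line :=
  mulOp halfIndicator measurable_halfIndicator norm_halfIndicator_le

theorem halfProj_coeFn (f : L2Line) :
    halfProj f =ᵐ[volume] fun x => if 0 < x then f x else 0 := by
  filter_upwards [mulOp_coeFn measurable_halfIndicator norm_halfIndicator_le f] with x hx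
  refine hx.trans ?_
  rw [halfIndicator]
  split_ifs <;> simp

theorem halfProj_halfProj (f : L2Line) : halfProj (halfProj f) = halfProj f :=
  mulOp_mulOp _ _ _ _ _ _ (Eventually.of_forall fun x => by
    unfold halfIndicator; split_ifs <;> simp) f

theorem inner_halfProj (f g : L2Line) : inner ℂ (halfProj f) g = inner ℂ f (halfProj g) :=
  inner_mulOp _ _ _ _ (fun x => by unfold halfIndicator; split_ifs <;> simp) f g

theorem refl_halfProj (f : L2Line) : refl (halfProj f) = refl f - halfProj (refl f) := by
  refine Lp.ext ?_
  filter_upwards [reflOp_coeFn (halfProj f), ae_comp_neg (halfProj_coeFn f),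
    Lp.coeFn_sub (refl f) (halfProj (refl f)), halfProj_coeFn (refl f), reflOp_coeFn f,
    ae_ne_zero] with x h1 h2 h3 h4 h5 hx
  rw [h1, h2, h3, Pi.sub_apply, h4, h5]
  rcases lt_or_gt_of_ne hx with h | h
  · rw [if_pos (by linarith), if_neg (by linarith), sub_zero]
  · rw [if_neg (by linarith), if_pos h, sub_self]

/-! ### The bound state of the half-line -/

/-- The normalized bound state on the half-line, which exists for `κ < 0`. -/
def boundFun (κ x : ℝ) : ℂ :=
  if κ < 0 ∧ 0 < x then (Real.sqrt (-2 * κ) * Real.exp (κ * x) : ℝ) else 0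

theorem boundFun_eq_indicator {κ : ℝ} (hκ : κ < 0) :
    boundFun κ = (Set.Ioi (0 : ℝ)).indicator
      fun x => ((Real.sqrt (-2 * κ) * Real.exp (κ * x) : ℝ) : ℂ) := by
  ext x
  by_cases hx : 0 < x
  · rw [Set.indicator_of_mem (show x ∈ Set.Ioi 0 from hx), boundFun, if_pos ⟨hκ, hx⟩]
  · rw [Set.indicator_of_notMem (show x ∉ Set.Ioi 0 from hx), boundFun, if_neg (fun h => hx h.2)]

theorem boundFun_of_nonneg {κ : ℝ} (hκ : 0 ≤ κ) : boundFun κ = 0 := by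
  ext x
  rw [boundFun, if_neg (fun h => absurd h.1 hκ.not_gt)]
  rfl

theorem integrable_boundFun (κ : ℝ) : Integrable (boundFun κ) := by
  rcases lt_or_ge κ 0 with hκ | hκ
  · rw [boundFun_eq_indicator hκ, integrable_indicator_iff measurableSet_Ioi]
    have h1 := (exp_neg_integrableOn_Ioi 0 (neg_pos.2 hκ)).const_mul (Real.sqrt (-2 * κ))
    simp only [neg_neg] at h1
    exact h1.ofReal
  · rw [boundFun_of_nonneg hκ]
    exact integrable_zero _ _ _

theorem memLp_boundFun (κ : ℝ) : MemLp (boundFun κ) 2 volume := by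
  rw [memLp_two_iff_integrable_sq_norm (integrable_boundFun κ).1]
  rcases lt_or_ge κ 0 with hκ | hκ
  · have h1 := (exp_neg_integrableOn_Ioi 0 (by linarith : 0 < -2 * κ)).const_mul (-2 * κ)
    refine ((integrable_indicator_iff measurableSet_Ioi).2 h1).congr (Eventually.of_forall fun x => ?_)
    rw [boundFun_eq_indicator hκ]
    by_cases hx : 0 < x
    · simp only [Set.indicator_of_mem (show x ∈ Set.Ioi 0 from hx)]
      rw [Complex.norm_real, Real.norm_of_nonneg (by positivity), mul_pow,
        Real.sq_sqrt (by linarith), ← Real.exp_nat_mul]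
      congr 2
      push_cast
      ring
    · simp only [Set.indicator_of_notMem (show x ∉ Set.Ioi 0 from hx)]
      simp
  · rw [boundFun_of_nonneg hκ]
    simp

/-- The bound state on the half-line as an element of `L²(ℝ)`. -/
def boundState (κ : ℝ) : L2Line := (memLp_boundFun κ).toLp _

theorem boundState_coeFn (κ : ℝ) : boundState κ =ᵐ[volume] boundFun κ :=
  (memLp_boundFun κ).coeFn_toLp

theorem boundState_of_nonneg {κ : ℝ} (hκ : 0 ≤ κ) : boundState κ = 0 := by
  refine Lp.ext ?_
  filter_upwards [boundState_coeFn κ, Lp.coeFn_zero ℂ 2 (volume : Measure ℝ)] with x h1 h2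
  rw [h1, h2, boundFun_of_nonneg hκ]

theorem halfProj_boundState (κ : ℝ) : halfProj (boundState κ) = boundState κ := by
  refine Lp.ext ?_
  filter_upwards [halfProj_coeFn (boundState κ), boundState_coeFn κ] with x h1 h2
  rw [h1, h2]
  split_ifs with hx
  · rfl
  · rw [boundFun, if_neg (fun h => hx h.2)]

theorem inner_boundState_self {κ : ℝ} (hκ : κ < 0) :
    inner ℂ (boundState κ) (boundState κ) = 1 := by
  have h1 : inner ℂ (boundState κ) (boundState κ)
      = ∫ x, (Set.Ioi (0 : ℝ)).indicator (fun x => ((-2 * κ * Real.exp (2 * κ * x) : ℝ) : ℂ)) x := by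
    rw [L2.inner_def]
    refine integral_congr_ae ?_
    filter_upwards [boundState_coeFn κ] with x hx
    rw [hx, boundFun_eq_indicator hκ]
    by_cases hx : 0 < x
    · simp only [Set.indicator_of_mem (show x ∈ Set.Ioi 0 from hx)]
      rw [RCLike.inner_apply, Complex.conj_ofReal, ← ofReal_mul]
      congr 1
      have := Real.mul_self_sqrt (by linarith : 0 ≤ -2 * κ)
      rw [show 2 * κ * x = κ * x + κ * x by ring, Real.exp_add]
      linear_combination (Real.exp (κ * x) * Real.exp (κ * x)) * this
    · simp only [Set.indicator_of_notMem (show x ∉ Set.Ioi 0 from hx)]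
      simp
  rw [h1, integral_indicator measurableSet_Ioi, integral_complex_ofReal, integral_const_mul,
    integral_exp_mul_Ioi (by linarith : 2 * κ < 0)]
  rw [← ofReal_one]
  congr 1
  have hκ' : κ ≠ 0 := hκ.ne
  simp only [mul_zero, Real.exp_zero]
  field_simp

theorem fourierOp_boundState {κ : ℝ} (hκ : κ < 0) :
    ∀ᵐ ξ : ℝ, fourierOp (boundState κ) ξ = Real.sqrt (-2 * κ) / (2 * Real.pi * ξ * I - κ) := by
  filter_upwards [fourierOp_toLp_ae (integrable_boundFun κ) (memLp_boundFun κ)] with ξ hξ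
  refine hξ.trans ?_
  have ha : (κ - 2 * Real.pi * ξ * I : ℂ).re < 0 := by simpa using hκ
  have hint := integral_exp_mul_complex_Ioi ha 0
  rw [Real.fourier_eq']
  have : ∀ v : ℝ, cexp (↑(-2 * Real.pi * inner ℝ v ξ) * I) • boundFun κ v
      = (Set.Ioi (0 : ℝ)).indicator (fun x : ℝ => (Real.sqrt (-2 * κ) : ℂ) *
        cexp ((κ - 2 * Real.pi * ξ * I) * x)) v := by
    intro v
    rw [boundFun_eq_indicator hκ]
    by_cases hv : 0 < v
    · simp only [Set.indicator_of_mem (show v ∈ Set.Ioi 0 from hv)]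
      rw [ofReal_mul (Real.sqrt _), ofReal_exp, smul_eq_mul, mul_left_comm, ← Complex.exp_add]
      congr 2
      simp
      ring
    · simp only [Set.indicator_of_notMem (show v ∉ Set.Ioi 0 from hv)]
      simp
  simp only [this]
  rw [integral_indicator measurableSet_Ioi, integral_const_mul, hint]
  simp only [ofReal_zero, mul_zero, Complex.exp_zero]
  rw [neg_div, ← div_neg, neg_sub, mul_one_div]

/-- The transform of the bound state is `N/(ik - κ)`. The symbol turns it into `N/(ik + κ)`, and
reflecting `k` gives `-N/(ik - κ)`. -/
theorem boundaryOp_boundState (κ : ℝ) : boundaryOp κ (boundState κ) = -boundState κ := by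
  rcases lt_or_ge κ 0 with hκ | hκ
  · apply fourierOp_injective
    rw [boundaryOp_apply, fourierOp_reflOp, fourierOp_symbolOp, map_neg]
    refine Lp.ext ?_
    filter_upwards [reflOp_coeFn (mulOp (symbol κ) (measurable_symbol κ) (norm_symbol_le κ)
        (fourierOp (boundState κ))),
      ae_comp_neg (mulOp_coeFn (measurable_symbol κ) (norm_symbol_le κ)
        (fourierOp (boundState κ))), ae_comp_neg (fourierOp_boundState hκ),
      fourierOp_boundState hκ, Lp.coeFn_neg (fourierOp (boundState κ)), ae_ne_zero]
      with ξ h1 h2 h3 h4 h5 hξ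
    rw [h1, h2, h3, h5, Pi.neg_apply, h4, symbol_neg, symbol]
    have e1 := symbol_denominator_ne_zero (κ := κ) hξ
    have e2 := symbol_numerator_ne_zero (κ := κ) hξ
    have e3 : (2 * Real.pi * ((-ξ : ℝ) : ℂ) * I - κ : ℂ) = -(2 * Real.pi * ξ * I + κ) := by
      push_cast
      ring
    rw [e3]
    push_cast
    rw [sub_neg_eq_add, ← sub_eq_add_neg]
    field_simp
  · rw [boundState_of_nonneg hκ, map_zero, neg_zero]

/-! ### Exponentials in `L²` of a half-line -/

theorem eq_zero_of_memLp_exp {μ : ℂ} (hμ : 0 ≤ μ.re) {α : ℂ}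
    (h : MemLp (fun x : ℝ => α * cexp (μ * x)) 2 (volume.restrict (Set.Ioi 0))) : α = 0 := by
  have h1 : MemLp (fun _ : ℝ => α) 2 (volume.restrict (Set.Ioi (0 : ℝ))) := by
    refine h.of_le aestronglyMeasurable_const ?_
    filter_upwards [ae_restrict_mem measurableSet_Ioi] with x hx
    rw [norm_mul, Complex.norm_exp]
    refine le_mul_of_one_le_right (norm_nonneg _) (Real.one_le_exp ?_)
    simpa using mul_nonneg hμ (le_of_lt hx)
  rw [memLp_const_iff (by norm_num) (by norm_num)] at h1
  simpa using h1

theorem memLp_exp_neg {μ : ℂ} (hμ : 0 < μ.re) (α : ℂ) :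
    MemLp (fun x : ℝ => α * cexp (-μ * x)) 2 (volume.restrict (Set.Ioi 0)) := by
  have hc : Continuous fun x : ℝ => α * cexp (-μ * x) := by fun_prop
  rw [memLp_two_iff_integrable_sq_norm hc.aestronglyMeasurable]
  refine ((exp_neg_integrableOn_Ioi 0 (by linarith : 0 < 2 * μ.re)).const_mul
    (‖α‖ ^ 2)).congr (Eventually.of_forall fun x => ?_)
  simp only [norm_mul, Complex.norm_exp, mul_pow, ← Real.exp_nat_mul]
  congr 2
  simp
  ring

theorem hasDerivAt_of_integral_eq {u v : ℝ → ℂ} {s : Set ℝ} (hso : IsOpen s)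
    (hv : ContinuousOn v s) (h : ∀ a ∈ s, ∀ b ∈ s, u b - u a = ∫ x in a..b, v x) {x : ℝ}
    (hx : x ∈ s) : HasDerivAt u (v x) x := by
  have hnh : s ∈ 𝓝 x := hso.mem_nhds hx
  have h1 : HasDerivAt (fun b => ∫ y in x..b, v y) (v x) x :=
    intervalIntegral.integral_hasDerivAt_right (by simp)
      (hv.stronglyMeasurableAtFilter hso x hx) (hv.continuousAt hnh)
  refine (h1.const_add (u x)).congr_of_eventuallyEq ?_
  filter_upwards [hnh] with y hy
  rw [← h x hx y hy]
  ring

theorem eq_exp_of_hasDerivAt {u : ℝ → ℂ} {c : ℂ} {s : Set ℝ} (hs : Convex ℝ s) (hso : IsOpen s)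
    (hd : ∀ x ∈ s, HasDerivAt u (c * u x) x) :
    ∃ C : ℂ, ∀ x ∈ s, u x = C * cexp (c * x) := by
  have hd2 : ∀ x ∈ s, HasDerivAt (fun x : ℝ => u x * cexp (-c * x)) 0 x := by
    intro x hx
    have he : HasDerivAt (fun x : ℝ => cexp (-c * x)) (cexp (-c * x) * -c) x := by
      have := ((hasDerivAt_id x).ofReal_comp.const_mul (-c)).cexp
      simpa using this
    refine ((hd x hx).mul he).congr_deriv ?_
    ring
  rcases s.eq_empty_or_nonempty with h0 | ⟨x₀, hx₀⟩
  · exact ⟨0, by simp [h0]⟩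
  refine ⟨u x₀ * cexp (-c * x₀), fun x hx => ?_⟩
  have hconst := hs.is_const_of_fderivWithin_eq_zero (𝕜 := ℝ)
    (f := fun x : ℝ => u x * cexp (-c * x))
    (fun y hy => (hd2 y hy).differentiableAt.differentiableWithinAt)
    (fun y hy => by
      rw [fderivWithin_of_isOpen hso hy]
      ext
      simpa using (hd2 y hy).deriv) hx hx₀
  rw [← hconst, mul_assoc, ← Complex.exp_add]
  simp

/-! ### Compression of the involution to the half-line -/

/-- Since `1 - s = 2κ/(ik + κ)`, the function `h = f - Sf` solves `h' = 2κ f - κ h`. Where `f`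
vanishes this is `h' = -κ h`, so `h` is a pure exponential on the negative half-line. -/
theorem symbolOp_ae_neg (κ : ℝ) {f : L2Line} (hf : halfProj f = f) :
    ∃ C : ℂ, ∀ᵐ x : ℝ, x < 0 → symbolOp κ f x = C * cexp (-κ * x) := by
  set h := f - symbolOp κ f with hh
  set g := (2 * κ : ℂ) • f - (κ : ℂ) • h with hg
  have hFg : ∀ᵐ ξ : ℝ, fourierOp g ξ = 2 * Real.pi * ξ * I * fourierOp h ξ := by
    have e1 : fourierOp h = fourierOp f - mulOp (symbol κ) (measurable_symbol κ)
        (norm_symbol_le κ) (fourierOp f) := by rw [hh, map_sub, fourierOp_symbolOp]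
    have e2 : fourierOp g = (2 * κ : ℂ) • fourierOp f - (κ : ℂ) • fourierOp h := by
      rw [hg, map_sub, map_smul, map_smul]
    filter_upwards [Lp.coeFn_sub (fourierOp f) (mulOp (symbol κ) (measurable_symbol κ)
        (norm_symbol_le κ) (fourierOp f)),
      mulOp_coeFn (measurable_symbol κ) (norm_symbol_le κ) (fourierOp f),
      Lp.coeFn_sub ((2 * κ : ℂ) • fourierOp f) ((κ : ℂ) • fourierOp h),
      Lp.coeFn_smul (2 * κ : ℂ) (fourierOp f), Lp.coeFn_smul (κ : ℂ) (fourierOp h), ae_ne_zero]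
      with ξ h1 h2 h3 h4 h5 hξ
    have e1' := symbol_denominator_ne_zero (κ := κ) hξ
    rw [e2, h3, Pi.sub_apply, h4, h5, Pi.smul_apply, Pi.smul_apply, e1, h1, Pi.sub_apply, h2,
      smul_eq_mul, smul_eq_mul, symbol]
    field_simp
    ring
  obtain ⟨u, hu, hhu, hug⟩ := exists_primitive_of_fourier hFg
  have hf0 : ∀ᵐ x : ℝ, x < 0 → f x = 0 := by
    filter_upwards [halfProj_coeFn f] with x h1 h2
    rw [hf] at h1
    rw [h1, if_neg (by linarith)]
  have hg0 : ∀ᵐ x : ℝ, x < 0 → g x = -κ * u x := by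
    filter_upwards [hf0, hhu, Lp.coeFn_sub ((2 * κ : ℂ) • f) ((κ : ℂ) • h),
      Lp.coeFn_smul (2 * κ : ℂ) f, Lp.coeFn_smul (κ : ℂ) h] with x h1 h2 h3 h4 h5 hx
    rw [h3, Pi.sub_apply, h4, h5, Pi.smul_apply, Pi.smul_apply, h1 hx, h2]
    simp
  have hint : ∀ a ∈ Set.Iio (0 : ℝ), ∀ b ∈ Set.Iio (0 : ℝ),
      u b - u a = ∫ x in a..b, -κ * u x := by
    intro a ha b hb
    rw [hug]
    refine intervalIntegral.integral_congr_ae ?_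
    filter_upwards [hg0] with x h1 h2
    refine h1 ?_
    rw [Set.uIoc, Set.mem_Ioc] at h2
    exact lt_of_le_of_lt h2.2 (max_lt ha hb)
  obtain ⟨C, hC⟩ := eq_exp_of_hasDerivAt (u := u) (c := -κ) (s := Set.Iio 0) (convex_Iio 0)
    isOpen_Iio fun x hx =>
      hasDerivAt_of_integral_eq isOpen_Iio (hu.const_mul _).continuousOn hint hx
  refine ⟨-C, ?_⟩
  filter_upwards [hf0, hhu, Lp.coeFn_sub f (symbolOp κ f)] with x h1 h2 h3 hx
  rw [h3, Pi.sub_apply, h1 hx, hC x hx, zero_sub] at h2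
  rw [neg_mul, ← h2, neg_neg]

/-- Reflecting gives a multiple of `e^{κx}` on `x > 0`. For `κ ≥ 0` this is square integrable only
if it vanishes; for `κ < 0` it is the bound state. -/
theorem halfProj_boundaryOp (κ : ℝ) {f : L2Line} (hf : halfProj f = f) :
    ∃ C : ℂ, halfProj (boundaryOp κ f) = C • boundState κ := by
  rcases lt_or_ge κ 0 with hκ | hκ
  · obtain ⟨C, hC⟩ := symbolOp_ae_neg κ hf
    refine ⟨C / Real.sqrt (-2 * κ), Lp.ext ?_⟩
    filter_upwards [halfProj_coeFn (boundaryOp κ f), reflOp_coeFn (symbolOp κ f), ae_comp_neg hC,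
      Lp.coeFn_smul (C / Real.sqrt (-2 * κ) : ℂ) (boundState κ), boundState_coeFn κ]
      with x h1 h2 h3 h4 h5
    rw [h1, h4, Pi.smul_apply, h5, boundFun]
    by_cases hx : 0 < x
    · rw [if_pos hx, if_pos ⟨hκ, hx⟩, boundaryOp_apply, h2, h3 (by linarith)]
      have : (Real.sqrt (-2 * κ) : ℂ) ≠ 0 :=
        ofReal_ne_zero.2 (Real.sqrt_pos.2 (by linarith)).ne'
      rw [smul_eq_mul, ofReal_mul, ← mul_assoc, div_mul_cancel₀ _ this, ofReal_exp]
      congr 2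
      push_cast
      ring
    · rw [if_neg hx, if_neg (fun h => hx h.2), smul_zero]
  · obtain ⟨C, hC⟩ := symbolOp_ae_neg κ hf
    have h1 : ∀ᵐ x : ℝ, 0 < x → boundaryOp κ f x = C * cexp (κ * x) := by
      filter_upwards [reflOp_coeFn (symbolOp κ f), ae_comp_neg hC] with x h1 h2 hx
      rw [boundaryOp_apply, h1, h2 (by linarith)]
      congr 2
      push_cast
      ring
    have hC0 : C = 0 := by
      refine eq_zero_of_memLp_exp (μ := κ) (by simpa using hκ) ?_
      refine ((Lp.memLp (boundaryOp κ f)).mono_measure Measure.restrict_le_self).ae_eq ?_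
      filter_upwards [ae_restrict_of_ae h1, ae_restrict_mem measurableSet_Ioi] with x h2 h3
      exact h2 h3
    refine ⟨0, Lp.ext ?_⟩
    rw [zero_smul]
    filter_upwards [halfProj_coeFn (boundaryOp κ f), h1, Lp.coeFn_zero ℂ 2 (volume : Measure ℝ)]
      with x h2 h3 h4
    rw [h2, h4]
    split_ifs with hx
    · rw [h3 hx, hC0, zero_mul]
      rfl
    · rfl

/-- The coefficient is found by pairing with the bound state, since the involution is self-adjoint
and changes the sign of that state. -/
theorem halfProj_boundaryOp_halfProj (κ : ℝ) (f : L2Line) :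
    halfProj (boundaryOp κ (halfProj f)) = -(inner ℂ (boundState κ) f • boundState κ) := by
  rcases lt_or_ge κ 0 with hκ | hκ
  · obtain ⟨C, hC⟩ := halfProj_boundaryOp κ (halfProj_halfProj f)
    have h1 : inner ℂ (boundState κ) (halfProj (boundaryOp κ (halfProj f)))
        = -inner ℂ (boundState κ) f := by
      rw [← inner_halfProj, halfProj_boundState, ← inner_boundaryOp, boundaryOp_boundState,
        inner_neg_left, ← inner_halfProj, halfProj_boundState]
    rw [hC, inner_smul_right, inner_boundState_self hκ, mul_one] at h1
    rw [hC, h1, neg_smul]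
  · obtain ⟨C, hC⟩ := halfProj_boundaryOp κ (halfProj_halfProj f)
    rw [hC, boundState_of_nonneg hκ, smul_zero, smul_zero, neg_zero]

/-- The projection onto the bound state of the half-line. -/
def boundOp (κ : ℝ) : L2Line →L[ℂ] L2Line := (innerSL ℂ (boundState κ)).smulRight (boundState κ)

theorem boundOp_apply (κ : ℝ) (f : L2Line) :
    boundOp κ f = inner ℂ (boundState κ) f • boundState κ := rfl

theorem star_eq_self_of_inner {A : L2Line →L[ℂ] L2Line}
    (h : ∀ f g, inner ℂ (A f) g = inner ℂ f (A g)) : star A = A :=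
  ((ContinuousLinearMap.eq_adjoint_iff A A).2 h).symm

/-- The compression to the negative half-line follows from the positive one, because conjugation
with the reflection replaces `κ` by `-κ`; hence `D` is the reflected bound-state projection for
`-κ`. -/
theorem halfLineData (κ : ℝ) :
    HalfLineData refl halfProj (boundaryOp κ) (boundOp κ) (refl * boundOp (-κ) * refl) where
  star_R := star_eq_self_of_inner inner_reflOp
  star_Θ := star_eq_self_of_inner inner_halfProj
  star_J := star_eq_self_of_inner (inner_boundaryOp κ)
  star_B := star_eq_self_of_inner fun f g => by
    rw [boundOp_apply, boundOp_apply, inner_smul_left, inner_smul_right, inner_conj_symm]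
    ring
  R_R := ContinuousLinearMap.ext reflOp_reflOp
  J_J := ContinuousLinearMap.ext (boundaryOp_boundaryOp κ)
  R_Θ := ContinuousLinearMap.ext refl_halfProj
  Θ_Θ := ContinuousLinearMap.ext halfProj_halfProj
  B_B := ContinuousLinearMap.ext fun f => by
    change boundOp κ (boundOp κ f) = boundOp κ f
    rw [boundOp_apply κ f, map_smul, boundOp_apply]
    rcases lt_or_ge κ 0 with hκ | hκ
    · rw [inner_boundState_self hκ, one_smul]
    · rw [boundState_of_nonneg hκ, smul_zero]
  Θ_B := ContinuousLinearMap.ext fun f => by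
    change halfProj (boundOp κ f) = boundOp κ f
    rw [boundOp_apply, map_smul, halfProj_boundState]
  J_B := ContinuousLinearMap.ext fun f => by
    change boundaryOp κ (boundOp κ f) = -boundOp κ f
    rw [boundOp_apply, map_smul, boundaryOp_boundState, smul_neg]
  J_D := ContinuousLinearMap.ext fun f => by
    change boundaryOp κ (refl (boundOp (-κ) (refl f))) = -refl (boundOp (-κ) (refl f))
    have h1 : boundaryOp κ (refl (boundState (-κ))) = -refl (boundState (-κ)) := by
      rw [← reflOp_reflOp (boundaryOp κ (refl (boundState (-κ)))), refl_boundaryOp_refl,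
        boundaryOp_boundState, map_neg]
    rw [boundOp_apply, map_smul, map_smul, h1, smul_neg]
  Θ_J_Θ := ContinuousLinearMap.ext (halfProj_boundaryOp_halfProj κ)
  Θ_J_Θ' := ContinuousLinearMap.ext fun f => by
    have h1 : ∀ g : L2Line, (1 - halfProj) g = refl (halfProj (refl g)) := fun g => by
      rw [refl_halfProj, reflOp_reflOp]
      rfl
    change (1 - halfProj) (boundaryOp κ ((1 - halfProj) f)) = -refl (boundOp (-κ) (refl f))
    rw [h1 f, h1, refl_boundaryOp_refl, halfProj_boundaryOp_halfProj, map_neg, boundOp_apply]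

end DeltaPrime

end


open MeasureTheory Filter Topology Complex

noncomputable section

namespace DeltaPrime

/-! ### The free Schrödinger group -/

theorem norm_sq_eq_integral {X : Type*} [MeasurableSpace X] {μ : Measure X} (f : Lp ℂ 2 μ) :
    ‖f‖ ^ 2 = ∫ x, ‖f x‖ ^ 2 ∂μ := by
  rw [← @inner_self_eq_norm_sq ℂ, L2.inner_def, ← integral_re (L2.integrable_inner _ _)]
  exact integral_congr_ae (Eventually.of_forall fun x => inner_self_eq_norm_sq _)

/-- The phase `e^{-iωt}`. -/
def phase (ω : ℝ → ℝ) (t ξ : ℝ) : ℂ := cexp ((-(ω ξ * t) : ℝ) * I)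

theorem norm_phase (ω : ℝ → ℝ) (t ξ : ℝ) : ‖phase ω t ξ‖ = 1 := Complex.norm_exp_ofReal_mul_I _

theorem norm_phase_le (ω : ℝ → ℝ) (t ξ : ℝ) : ‖phase ω t ξ‖ ≤ 1 := (norm_phase ω t ξ).le

theorem measurable_phase {ω : ℝ → ℝ} (hω : Measurable ω) (t : ℝ) : Measurable (phase ω t) := by
  unfold phase
  fun_prop

theorem hasDerivAt_phase (ω : ℝ → ℝ) (ξ : ℝ) :
    HasDerivAt (fun t => phase ω t ξ) (-(I * ω ξ)) 0 := by
  have := ((hasDerivAt_id (0 : ℝ)).ofReal_comp.const_mul (-(ω ξ) * I : ℂ)).cexp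
  simp only [id, ofReal_zero, mul_zero, Complex.exp_zero, ofReal_one, mul_one, one_mul] at this
  refine (this.congr_of_eventuallyEq (Eventually.of_forall fun t => ?_)).congr_deriv (by ring)
  simp only [phase]
  congr 1
  push_cast
  ring

theorem isIsometryGroup_phase {ω : ℝ → ℝ} (hω : Measurable ω) :
    IsIsometryGroup fun t =>
      (mulOp (phase ω t) (measurable_phase hω t) (norm_phase_le ω t) : L2Line →L[ℂ] L2Line) where
  map_zero := mulOp_eq_self _ _ (Eventually.of_forall fun ξ => by simp [phase])
  map_add := fun s t f => (mulOp_mulOp _ _ _ _ _ _ (Eventually.of_forall fun ξ => by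
    simp only [phase]
    rw [← Complex.exp_add]
    congr 1
    push_cast
    ring) f).symm
  norm_map := fun t => norm_mulOp_apply _ _ (norm_phase ω t)
  continuous := fun f => by
    refine continuous_iff_continuousAt.2 fun t₀ => ?_
    rw [ContinuousAt, tendsto_iff_norm_sub_tendsto_zero]
    have key : Tendsto (fun t => ∫ ξ, ‖(phase ω t ξ - phase ω t₀ ξ) * f ξ‖ ^ 2) (𝓝 t₀)
        (𝓝 (∫ _ : ℝ, (0 : ℝ))) := by
      refine tendsto_integral_filter_of_dominated_convergence (fun ξ => 4 * ‖f ξ‖ ^ 2) ?_ ?_ ?_ ?_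
      · refine Eventually.of_forall fun t => ?_
        exact ((((measurable_phase hω t).sub (measurable_phase hω t₀)).aestronglyMeasurable.mul
          (Lp.aestronglyMeasurable f)).norm.pow 2)
      · refine Eventually.of_forall fun t => Eventually.of_forall fun ξ => ?_
        have h1 : ‖phase ω t ξ - phase ω t₀ ξ‖ ≤ 2 := by
          refine (norm_sub_le _ _).trans ?_
          rw [norm_phase, norm_phase]
          norm_num
        rw [Real.norm_of_nonneg (by positivity), norm_mul, mul_pow]
        refine mul_le_mul_of_nonneg_right ?_ (by positivity)
        nlinarith [norm_nonneg (phase ω t ξ - phase ω t₀ ξ)]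
      · exact ((Lp.memLp f).integrable_norm_pow (by norm_num)).const_mul 4
      · refine Eventually.of_forall fun ξ => ?_
        have hc : Continuous fun t => ‖(phase ω t ξ - phase ω t₀ ξ) * f ξ‖ ^ 2 := by
          unfold phase
          fun_prop
        have := hc.tendsto t₀
        simpa using this
    rw [integral_zero] at key
    have h2 := key.sqrt
    rw [Real.sqrt_zero] at h2
    refine h2.congr fun t => ?_
    rw [Real.sqrt_eq_iff_mul_self_eq (integral_nonneg fun _ => by positivity) (norm_nonneg _),
      ← sq, norm_sq_eq_integral]
    refine integral_congr_ae ?_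
    filter_upwards [Lp.coeFn_sub (mulOp (phase ω t) (measurable_phase hω t) (norm_phase_le ω t) f)
      (mulOp (phase ω t₀) (measurable_phase hω t₀) (norm_phase_le ω t₀) f),
      mulOp_coeFn (measurable_phase hω t) (norm_phase_le ω t) f,
      mulOp_coeFn (measurable_phase hω t₀) (norm_phase_le ω t₀) f] with ξ h1 h2 h3
    rw [h1, Pi.sub_apply, h2, h3, sub_mul]

/-- The difference quotients at times `1/(n + 1)` converge in `L²`, hence almost everywhere along a
subsequence, while at each point they converge to the derivative of the phase. -/
theorem ae_eq_of_mem_generatorGraph_phase {ω : ℝ → ℝ} (hω : Measurable ω) {x y : L2Line}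
    (h : (x, y) ∈ generatorGraph fun t =>
      (mulOp (phase ω t) (measurable_phase hω t) (norm_phase_le ω t) : L2Line →L[ℂ] L2Line)) :
    ∀ᵐ ξ : ℝ, y ξ = ω ξ * x ξ := by
  have hx : HasDerivAt (fun t => mulOp (phase ω t) (measurable_phase hω t) (norm_phase_le ω t) x)
    (-(I • y)) 0 := h
  have htn : Tendsto (fun n : ℕ => (1 / ((n : ℝ) + 1))) atTop (𝓝[≠] 0) := by
    refine tendsto_nhdsWithin_iff.2 ⟨tendsto_one_div_add_atTop_nhds_zero_nat, ?_⟩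
    exact Eventually.of_forall fun n => by
      simp only [Set.mem_compl_iff, Set.mem_singleton_iff]
      positivity
  have h1 := (hasDerivAt_iff_tendsto_slope_zero.1 hx).comp htn
  obtain ⟨ns, hns, hae⟩ := (tendstoInMeasure_of_tendsto_Lp h1).exists_seq_tendsto_ae
  have hpt : ∀ᵐ ξ : ℝ, ∀ n : ℕ, (((1 / ((n : ℝ) + 1))⁻¹ •
      (mulOp (phase ω (0 + 1 / ((n : ℝ) + 1))) (measurable_phase hω _) (norm_phase_le ω _) x
        - mulOp (phase ω 0) (measurable_phase hω 0) (norm_phase_le ω 0) x) : L2Line) : ℝ → ℂ) ξ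
      = ((1 / ((n : ℝ) + 1))⁻¹ • (phase ω (0 + 1 / ((n : ℝ) + 1)) ξ - phase ω 0 ξ)) * x ξ := by
    rw [ae_all_iff]
    intro n
    filter_upwards [Lp.coeFn_smul (1 / ((n : ℝ) + 1))⁻¹
      (mulOp (phase ω (0 + 1 / ((n : ℝ) + 1))) (measurable_phase hω _) (norm_phase_le ω _) x
        - mulOp (phase ω 0) (measurable_phase hω 0) (norm_phase_le ω 0) x),
      Lp.coeFn_sub (mulOp (phase ω (0 + 1 / ((n : ℝ) + 1))) (measurable_phase hω _)
        (norm_phase_le ω _) x) (mulOp (phase ω 0) (measurable_phase hω 0) (norm_phase_le ω 0) x),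
      mulOp_coeFn (measurable_phase hω (0 + 1 / ((n : ℝ) + 1))) (norm_phase_le ω _) x,
      mulOp_coeFn (measurable_phase hω 0) (norm_phase_le ω 0) x] with ξ h1 h2 h3 h4
    rw [h1, Pi.smul_apply, h2, Pi.sub_apply, h3, h4, ← sub_mul, smul_mul_assoc]
  filter_upwards [hae, hpt, Lp.coeFn_neg (I • y), Lp.coeFn_smul I y] with ξ h2 h3 h4 h5
  rw [h4, Pi.neg_apply, h5, Pi.smul_apply] at h2
  have h6 := ((hasDerivAt_iff_tendsto_slope_zero.1 (hasDerivAt_phase ω ξ)).comp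
    (htn.comp hns.tendsto_atTop)).mul_const (x ξ)
  have h7 := tendsto_nhds_unique h2 (h6.congr fun n => (h3 (ns n)).symm)
  rw [smul_eq_mul] at h7
  have h8 : I * (y ξ) = I * (ω ξ * x ξ) := by linear_combination -h7
  exact mul_left_cancel₀ I_ne_zero h8

/-- The dispersion relation `c k²`, `k = 2πξ`. -/
def dispersion (c ξ : ℝ) : ℝ := c * (2 * Real.pi * ξ) ^ 2

theorem measurable_dispersion (c : ℝ) : Measurable (dispersion c) := by
  unfold dispersion
  fun_prop

/-- Multiplication by `e^{-itck²}`. -/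
def phaseOp (c t : ℝ) : L2Line →L[ℂ] L2Line :=
  mulOp (phase (dispersion c) t) (measurable_phase (measurable_dispersion c) t)
    (norm_phase_le (dispersion c) t)

/-- The group generated by `-c d²/dx²` on the line. -/
def schrodingerGroup (c t : ℝ) : L2Line →L[ℂ] L2Line := fourierInvOp * phaseOp c t * fourierOp

theorem fourierOp_schrodingerGroup (c t : ℝ) (f : L2Line) :
    fourierOp (schrodingerGroup c t f) = phaseOp c t (fourierOp f) :=
  fourierOp_fourierInvOp _

theorem isIsometryGroup_schrodingerGroup (c : ℝ) : IsIsometryGroup (schrodingerGroup c) := by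
  have h : IsIsometryGroup (phaseOp c) := isIsometryGroup_phase (measurable_dispersion c)
  constructor
  · intro f
    apply fourierOp_injective
    rw [fourierOp_schrodingerGroup, h.map_zero]
  · intro s t f
    apply fourierOp_injective
    rw [fourierOp_schrodingerGroup, fourierOp_schrodingerGroup, fourierOp_schrodingerGroup,
      h.map_add]
  · intro t f
    rw [← norm_fourierOp, fourierOp_schrodingerGroup, h.norm_map, norm_fourierOp]
  · intro f
    exact fourierInvOp.continuous.comp (h.continuous (fourierOp f))

theorem refl_phaseOp (c t : ℝ) (f : L2Line) : refl (phaseOp c t f) = phaseOp c t (refl f) :=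
  reflOp_mulOp _ _ _ _ (Eventually.of_forall fun ξ => by simp [phase, dispersion]) f

theorem symbolOp_schrodingerGroup (κ c t : ℝ) (f : L2Line) :
    symbolOp κ (schrodingerGroup c t f) = schrodingerGroup c t (symbolOp κ f) := by
  apply fourierOp_injective
  rw [fourierOp_schrodingerGroup, fourierOp_symbolOp, fourierOp_symbolOp,
    fourierOp_schrodingerGroup]
  refine Lp.ext ?_
  filter_upwards [mulOp_coeFn (measurable_symbol κ) (norm_symbol_le κ)
      (phaseOp c t (fourierOp f)),
    mulOp_coeFn (measurable_symbol κ) (norm_symbol_le κ) (fourierOp f),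
    mulOp_coeFn (measurable_phase (measurable_dispersion c) t) (norm_phase_le (dispersion c) t)
      (fourierOp f),
    mulOp_coeFn (measurable_phase (measurable_dispersion c) t) (norm_phase_le (dispersion c) t)
      (mulOp (symbol κ) (measurable_symbol κ) (norm_symbol_le κ) (fourierOp f))] with ξ h1 h2 h3 h4
  unfold phaseOp at *
  rw [h1, h4, h2, h3]
  ring

theorem refl_schrodingerGroup (c t : ℝ) (f : L2Line) :
    refl (schrodingerGroup c t f) = schrodingerGroup c t (refl f) := by
  apply fourierOp_injective
  rw [fourierOp_reflOp, fourierOp_schrodingerGroup, fourierOp_schrodingerGroup, fourierOp_reflOp,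
    refl_phaseOp]

theorem isCommuting (κ c : ℝ) : IsCommuting refl (boundaryOp κ) (schrodingerGroup c) where
  R_U := fun t => ContinuousLinearMap.ext fun f => refl_schrodingerGroup c t f
  J_U := fun t => ContinuousLinearMap.ext fun f => by
    change refl (symbolOp κ (schrodingerGroup c t f))
      = schrodingerGroup c t (refl (symbolOp κ f))
    rw [symbolOp_schrodingerGroup, refl_schrodingerGroup]

theorem fourierOp_of_mem_generatorGraph {c : ℝ} {x y : L2Line}
    (h : (x, y) ∈ generatorGraph (schrodingerGroup c)) :
    ∀ᵐ ξ : ℝ, fourierOp y ξ = dispersion c ξ * fourierOp x ξ :=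
  ae_eq_of_mem_generatorGraph_phase (measurable_dispersion c)
    (mem_generatorGraph_of_intertwining (V := phaseOp c)
      (fun t => ContinuousLinearMap.ext fun f => fourierOp_schrodingerGroup c t f) h)

/-! ### Sobolev regularity of the domain of the free Hamiltonian -/

/-- The bound `|k| ≤ 1 + k²` puts the first derivative in `L²`. Then both the function and its
derivative have continuous representatives that are primitives. -/
theorem exists_sobolev_representative {c : ℝ} (hc : 0 < c) {g h : L2Line}
    (hgh : ∀ᵐ ξ : ℝ, fourierOp h ξ = dispersion c ξ * fourierOp g ξ) :
    ∃ (d w : L2Line) (u v : ℝ → ℂ),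
      (∀ᵐ ξ : ℝ, fourierOp d ξ = 2 * Real.pi * ξ * I * fourierOp g ξ) ∧
      g =ᵐ[volume] u ∧ d =ᵐ[volume] v ∧ Continuous v ∧ (∀ x, HasDerivAt u (v x) x) ∧
      (∀ a b, v b - v a = ∫ x in a..b, w x) ∧ h = (-c) • w := by
  have hmem : MemLp (fun ξ : ℝ => 2 * Real.pi * ξ * I * fourierOp g ξ) 2 volume := by
    have hb := (Lp.memLp (fourierOp g)).norm.add ((Lp.memLp (fourierOp h)).norm.const_mul c⁻¹)
    refine hb.of_le ?_ ?_
    · exact (by fun_prop : Continuous fun ξ : ℝ =>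
        (2 * Real.pi * ξ * I : ℂ)).aestronglyMeasurable.mul (Lp.aestronglyMeasurable _)
    · filter_upwards [hgh] with ξ hξ
      refine le_trans ?_ (Real.le_norm_self _)
      rw [Pi.add_apply, hξ, norm_mul (2 * Real.pi * ξ * I : ℂ), norm_mul (dispersion c ξ : ℂ)]
      have h1 : ‖(2 * Real.pi * ξ * I : ℂ)‖ = |2 * Real.pi * ξ| := by
        rw [show (2 * Real.pi * ξ * I : ℂ) = ((2 * Real.pi * ξ : ℝ) : ℂ) * I by push_cast; rfl,
          norm_mul, norm_I, mul_one, Complex.norm_real, Real.norm_eq_abs]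
      have h2 : ‖(dispersion c ξ : ℂ)‖ = c * |2 * Real.pi * ξ| ^ 2 := by
        rw [Complex.norm_real, dispersion, Real.norm_of_nonneg (by positivity), sq_abs]
      rw [h1, h2, ← mul_assoc, ← mul_assoc, inv_mul_cancel₀ hc.ne', one_mul]
      nlinarith [norm_nonneg (fourierOp g ξ), abs_nonneg (2 * Real.pi * ξ),
        sq_nonneg (|2 * Real.pi * ξ| - 1), mul_nonneg (norm_nonneg (fourierOp g ξ))
          (sq_nonneg (|2 * Real.pi * ξ| - 1)), mul_nonneg (norm_nonneg (fourierOp g ξ))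
          (sq_nonneg (|2 * Real.pi * ξ|))]
  set d : L2Line := fourierInvOp (hmem.toLp _) with hd
  set w : L2Line := (-c⁻¹) • h with hw
  have hFd : ∀ᵐ ξ : ℝ, fourierOp d ξ = 2 * Real.pi * ξ * I * fourierOp g ξ := by
    rw [hd, fourierOp_fourierInvOp]
    exact hmem.coeFn_toLp
  have hFw : ∀ᵐ ξ : ℝ, fourierOp w ξ = 2 * Real.pi * ξ * I * fourierOp d ξ := by
    have e : fourierOp w = (-c⁻¹) • fourierOp h := by
      rw [hw]
      exact (fourierOp.restrictScalars ℝ).map_smul _ _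
    rw [e]
    filter_upwards [hFd, hgh, Lp.coeFn_smul (-c⁻¹) (fourierOp h)] with ξ h1 h2 h3
    rw [h3, Pi.smul_apply, h2, h1, dispersion, real_smul]
    have : (c : ℂ) ≠ 0 := ofReal_ne_zero.2 hc.ne'
    push_cast
    field_simp
    linear_combination (-(ξ ^ 2 * fourierOp g ξ : ℂ)) * I_sq
  obtain ⟨u, hu, hgu, hud⟩ := exists_primitive_of_fourier hFd
  obtain ⟨v, hv, hdv, hvw⟩ := exists_primitive_of_fourier hFw
  refine ⟨d, w, u, v, hFd, hgu, hdv, hv, fun x => ?_, hvw, ?_⟩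
  · refine hasDerivAt_of_integral_eq isOpen_univ hv.continuousOn (fun a _ b _ => ?_)
      (Set.mem_univ x)
    rw [hud]
    refine intervalIntegral.integral_congr_ae ?_
    filter_upwards [hdv] with y hy _
    exact hy
  · rw [hw, smul_smul]
    simp [hc.ne']

theorem eq_of_ae_eq_of_continuous {u v : ℝ → ℂ} (hu : Continuous u) (hv : Continuous v)
    (h : u =ᵐ[volume] v) : u = v :=
  (hu.ae_eq_iff_eq volume hv).1 h

/-! ### The `δ'` Hamiltonian -/

section Hamiltonian

variable {ħ m : ℝ} {β : OnePoint ℝ}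

/-- The inverse length `κ = ħ²/(mβ)`. -/
def robin (ħ m : ℝ) (β : OnePoint ℝ) : ℝ := ħ ^ 2 / m * recip β

theorem boundary_add {v v' u u' : ℂ}
    (h : β.elim (v = 0) (fun b => u = (2 * m * b / ħ ^ 2 : ℝ) * v))
    (h' : β.elim (v' = 0) (fun b => u' = (2 * m * b / ħ ^ 2 : ℝ) * v')) :
    β.elim (v + v' = 0) (fun b => u + u' = (2 * m * b / ħ ^ 2 : ℝ) * (v + v')) := by
  induction β using OnePoint.rec with
  | infty =>
    change v = 0 at h
    change v' = 0 at h'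
    change v + v' = 0
    rw [h, h', add_zero]
  | coe b =>
    change u = _ at h
    change u' = _ at h'
    change u + u' = _
    rw [h, h', mul_add]

theorem boundary_smul {v u : ℂ} (a : ℂ)
    (h : β.elim (v = 0) (fun b => u = (2 * m * b / ħ ^ 2 : ℝ) * v)) :
    β.elim (a * v = 0) (fun b => a * u = (2 * m * b / ħ ^ 2 : ℝ) * (a * v)) := by
  induction β using OnePoint.rec with
  | infty =>
    change v = 0 at h
    change a * v = 0
    rw [h, mul_zero]
  | coe b =>
    change u = _ at h
    change a * u = _
    rw [h]
    ring

theorem intervalIntegrable_coeFn (w : L2Line) (a b : ℝ) : IntervalIntegrable w volume a b :=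
  ((LocallyIntegrable.integrableOn_isCompact (locallyIntegrable_coeFn w)
    isCompact_uIcc)).intervalIntegrable

theorem hamiltonian_add {ψ ψ' η η' : L2Line} (h : (ψ, η) ∈ hamiltonian ħ m β)
    (h' : (ψ', η') ∈ hamiltonian ħ m β) : (ψ + ψ', η + η') ∈ hamiltonian ħ m β := by
  obtain ⟨u, v, w, uR, uL, v₀, h1, h2, h3, h4, h5, h6, h7, h8, h9⟩ := h
  obtain ⟨u', v', w', uR', uL', v₀', h1', h2', h3', h4', h5', h6', h7', h8', h9'⟩ := h'
  refine ⟨fun x => u x + u' x, fun x => v x + v' x, w + w', uR + uR', uL + uL', v₀ + v₀',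
    ?_, fun x hx => (h2 x hx).add (h2' x hx), fun a b hab => ?_, h4.add h4', h5.add h5',
    h6.add h6', h7.add h7', ?_, ?_⟩
  · filter_upwards [Lp.coeFn_add ψ ψ', h1, h1'] with x e1 e2 e3
    rw [e1, Pi.add_apply]
    exact congrArg₂ (· + ·) e2 e3
  · have e : ∫ x in a..b, (w + w' : L2Line) x = ∫ x in a..b, (w x + w' x) := by
      refine intervalIntegral.integral_congr_ae ?_
      filter_upwards [Lp.coeFn_add w w'] with x hx _
      exact hx
    rw [e, intervalIntegral.integral_add (intervalIntegrable_coeFn w a b)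
      (intervalIntegrable_coeFn w' a b), ← h3 a b hab, ← h3' a b hab]
    ring
  · rw [show uR + uR' - (uL + uL') = (uR - uL) + (uR' - uL') by ring]
    exact boundary_add h8 h8'
  · change η + η' = _
    rw [smul_add]
    exact congrArg₂ (· + ·) h9 h9'

theorem hamiltonian_smul {ψ η : L2Line} (a : ℂ) (h : (ψ, η) ∈ hamiltonian ħ m β) :
    (a • ψ, a • η) ∈ hamiltonian ħ m β := by
  obtain ⟨u, v, w, uR, uL, v₀, h1, h2, h3, h4, h5, h6, h7, h8, h9⟩ := h
  refine ⟨fun x => a * u x, fun x => a * v x, a • w, a * uR, a * uL, a * v₀,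
    ?_, fun x hx => (h2 x hx).const_mul a, fun c b hab => ?_, h4.const_mul a, h5.const_mul a,
    h6.const_mul a, h7.const_mul a, ?_, ?_⟩
  · filter_upwards [Lp.coeFn_smul a ψ, h1] with x e1 e2
    rw [e1, Pi.smul_apply, smul_eq_mul]
    exact congrArg (a * ·) e2
  · have e : ∫ x in c..b, (a • w : L2Line) x = ∫ x in c..b, a * w x := by
      refine intervalIntegral.integral_congr_ae ?_
      filter_upwards [Lp.coeFn_smul a w] with x hx _
      exact hx
    rw [e, intervalIntegral.integral_const_mul, ← h3 c b hab]
    ring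
  · rw [← mul_sub]
    exact boundary_smul a h8
  · change a • η = _
    rw [smul_comm]
    exact congrArg (a • ·) h9

theorem hamiltonian_sub {ψ ψ' η η' : L2Line} (h : (ψ, η) ∈ hamiltonian ħ m β)
    (h' : (ψ', η') ∈ hamiltonian ħ m β) : (ψ - ψ', η - η') ∈ hamiltonian ħ m β := by
  have := hamiltonian_add h (hamiltonian_smul (-1) h')
  simpa only [neg_smul, one_smul, ← sub_eq_add_neg] using this

theorem uIcc_pos_or_neg {a b : ℝ} (h : (0 : ℝ) ∉ Set.uIcc a b) :
    (0 < a ∧ 0 < b) ∨ (a < 0 ∧ b < 0) := by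
  rw [Set.mem_uIcc] at h
  push Not at h
  rcases lt_trichotomy a 0 with ha | ha | ha
  · exact Or.inr ⟨ha, h.1 ha.le⟩
  · subst ha
    have h1 := h.1 le_rfl
    have h2 := h.2 h1.le
    exact absurd h2 (lt_irrefl _)
  · refine Or.inl ⟨ha, ?_⟩
    by_contra hb
    exact absurd (h.2 (not_lt.1 hb)) ha.not_gt

/-- The continuous derivative of an even function vanishes at `0` and the function has no jump
there, so the condition holds for every `β`. -/
theorem hamiltonian_even (hħ : 0 < ħ) (hm : 0 < m) {g h : L2Line} (hg : refl g = g)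
    (hgh : (g, h) ∈ generatorGraph (schrodingerGroup (ħ ^ 2 / (2 * m)))) :
    (g, h) ∈ hamiltonian ħ m β := by
  obtain ⟨d, w, u, v, hd, hgu, hdv, hv, huv, hvw, hh⟩ := exists_sobolev_representative
    (by positivity : 0 < ħ ^ 2 / (2 * m)) (fourierOp_of_mem_generatorGraph hgh)
  have huc : Continuous u := continuous_iff_continuousAt.2 fun x => (huv x).continuousAt
  have hue : (fun x => u (-x)) = u := by
    refine eq_of_ae_eq_of_continuous (huc.comp continuous_neg) huc ?_
    have h1 := reflOp_coeFn g
    rw [show reflOp volume g = g from hg] at h1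
    filter_upwards [hgu, ae_comp_neg hgu, h1] with x h2 h3 h4
    rw [← h2, ← h3, h4]
  have hv0 : v 0 = 0 := by
    have h1 : HasDerivAt (fun x => u (-x)) (-v 0) 0 := by
      have h0 : HasDerivAt u (v 0) (-0) := by rw [neg_zero]; exact huv 0
      have := h0.scomp (0 : ℝ) (hasDerivAt_neg (0 : ℝ))
      simpa [Function.comp_def] using this
    rw [hue] at h1
    exact self_eq_neg.1 ((huv 0).unique h1)
  have htv := hv.tendsto 0
  have htu := huc.tendsto 0
  rw [hv0] at htv
  refine ⟨u, v, w, u 0, u 0, 0, hgu, fun x _ => huv x, fun a b _ => hvw a b,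
    htv.mono_left nhdsWithin_le_nhds, htv.mono_left nhdsWithin_le_nhds,
    htu.mono_left nhdsWithin_le_nhds, htu.mono_left nhdsWithin_le_nhds, ?_, hh⟩
  induction β using OnePoint.rec with
  | infty => rfl
  | coe b =>
    change u 0 - u 0 = _
    simp

/-- An odd function jumps by `2u`, so the condition `2u = (2mβ/ħ²) v` is `v = κ u` after division by
`β ≠ 0`. For `β = ∞` both say `v = 0`. -/
theorem boundary_of_robin (hħ : 0 < ħ) (hm : 0 < m) (hβ : β ≠ ((0 : ℝ) : OnePoint ℝ)) {v u : ℂ}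
    (h : v = robin ħ m β * u) :
    β.elim (v = 0) (fun b => u - -u = (2 * m * b / ħ ^ 2 : ℝ) * v) := by
  induction β using OnePoint.rec with
  | infty =>
    change v = 0
    rw [h, robin]
    simp [recip]
  | coe b =>
    have hb : (b : ℂ) ≠ 0 := by
      intro h0
      exact hβ (by rw [ofReal_eq_zero.1 h0])
    have hħ' : (ħ : ℂ) ≠ 0 := ofReal_ne_zero.2 hħ.ne'
    have hm' : (m : ℂ) ≠ 0 := ofReal_ne_zero.2 hm.ne'
    change u - -u = (2 * m * b / ħ ^ 2 : ℝ) * v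
    rw [h, robin]
    change u - -u = (2 * m * b / ħ ^ 2 : ℝ) * (((ħ ^ 2 / m * b⁻¹ : ℝ) : ℂ) * u)
    push_cast
    field_simp
    ring

theorem oddOf_coeFn (f : L2Line) : ∀ᵐ x : ℝ, ((1 - refl) * halfProj) f x =
    if 0 < x then f x else -f (-x) := by
  change ∀ᵐ x : ℝ, (halfProj f - refl (halfProj f) : L2Line) x = _
  filter_upwards [Lp.coeFn_sub (halfProj f) (refl (halfProj f)), halfProj_coeFn f,
    reflOp_coeFn (halfProj f), ae_comp_neg (halfProj_coeFn f), ae_ne_zero] with x h1 h2 h3 h4 hx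
  rw [h1, Pi.sub_apply, h2, h3, h4]
  rcases lt_or_gt_of_ne hx with h | h
  · rw [if_neg (by linarith), if_pos (by linarith), if_neg (by linarith), zero_sub]
  · rw [if_pos h, if_neg (by linarith), sub_zero, if_pos h]

/-- Odd extensions of functions on the half-line satisfying the Robin condition. -/
theorem hamiltonian_odd (hħ : 0 < ħ) (hm : 0 < m) (hβ : β ≠ ((0 : ℝ) : OnePoint ℝ))
    {g w : L2Line} {u v : ℝ → ℂ} {u₀ v₀ : ℂ} (hgu : ∀ᵐ x : ℝ, 0 < x → g x = u x)
    (huv : ∀ x, 0 < x → HasDerivAt u (v x) x)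
    (hvw : ∀ a b, 0 < a → 0 < b → v b - v a = ∫ x in a..b, w x)
    (hv : Tendsto v (𝓝[>] 0) (𝓝 v₀)) (hu : Tendsto u (𝓝[>] 0) (𝓝 u₀))
    (hbc : v₀ = robin ħ m β * u₀) :
    (((1 - refl) * halfProj) g, ((1 - refl) * halfProj) ((-(ħ ^ 2 / (2 * m)) : ℝ) • w))
      ∈ hamiltonian ħ m β := by
  have hneg : Tendsto (fun x : ℝ => -x) (𝓝[<] 0) (𝓝[>] 0) := by
    have := tendsto_neg_nhdsLT (a := (0 : ℝ))
    rwa [neg_zero] at this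
  refine ⟨fun x => if 0 < x then u x else -u (-x), fun x => if 0 < x then v x else v (-x),
    ((1 - refl) * halfProj) w, u₀, -u₀, v₀, ?_, ?_, ?_, ?_, ?_, ?_, ?_, ?_, ?_⟩
  · filter_upwards [oddOf_coeFn g, hgu, ae_comp_neg hgu, ae_ne_zero] with x h1 h2 h3 hx
    rw [h1]
    rcases lt_or_gt_of_ne hx with h | h
    · simp only [if_neg h.not_gt]
      rw [h3 (by linarith)]
    · simp only [if_pos h]
      rw [h2 h]
  · intro x hx
    rcases lt_or_gt_of_ne hx with h | h
    · have h1 : HasDerivAt (fun y => -u (-y)) (v (-x)) x := by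
        have := ((huv (-x) (by linarith)).scomp x (hasDerivAt_neg x)).fun_neg
        simpa [Function.comp_def] using this
      simp only [if_neg h.not_gt]
      refine h1.congr_of_eventuallyEq ?_
      filter_upwards [Iio_mem_nhds h] with y hy
      rw [if_neg (not_lt.2 (le_of_lt hy))]
    · simp only [if_pos h]
      refine (huv x h).congr_of_eventuallyEq ?_
      filter_upwards [Ioi_mem_nhds h] with y hy
      rw [if_pos (show 0 < y from hy)]
  · intro a b hab
    rcases uIcc_pos_or_neg hab with ⟨ha, hb⟩ | ⟨ha, hb⟩
    · simp only [if_pos ha, if_pos hb]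
      rw [hvw a b ha hb]
      refine intervalIntegral.integral_congr_ae ?_
      filter_upwards [oddOf_coeFn w] with x h1 h2
      rw [Set.uIoc, Set.mem_Ioc] at h2
      rw [h1, if_pos ((lt_min ha hb).trans h2.1)]
    · simp only [if_neg ha.not_gt, if_neg hb.not_gt]
      rw [hvw (-a) (-b) (by linarith) (by linarith)]
      have e : ∫ x in a..b, (((1 - refl) * halfProj) w : L2Line) x = ∫ x in a..b, -w (-x) := by
        refine intervalIntegral.integral_congr_ae ?_
        filter_upwards [oddOf_coeFn w] with x h1 h2
        rw [Set.uIoc, Set.mem_Ioc] at h2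
        have : x < 0 := lt_of_le_of_lt h2.2 (max_lt ha hb)
        rw [h1, if_neg this.not_gt]
      rw [e, intervalIntegral.integral_neg, intervalIntegral.integral_comp_neg (fun x => w x),
        ← intervalIntegral.integral_symm]
  · refine hv.congr' ?_
    filter_upwards [self_mem_nhdsWithin] with x hx
    rw [if_pos (show 0 < x from hx)]
  · refine (hv.comp hneg).congr' ?_
    filter_upwards [self_mem_nhdsWithin] with x hx
    rw [if_neg (not_lt.2 (le_of_lt hx))]
    rfl
  · refine hu.congr' ?_
    filter_upwards [self_mem_nhdsWithin] with x hx
    rw [if_pos (show 0 < x from hx)]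
  · refine (hu.comp hneg).neg.congr' ?_
    filter_upwards [self_mem_nhdsWithin] with x hx
    rw [if_neg (not_lt.2 (le_of_lt hx))]
    rfl
  · exact boundary_of_robin hħ hm hβ hbc
  · exact (((1 - refl) * halfProj).restrictScalars ℝ).map_smul _ _

/-- For a fixed vector of the involution `g' - κ g` is odd. It is also continuous, so it vanishes at
`0`, which is the Robin condition. -/
theorem hamiltonian_restriction (hħ : 0 < ħ) (hm : 0 < m) (hβ : β ≠ ((0 : ℝ) : OnePoint ℝ))
    {g h : L2Line} (hg : boundaryOp (robin ħ m β) g = g)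
    (hgh : (g, h) ∈ generatorGraph (schrodingerGroup (ħ ^ 2 / (2 * m)))) :
    (((1 - refl) * halfProj) g, ((1 - refl) * halfProj) h) ∈ hamiltonian ħ m β := by
  obtain ⟨d, w, u, v, hd, hgu, hdv, hv, huv, hvw, hh⟩ := exists_sobolev_representative
    (by positivity : 0 < ħ ^ 2 / (2 * m)) (fourierOp_of_mem_generatorGraph hgh)
  have huc : Continuous u := continuous_iff_continuousAt.2 fun x => (huv x).continuousAt
  set κ := robin ħ m β with hκ
  have hodd : refl (d - (κ : ℂ) • g) = -(d - (κ : ℂ) • g) := by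
    apply fourierOp_injective
    rw [fourierOp_reflOp, map_neg, map_sub, map_smul]
    have hFg : ∀ᵐ ξ : ℝ, fourierOp g ξ = symbol κ (-ξ) * fourierOp g (-ξ) := by
      have e : fourierOp g = refl (mulOp (symbol κ) (measurable_symbol κ) (norm_symbol_le κ)
          (fourierOp g)) := by
        conv_lhs => rw [← hg, boundaryOp_apply, fourierOp_reflOp, fourierOp_symbolOp]
      have h1 := reflOp_coeFn (mulOp (symbol κ) (measurable_symbol κ) (norm_symbol_le κ)
          (fourierOp g))
      rw [show reflOp volume (mulOp (symbol κ) (measurable_symbol κ) (norm_symbol_le κ)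
          (fourierOp g)) = fourierOp g from e.symm] at h1
      filter_upwards [h1, ae_comp_neg (mulOp_coeFn (measurable_symbol κ) (norm_symbol_le κ)
          (fourierOp g))] with ξ h2 h3
      rw [h2, h3]
    refine Lp.ext ?_
    filter_upwards [reflOp_coeFn (fourierOp d - (κ : ℂ) • fourierOp g),
      Lp.coeFn_neg (fourierOp d - (κ : ℂ) • fourierOp g),
      Lp.coeFn_sub (fourierOp d) ((κ : ℂ) • fourierOp g),
      ae_comp_neg (Lp.coeFn_sub (fourierOp d) ((κ : ℂ) • fourierOp g)),
      Lp.coeFn_smul (κ : ℂ) (fourierOp g), ae_comp_neg (Lp.coeFn_smul (κ : ℂ) (fourierOp g)),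
      hd, ae_comp_neg hd, hFg, ae_ne_zero] with ξ h1 h2 h3 h4 h5 h6 h7 h8 h9 hξ
    rw [h1, h4, Pi.sub_apply, h6, h8, h2, Pi.neg_apply, h3, Pi.sub_apply, h5, h7, Pi.smul_apply,
      Pi.smul_apply, h9, symbol_neg, symbol, smul_eq_mul, smul_eq_mul]
    have e2 := symbol_numerator_ne_zero (κ := κ) hξ
    push_cast
    rw [sub_neg_eq_add, ← sub_eq_add_neg]
    field_simp
    ring
  have hfun : (fun x => v (-x) - κ * u (-x)) = fun x => -(v x - κ * u x) := by
    refine eq_of_ae_eq_of_continuous (by fun_prop) (by fun_prop) ?_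
    have h1 := reflOp_coeFn (d - (κ : ℂ) • g)
    rw [show reflOp volume (d - (κ : ℂ) • g) = -(d - (κ : ℂ) • g) from hodd] at h1
    filter_upwards [h1, Lp.coeFn_neg (d - (κ : ℂ) • g), Lp.coeFn_sub d ((κ : ℂ) • g),
      ae_comp_neg (Lp.coeFn_sub d ((κ : ℂ) • g)), Lp.coeFn_smul (κ : ℂ) g,
      ae_comp_neg (Lp.coeFn_smul (κ : ℂ) g), hgu, ae_comp_neg hgu, hdv, ae_comp_neg hdv]
      with x h1 h2 h3 h4 h5 h6 h7 h8 h9 h10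
    rw [h2, Pi.neg_apply, h3, h4, Pi.sub_apply, Pi.sub_apply, h5, h6, Pi.smul_apply, Pi.smul_apply,
      h7, h8, h9, h10, smul_eq_mul, smul_eq_mul] at h1
    exact h1.symm
  have hbc : v 0 = κ * u 0 := by
    have := congrFun hfun 0
    simp only [neg_zero] at this
    exact sub_eq_zero.1 (self_eq_neg.1 this)
  rw [hh]
  exact hamiltonian_odd hħ hm hβ (hgu.mono fun x hx _ => hx) (fun x _ => huv x)
    (fun a b _ _ => hvw a b) ((hv.tendsto 0).mono_left nhdsWithin_le_nhds)
    ((huc.tendsto 0).mono_left nhdsWithin_le_nhds) hbc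

theorem hamiltonian_boundState (hħ : 0 < ħ) (hm : 0 < m) (hβ : β ≠ ((0 : ℝ) : OnePoint ℝ)) :
    (((1 - refl) * halfProj) (boundState (robin ħ m β)),
      ((-(ħ ^ 2 / (2 * m)) * robin ħ m β ^ 2 : ℝ) : ℂ) •
        ((1 - refl) * halfProj) (boundState (robin ħ m β))) ∈ hamiltonian ħ m β := by
  set κ := robin ħ m β with hκd
  rcases lt_or_ge κ 0 with hκ | hκ
  · set N : ℂ := (Real.sqrt (-2 * κ) : ℂ) with hN
    have hE : ∀ x : ℝ, HasDerivAt (fun x : ℝ => cexp (κ * x)) (κ * cexp (κ * x)) x := fun x => by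
      have := ((hasDerivAt_id x).ofReal_comp.const_mul (κ : ℂ)).cexp
      simpa [mul_comm] using this
    have hb : ∀ᵐ x : ℝ, 0 < x → boundState κ x = N * cexp (κ * x) := by
      filter_upwards [boundState_coeFn κ] with x h1 hx
      rw [h1, boundFun, if_pos ⟨hκ, hx⟩]
      push_cast
      rfl
    have hc1 : Continuous fun x : ℝ => N * cexp (κ * x) := by fun_prop
    have hc2 : Continuous fun x : ℝ => κ * (N * cexp (κ * x)) := by fun_prop
    have key := hamiltonian_odd hħ hm hβ (g := boundState κ) (w := ((κ ^ 2 : ℝ) : ℂ) • boundState κ)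
      (u := fun x => N * cexp (κ * x)) (v := fun x => κ * (N * cexp (κ * x))) (u₀ := N)
      (v₀ := κ * N) hb (fun x _ => ?_) (fun a b ha hb' => ?_) ?_ ?_ rfl
    · convert key using 2
      have e : (-(ħ ^ 2 / (2 * m)) : ℝ) • ((κ ^ 2 : ℝ) : ℂ) • boundState κ
          = ((-(ħ ^ 2 / (2 * m)) * κ ^ 2 : ℝ) : ℂ) • boundState κ := by
        rw [ofReal_mul, mul_smul]
        rfl
      rw [e, map_smul]
    · refine ((hE x).const_mul N).congr_deriv ?_
      ring
    · have e : ∫ x in a..b, (((κ ^ 2 : ℝ) : ℂ) • boundState κ : L2Line) x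
          = ∫ x in a..b, (κ : ℂ) ^ 2 * (N * cexp (κ * x)) := by
        refine intervalIntegral.integral_congr_ae ?_
        filter_upwards [hb, Lp.coeFn_smul ((κ ^ 2 : ℝ) : ℂ) (boundState κ)] with x h1 h2 h3
        rw [Set.uIoc, Set.mem_Ioc] at h3
        rw [h2, Pi.smul_apply, h1 ((lt_min ha hb').trans h3.1), smul_eq_mul, ofReal_pow]
      rw [e]
      refine (intervalIntegral.integral_eq_sub_of_hasDerivAt
        (f := fun x : ℝ => κ * (N * cexp (κ * x))) (fun x _ => ?_)
        (Continuous.intervalIntegrable (by fun_prop) _ _)).symm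
      refine (((hE x).const_mul N).const_mul (κ : ℂ)).congr_deriv ?_
      ring
    · have := (hc2.tendsto 0).mono_left (nhdsWithin_le_nhds (s := Set.Ioi 0))
      simpa using this
    · have := (hc1.tendsto 0).mono_left (nhdsWithin_le_nhds (s := Set.Ioi 0))
      simpa using this
  · rw [boundState_of_nonneg hκ, map_zero, smul_zero]
    have := hamiltonian_odd hħ hm hβ (g := 0) (w := 0) (u := 0) (v := 0) (u₀ := 0) (v₀ := 0)
      (by filter_upwards [Lp.coeFn_zero ℂ 2 (volume : Measure ℝ)] with x hx _; exact hx)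
      (fun x _ => hasDerivAt_const x 0) (fun a b _ _ => by
        have : ∫ x in a..b, (0 : L2Line) x = ∫ x in a..b, (0 : ℂ) := by
          refine intervalIntegral.integral_congr_ae ?_
          filter_upwards [Lp.coeFn_zero ℂ 2 (volume : Measure ℝ)] with x hx _
          exact hx
        rw [this]
        simp) tendsto_const_nhds tendsto_const_nhds (by simp)
    simpa using this

/-! ### Injectivity off the real axis -/

/-- The combinations `v + μu` and `v - μu` solve first-order equations, so they are multiples of
`e^{μx}` and `e^{-μx}`. Square integrability excludes the growing one. -/
theorem decaying_solution {μ : ℂ} (hμ : 0 < μ.re) {u v : ℝ → ℂ}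
    (hu : ∀ x, 0 < x → HasDerivAt u (v x) x) (hv : ∀ x, 0 < x → HasDerivAt v (μ ^ 2 * u x) x)
    (hL : MemLp u 2 (volume.restrict (Set.Ioi 0))) :
    ∃ b : ℂ, ∀ x, 0 < x → u x = b * cexp (-μ * x) ∧ v x = -μ * b * cexp (-μ * x) := by
  have hμ0 : μ ≠ 0 := fun h => by simp [h] at hμ
  obtain ⟨C, hC⟩ := eq_exp_of_hasDerivAt (u := fun x => v x + μ * u x) (c := μ)
    (convex_Ioi 0) isOpen_Ioi fun x hx => by
      refine ((hv x hx).add ((hu x hx).const_mul μ)).congr_deriv ?_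
      ring
  obtain ⟨C', hC'⟩ := eq_exp_of_hasDerivAt (u := fun x => v x - μ * u x) (c := -μ)
    (convex_Ioi 0) isOpen_Ioi fun x hx => by
      refine ((hv x hx).sub ((hu x hx).const_mul μ)).congr_deriv ?_
      ring
  have hC0 : C / (2 * μ) = 0 := by
    refine eq_zero_of_memLp_exp hμ.le ?_
    refine (hL.add (memLp_exp_neg hμ (C' / (2 * μ)))).ae_eq ?_
    filter_upwards [ae_restrict_mem measurableSet_Ioi] with x hx
    have h1 := hC x hx
    have h2 := hC' x hx
    rw [neg_mul] at h2
    rw [Pi.add_apply]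
    field_simp
    linear_combination h1 - h2
  have hC0' : C = 0 := by
    rcases div_eq_zero_iff.1 hC0 with h | h
    · exact h
    · simp [hμ0] at h
  refine ⟨-C' / (2 * μ), fun x hx => ?_⟩
  have h1 := hC x hx
  have h2 := hC' x hx
  simp only [hC0', zero_mul, neg_mul] at h1 h2
  constructor
  · field_simp
    linear_combination h1 - h2
  · field_simp
    linear_combination h1 + h2

theorem exists_sqrt_re_pos {a : ℂ} (ha : a.im ≠ 0) : ∃ μ : ℂ, μ ^ 2 = a ∧ 0 < μ.re ∧ μ.im ≠ 0 := by
  obtain ⟨r, hr⟩ := IsAlgClosed.exists_pow_nat_eq a (n := 2) (by norm_num)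
  have him : a.im = 2 * r.re * r.im := by
    rw [← hr, sq, mul_im]
    ring
  have hre0 : r.re ≠ 0 := fun h => ha (by rw [him, h]; ring)
  have him0 : r.im ≠ 0 := fun h => ha (by rw [him, h]; ring)
  rcases lt_or_gt_of_ne hre0 with h | h
  · exact ⟨-r, by rw [neg_sq, hr], by simpa using h, by simpa using him0⟩
  · exact ⟨r, hr, h, him0⟩

/-- On each side of `0` the function is a decaying exponential with the same `μ`, `μ² = -2mz/ħ²`.
Continuity of the derivative makes the two coefficients opposite. For finite `β` the jump condition
then reads `b (2 + (2mβ/ħ²) μ) = 0`, whose second factor is nonzero because `μ` is not real; for `β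
= ∞`, `ψ'(0) = 0` gives `b = 0` directly. -/
theorem hamiltonian_eigenvector_eq_zero (hħ : 0 < ħ) (hm : 0 < m) {z : ℂ} (hz : z.im ≠ 0)
    {ψ : L2Line} (h : (ψ, z • ψ) ∈ hamiltonian ħ m β) : ψ = 0 := by
  obtain ⟨u, v, w, uR, uL, v₀, h1, h2, h3, h4, h5, h6, h7, h8, h9⟩ := h
  have hc : 0 < ħ ^ 2 / (2 * m) := by positivity
  set c := ħ ^ 2 / (2 * m) with hcd
  obtain ⟨μ, hμ2, hμ, hμi⟩ := exists_sqrt_re_pos (a := -z * ((c⁻¹ : ℝ) : ℂ)) (by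
    rw [im_mul_ofReal]
    exact mul_ne_zero (by simpa using hz) (by positivity))
  have hμ0 : μ ≠ 0 := fun h => by simp [h] at hμ
  have hw : w = (μ ^ 2) • ψ := by
    have e : z • ψ = (-c : ℝ) • w := h9
    rw [hμ2, mul_comm, neg_eq_neg_one_mul, mul_smul, mul_smul, e]
    change w = c⁻¹ • (-1 : ℂ) • (-c) • w
    rw [neg_smul, one_smul, smul_neg, smul_smul]
    rw [mul_neg, inv_mul_cancel₀ hc.ne', neg_smul, one_smul, neg_neg]
  have hwu : ∀ᵐ x : ℝ, w x = μ ^ 2 * u x := by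
    rw [hw]
    filter_upwards [Lp.coeFn_smul (μ ^ 2) ψ, h1] with x e1 e2
    rw [e1, Pi.smul_apply, smul_eq_mul]
    exact congrArg (μ ^ 2 * ·) e2
  have hvu : ∀ a b : ℝ, (0 : ℝ) ∉ Set.uIcc a b → v b - v a = ∫ x in a..b, μ ^ 2 * u x := by
    intro a b hab
    rw [h3 a b hab]
    refine intervalIntegral.integral_congr_ae ?_
    filter_upwards [hwu] with x hx _
    exact hx
  have huc : ∀ s : Set ℝ, (0 : ℝ) ∉ s → ContinuousOn (fun x => μ ^ 2 * u x) s := fun s hs x hx =>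
    ((h2 x (fun h => hs (h ▸ hx))).continuousAt.const_mul _).continuousWithinAt
  have hvd : ∀ x, x ≠ 0 → HasDerivAt v (μ ^ 2 * u x) x := by
    intro x hx
    rcases lt_or_gt_of_ne hx with h | h
    · refine hasDerivAt_of_integral_eq (s := Set.Iio 0) isOpen_Iio (huc _ (by simp))
        (fun a ha b hb => hvu a b ?_) h
      intro h0
      rw [Set.mem_uIcc] at h0
      simp only [Set.mem_Iio] at ha hb
      rcases h0 with h0 | h0 <;> linarith [h0.1, h0.2]
    · refine hasDerivAt_of_integral_eq (s := Set.Ioi 0) isOpen_Ioi (huc _ (by simp))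
        (fun a ha b hb => hvu a b ?_) h
      intro h0
      rw [Set.mem_uIcc] at h0
      simp only [Set.mem_Ioi] at ha hb
      rcases h0 with h0 | h0 <;> linarith [h0.1, h0.2]
  have huL2 : MemLp u 2 volume := (Lp.memLp ψ).ae_eq h1
  have huL2' : MemLp (fun x => u (-x)) 2 volume :=
    huL2.comp_measurePreserving (Measure.measurePreserving_neg volume)
  obtain ⟨b, hb⟩ := decaying_solution hμ (fun x hx => h2 x hx.ne') (fun x hx => hvd x hx.ne')
    (huL2.mono_measure Measure.restrict_le_self)
  obtain ⟨b', hb'⟩ := decaying_solution (u := fun x => u (-x)) (v := fun x => -v (-x)) hμ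
    (fun x hx => by
      have := (h2 (-x) (by linarith)).scomp x (hasDerivAt_neg x)
      simpa [Function.comp_def] using this)
    (fun x hx => by
      have := ((hvd (-x) (by linarith)).scomp x (hasDerivAt_neg x)).fun_neg
      simpa [Function.comp_def] using this) (huL2'.mono_measure Measure.restrict_le_self)
  have hE : ∀ a : ℂ, Tendsto (fun x : ℝ => a * cexp (-μ * x)) (𝓝[>] 0) (𝓝 a) := fun a => by
    have hc : Continuous fun x : ℝ => a * cexp (-μ * x) := by fun_prop
    have := (hc.tendsto 0).mono_left (nhdsWithin_le_nhds (s := Set.Ioi 0))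
    simpa using this
  have hneg : Tendsto (fun x : ℝ => -x) (𝓝[>] 0) (𝓝[<] 0) := by
    have := tendsto_neg_nhdsGT (a := (0 : ℝ))
    rwa [neg_zero] at this
  have e1 : uR = b := tendsto_nhds_unique h6 ((hE b).congr' (by
    filter_upwards [self_mem_nhdsWithin] with x hx
    exact (hb x hx).1.symm))
  have e2 : v₀ = -μ * b := tendsto_nhds_unique h4 ((hE (-μ * b)).congr' (by
    filter_upwards [self_mem_nhdsWithin] with x hx
    exact (hb x hx).2.symm))
  have e3 : uL = b' := tendsto_nhds_unique (h7.comp hneg) ((hE b').congr' (by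
    filter_upwards [self_mem_nhdsWithin] with x hx
    exact (hb' x hx).1.symm))
  have e4 : -v₀ = -μ * b' := tendsto_nhds_unique ((h5.comp hneg).neg) ((hE (-μ * b')).congr' (by
    filter_upwards [self_mem_nhdsWithin] with x hx
    exact (hb' x hx).2.symm))
  have hbb : b' = -b := by
    have : μ * b' = μ * (-b) := by linear_combination e4 + e2
    exact mul_left_cancel₀ hμ0 this
  have hb0 : b = 0 := by
    induction β using OnePoint.rec with
    | infty =>
      have h0 : v₀ = 0 := h8
      rw [h0] at e2
      rcases mul_eq_zero.1 e2.symm with h | h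
      · exact absurd (neg_eq_zero.1 h) hμ0
      · exact h
    | coe r =>
      have h0 : uR - uL = (2 * m * r / ħ ^ 2 : ℝ) * v₀ := h8
      rw [e1, e3, e2, hbb] at h0
      have h0' : b * (2 + (2 * m * r / ħ ^ 2 : ℝ) * μ) = 0 := by linear_combination h0
      rcases mul_eq_zero.1 h0' with h | h
      · exact h
      · exfalso
        have hi := congrArg Complex.im h
        have hr := congrArg Complex.re h
        simp only [add_im, add_re, im_ofReal_mul, re_ofReal_mul, zero_im, zero_re, re_ofNat,
          im_ofNat, zero_add] at hi hr
        rcases mul_eq_zero.1 hi with h | h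
        · rw [h] at hr
          norm_num at hr
        · exact hμi h
  refine Lp.ext ?_
  filter_upwards [h1, ae_ne_zero, Lp.coeFn_zero ℂ 2 (volume : Measure ℝ)] with x e5 hx e6
  rw [e6]
  refine e5.trans ?_
  rcases lt_or_gt_of_ne hx with h | h
  · have := (hb' (-x) (by linarith)).1
    rw [neg_neg, hbb, hb0] at this
    simpa using this
  · have := (hb x h).1
    rw [hb0] at this
    simpa using this

/-! ### The group generated by the Hamiltonian -/

variable (ħ m β) in
/-- The group `e^{-isH_β}`. -/
def hamiltonianGroup : ℝ → L2Line →L[ℂ] L2Line :=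
  halfLineGroup refl halfProj (boundaryOp (robin ħ m β)) (boundOp (robin ħ m β))
    (schrodingerGroup (ħ ^ 2 / (2 * m))) (-(ħ ^ 2 / (2 * m)) * robin ħ m β ^ 2)

theorem isIsometryGroup_hamiltonianGroup (ħ m : ℝ) (β : OnePoint ℝ) :
    IsIsometryGroup (hamiltonianGroup ħ m β) :=
  isIsometryGroup_halfLineGroup (halfLineData _) (isCommuting _ _)
    (isIsometryGroup_schrodingerGroup _)

/-- The resolution of the identity splits the vector into an even part with free regularity, the odd
restriction of a fixed vector of the involution with free regularity, and a multiple of the odd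
bound state. Each satisfies the boundary condition. -/
theorem generatorGraph_subset_hamiltonian (hħ : 0 < ħ) (hm : 0 < m)
    (hβ : β ≠ ((0 : ℝ) : OnePoint ℝ)) {f y : L2Line}
    (h : (f, y) ∈ generatorGraph (hamiltonianGroup ħ m β)) : (f, y) ∈ hamiltonian ħ m β := by
  have hD := halfLineData (robin ħ m β)
  have hC := isCommuting (robin ħ m β) (ħ ^ 2 / (2 * m))
  set κ := robin ħ m β with hκ
  have h1 : (evenProj refl f, evenProj refl y) ∈ hamiltonian ħ m β := by
    refine hamiltonian_even hħ hm ?_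
      (mem_generatorGraph_of_intertwining (fun t => even_halfLineGroup hD hC t) h)
    change refl ((1 / 2 : ℂ) • (f + refl f)) = (1 / 2 : ℂ) • (f + refl f)
    rw [map_smul, map_add, reflOp_reflOp, add_comm]
  have hJ : ∀ x, boundaryOp κ (oddExtension refl halfProj (boundaryOp κ) x)
      = oddExtension refl halfProj (boundaryOp κ) x := by
    intro x
    have := DFunLike.congr_fun hD.half_one_add_J_extension x
    change (1 / 2 : ℂ) • (oddExtension refl halfProj (boundaryOp κ) x
      + boundaryOp κ (oddExtension refl halfProj (boundaryOp κ) x))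
        = oddExtension refl halfProj (boundaryOp κ) x at this
    generalize oddExtension refl halfProj (boundaryOp κ) x = g at this ⊢
    have e : boundaryOp κ g = (2 : ℂ) • ((1 / 2 : ℂ) • (g + boundaryOp κ g)) - g := by module
    rw [e, this]
    module
  have hT : ∀ x, oddRestriction refl halfProj (boundaryOp κ)
      (oddExtension refl halfProj (boundaryOp κ) x)
        = ((1 - refl) * halfProj) (oddExtension refl halfProj (boundaryOp κ) x) := by
    intro x
    change (1 / 2 : ℂ) • ((1 - refl) * halfProj) (oddExtension refl halfProj (boundaryOp κ) x
      + boundaryOp κ (oddExtension refl halfProj (boundaryOp κ) x)) = _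
    rw [hJ, map_add]
    module
  have h2 : (oddRestriction refl halfProj (boundaryOp κ)
      (oddExtension refl halfProj (boundaryOp κ) f), oddRestriction refl halfProj (boundaryOp κ)
      (oddExtension refl halfProj (boundaryOp κ) y)) ∈ hamiltonian ħ m β := by
    rw [hT, hT]
    exact hamiltonian_restriction hħ hm hβ (hJ f)
      (mem_generatorGraph_of_intertwining (fun t => extension_halfLineGroup hD hC t) h)
  have h3 : (boundProj refl (boundOp κ) f, boundProj refl (boundOp κ) y) ∈ hamiltonian ħ m β := by
    rw [boundProj_of_mem_generatorGraph hD hC h]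
    have e : boundProj refl (boundOp κ) f = ((1 / 2 : ℂ) * inner ℂ (boundState κ) (f - refl f)) •
        ((1 - refl) * halfProj) (boundState κ) := by
      change (1 / 2 : ℂ) • (1 - refl) (inner ℂ (boundState κ) (f - refl f) • boundState κ) =
        ((1 / 2 : ℂ) * inner ℂ (boundState κ) (f - refl f)) •
        (1 - refl) (halfProj (boundState κ))
      rw [halfProj_boundState, map_smul, mul_smul]
    rw [e, smul_comm]
    exact hamiltonian_smul _ (hamiltonian_boundState hħ hm hβ)
  have hid : ∀ x, evenProj refl x + oddRestriction refl halfProj (boundaryOp κ)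
      (oddExtension refl halfProj (boundaryOp κ) x) + boundProj refl (boundOp κ) x = x := fun x =>
    DFunLike.congr_fun hD.resolution_of_identity x
  have h4 := hamiltonian_add (hamiltonian_add h1 h2) h3
  rwa [hid, hid] at h4

/-- The generator minus `i` is onto. An element of `H_β` outside the generator would therefore
differ from one inside by an eigenvector of `H_β` with eigenvalue `i`. -/
theorem hamiltonian_eq_generatorGraph (hħ : 0 < ħ) (hm : 0 < m)
    (hβ : β ≠ ((0 : ℝ) : OnePoint ℝ)) :
    hamiltonian ħ m β = generatorGraph (hamiltonianGroup ħ m β) := by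
  refine Set.Subset.antisymm ?_ fun x hx => generatorGraph_subset_hamiltonian hħ hm hβ hx
  rintro ⟨ψ, η⟩ h
  have hI : 0 < I.im := by simp
  have h1 := (isIsometryGroup_hamiltonianGroup ħ m β).laplaceResolvent_mem hI (η - I • ψ)
  set φ := laplaceResolvent (hamiltonianGroup ħ m β) I (η - I • ψ) with hφ
  have h2 := hamiltonian_sub h (generatorGraph_subset_hamiltonian hħ hm hβ h1)
  have e : η - (η - I • ψ + I • φ) = I • (ψ - φ) := by module
  rw [e] at h2
  have h3 := hamiltonian_eigenvector_eq_zero hħ hm hI.ne' h2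
  rw [← sub_eq_zero.1 h3, sub_add_cancel] at h1
  exact h1

end Hamiltonian

end DeltaPrime

end


open MeasureTheory Filter Topology Complex

noncomputable section

namespace DeltaPrime

open scoped FourierTransform

/-! ### Coherent states -/

section CoherentState

variable {ħ σ₀ : ℝ} {σ : ℂ}

theorem continuous_coherentState (ħ σ₀ : ℝ) (σ : ℂ) (ξ : ℝ × ℝ) :
    Continuous (coherentState ħ σ₀ σ ξ) := by
  unfold coherentState
  fun_prop

theorem cpow_half_sq (σ : ℂ) : (σ ^ (1 / 2 : ℂ)) ^ 2 = σ := by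
  have := Complex.cpow_nat_inv_pow σ (n := 2) (by norm_num)
  rwa [show ((2 : ℕ) : ℂ)⁻¹ = 1 / 2 by norm_num] at this

theorem ofReal_mul_cpow_half {r : ℝ} (hr : 0 < r) (hσ : σ ≠ 0) :
    (r * σ) ^ (1 / 2 : ℂ) = Real.sqrt r * σ ^ (1 / 2 : ℂ) := by
  have hr' : (r : ℂ) ≠ 0 := ofReal_ne_zero.2 hr.ne'
  rw [Complex.cpow_def_of_ne_zero (mul_ne_zero hr' hσ), Complex.cpow_def_of_ne_zero hσ,
    Complex.log_ofReal_mul hr hσ, add_mul, Complex.exp_add, Real.sqrt_eq_rpow,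
    Complex.ofReal_cpow hr.le, Complex.cpow_def_of_ne_zero hr', ofReal_log hr.le]
  push_cast
  rfl

theorem rpow_quarter_sq {a : ℝ} (ha : 0 ≤ a) : (a ^ (1 / 4 : ℝ)) ^ 2 = Real.sqrt a := by
  rw [Real.sqrt_eq_rpow, ← Real.rpow_natCast, ← Real.rpow_mul ha]
  norm_num

theorem inv_width_re (hħ : 0 < ħ) (hσ₀ : 0 < σ₀) (hσ : σ.re = σ₀) :
    (1 / (4 * ħ * σ₀ * σ) : ℂ).re = 1 / (4 * ħ * ‖σ‖ ^ 2) := by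
  have e : (4 * ħ * σ₀ * σ : ℂ) = ((4 * ħ * σ₀ : ℝ) : ℂ) * σ := by push_cast; rfl
  have hσ0 : ‖σ‖ ≠ 0 := norm_ne_zero_iff.2 fun h => by simp [h] at hσ; exact hσ₀.ne hσ
  rw [e, one_div, Complex.inv_re, re_ofReal_mul, hσ, Complex.normSq_mul, Complex.normSq_ofReal,
    Complex.normSq_eq_norm_sq]
  field_simp

theorem norm_sq_coherentState (hħ : 0 < ħ) (hσ₀ : 0 < σ₀) (hσ : σ.re = σ₀) (ξ : ℝ × ℝ) (x : ℝ) :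
    ‖coherentState ħ σ₀ σ ξ x‖ ^ 2 = (Real.sqrt (2 * Real.pi * ħ) * ‖σ‖)⁻¹ *
      Real.exp (-(1 / (2 * ħ * ‖σ‖ ^ 2)) * (x - ξ.1) ^ 2) := by
  have hre : (-(1 / (4 * ħ * σ₀ * σ)) * ((x : ℂ) - ξ.1) ^ 2
      + I / ħ * ξ.2 * ((x : ℂ) - ξ.1)).re = -(1 / (4 * ħ * ‖σ‖ ^ 2)) * (x - ξ.1) ^ 2 := by
    have e1 : ((x : ℂ) - ξ.1) ^ 2 = (((x - ξ.1) ^ 2 : ℝ) : ℂ) := by push_cast; rfl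
    have e2 : I / ħ * ξ.2 * ((x : ℂ) - ξ.1) = ((ξ.2 / ħ * (x - ξ.1) : ℝ) : ℂ) * I := by
      push_cast
      ring
    rw [e1, e2, add_re, re_mul_ofReal, neg_re, inv_width_re hħ hσ₀ hσ, re_ofReal_mul, I_re,
      mul_zero, add_zero]
  rw [coherentState, norm_mul, mul_pow, norm_exp, hre, ← Real.exp_nat_mul, norm_div, norm_one,
    norm_mul, div_pow, mul_pow, ← norm_pow, ← norm_pow, cpow_half_sq, ← ofReal_pow,
    rpow_quarter_sq (by positivity), Complex.norm_real, Real.norm_of_nonneg (Real.sqrt_nonneg _),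
    one_pow, one_div]
  congr 2
  push_cast
  ring

theorem memLp_coherentState_of_re (hħ : 0 < ħ) (hσ₀ : 0 < σ₀) (hσ : σ.re = σ₀) (ξ : ℝ × ℝ) :
    MemLp (coherentState ħ σ₀ σ ξ) 2 volume := by
  rw [memLp_two_iff_integrable_sq_norm (continuous_coherentState ħ σ₀ σ ξ).aestronglyMeasurable]
  simp only [norm_sq_coherentState hħ hσ₀ hσ]
  have hσ0 : 0 < ‖σ‖ := norm_pos_iff.2 fun h => by simp [h] at hσ; exact hσ₀.ne hσ
  exact ((integrable_exp_neg_mul_sq (by positivity)).comp_sub_right ξ.1).const_mul _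

theorem coherentState_eq_quadratic (ħ σ₀ : ℝ) (σ : ℂ) (ξ : ℝ × ℝ) (k : ℂ) (x : ℝ) :
    cexp (k * x) * coherentState ħ σ₀ σ ξ x =
      1 / (((2 * Real.pi * ħ) ^ (1 / 4 : ℝ) : ℝ) * σ ^ (1 / 2 : ℂ)) *
        cexp (-(1 / (4 * ħ * σ₀ * σ)) * x ^ 2
          + (2 * (1 / (4 * ħ * σ₀ * σ)) * ξ.1 + (I / ħ * ξ.2 + k)) * x
          + (-(1 / (4 * ħ * σ₀ * σ)) * ξ.1 ^ 2 - I / ħ * ξ.2 * ξ.1)) := by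
  rw [coherentState, mul_left_comm, ← Complex.exp_add]
  congr 2
  ring

theorem integrable_exp_mul_coherentState (hħ : 0 < ħ) (hσ₀ : 0 < σ₀) (hσ : σ.re = σ₀)
    (ξ : ℝ × ℝ) (k : ℂ) : Integrable fun x : ℝ => cexp (k * x) * coherentState ħ σ₀ σ ξ x := by
  have hσ0 : 0 < ‖σ‖ := norm_pos_iff.2 fun h => by simp [h] at hσ; exact hσ₀.ne hσ
  simp only [coherentState_eq_quadratic]
  refine (integrable_cexp_quadratic' ?_ _ _).const_mul _
  rw [neg_re, inv_width_re hħ hσ₀ hσ, neg_lt_zero]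
  positivity

theorem integrable_coherentState (hħ : 0 < ħ) (hσ₀ : 0 < σ₀) (hσ : σ.re = σ₀) (ξ : ℝ × ℝ) :
    Integrable (coherentState ħ σ₀ σ ξ) := by
  simpa using integrable_exp_mul_coherentState hħ hσ₀ hσ ξ 0

/-- The normalization of the coherent states in momentum space. -/
def momentumAmplitude (ħ σ₀ : ℝ) : ℝ :=
  Real.sqrt (4 * Real.pi * ħ * σ₀) / (2 * Real.pi * ħ) ^ (1 / 4 : ℝ)

/-- The Gaussian integral produces `(4πħσ₀σ)^{1/2}`, which on the principal branch cancels the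
normalizing `σ^{1/2}`. The amplitude is therefore independent of `σ`, and so the same at all times.
-/
theorem integral_exp_mul_coherentState (hħ : 0 < ħ) (hσ₀ : 0 < σ₀) (hσ : σ.re = σ₀)
    (ξ : ℝ × ℝ) (k : ℂ) :
    ∫ x : ℝ, cexp (k * x) * coherentState ħ σ₀ σ ξ x = momentumAmplitude ħ σ₀ *
      cexp (ħ * σ₀ * σ * (I / ħ * ξ.2 + k) ^ 2 + k * ξ.1) := by
  have hσ0 : σ ≠ 0 := fun h => by simp [h] at hσ; exact hσ₀.ne hσ
  have hn : 0 < ‖σ‖ := norm_pos_iff.2 hσ0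
  have hħ' : (ħ : ℂ) ≠ 0 := ofReal_ne_zero.2 hħ.ne'
  have hσ₀' : (σ₀ : ℂ) ≠ 0 := ofReal_ne_zero.2 hσ₀.ne'
  have hs : σ ^ (1 / 2 : ℂ) ≠ 0 := by simp [Complex.cpow_eq_zero_iff, hσ0]
  have hA : (((2 * Real.pi * ħ) ^ (1 / 4 : ℝ) : ℝ) : ℂ) ≠ 0 := by
    rw [ofReal_ne_zero]
    positivity
  simp only [coherentState_eq_quadratic]
  rw [integral_const_mul, integral_cexp_quadratic (by
    rw [neg_re, inv_width_re hħ hσ₀ hσ, neg_lt_zero]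
    positivity)]
  have e : (Real.pi / - -(1 / (4 * ħ * σ₀ * σ)) : ℂ) = ((4 * Real.pi * ħ * σ₀ : ℝ) : ℂ) * σ := by
    push_cast
    field_simp
  rw [e, ofReal_mul_cpow_half (by positivity) hσ0, momentumAmplitude, ← mul_assoc]
  congr 1
  · push_cast
    field_simp
  · congr 1
    field_simp
    ring

theorem fourier_coherentState (hħ : 0 < ħ) (hσ₀ : 0 < σ₀) (hσ : σ.re = σ₀) (ξ : ℝ × ℝ) (ζ : ℝ) :
    𝓕 (coherentState ħ σ₀ σ ξ) ζ = momentumAmplitude ħ σ₀ *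
      cexp (-(ħ * σ₀ * σ * (ξ.2 / ħ - 2 * Real.pi * ζ) ^ 2) - 2 * Real.pi * ζ * ξ.1 * I) := by
  have := integral_exp_mul_coherentState hħ hσ₀ hσ ξ (-(2 * Real.pi * ζ * I))
  rw [Real.fourier_eq']
  have e : ∀ x : ℝ, cexp (↑(-2 * Real.pi * inner ℝ x ζ) * I) • coherentState ħ σ₀ σ ξ x
      = cexp (-(2 * Real.pi * ζ * I) * x) * coherentState ħ σ₀ σ ξ x := by
    intro x
    rw [smul_eq_mul]
    congr 2
    simp
    ring
  simp only [e]
  rw [this]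
  congr 2
  linear_combination (ħ * σ₀ * σ * (ξ.2 / ħ - 2 * Real.pi * ζ) ^ 2 : ℂ) * I_sq

/-- The coherent state `ψ^ħ_{σ,ξ}` as an element of `L²(ℝ)`. -/
def coherentLp (hħ : 0 < ħ) (hσ₀ : 0 < σ₀) (hσ : σ.re = σ₀) (ξ : ℝ × ℝ) : L2Line :=
  (memLp_coherentState_of_re hħ hσ₀ hσ ξ).toLp _

theorem coherentLp_coeFn (hħ : 0 < ħ) (hσ₀ : 0 < σ₀) (hσ : σ.re = σ₀) (ξ : ℝ × ℝ) :
    coherentLp hħ hσ₀ hσ ξ =ᵐ[volume] coherentState ħ σ₀ σ ξ :=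
  (memLp_coherentState_of_re hħ hσ₀ hσ ξ).coeFn_toLp

theorem initialState_eq_coherentLp (hħ : 0 < ħ) (hσ₀ : 0 < σ₀) (ξ : ℝ × ℝ) :
    initialState hħ hσ₀ ξ = coherentLp hħ hσ₀ (ofReal_re σ₀) ξ := rfl

theorem fourierOp_coherentLp (hħ : 0 < ħ) (hσ₀ : 0 < σ₀) (hσ : σ.re = σ₀) (ξ : ℝ × ℝ) :
    ∀ᵐ ζ : ℝ, fourierOp (coherentLp hħ hσ₀ hσ ξ) ζ = momentumAmplitude ħ σ₀ *
      cexp (-(ħ * σ₀ * σ * (ξ.2 / ħ - 2 * Real.pi * ζ) ^ 2) - 2 * Real.pi * ζ * ξ.1 * I) := by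
  filter_upwards [fourierOp_toLp_ae (integrable_coherentState hħ hσ₀ hσ ξ)
    (memLp_coherentState_of_re hħ hσ₀ hσ ξ)] with ζ hζ
  rw [← fourier_coherentState hħ hσ₀ hσ]
  exact hζ

theorem norm_coherentLp (hħ : 0 < ħ) (hσ₀ : 0 < σ₀) (hσ : σ.re = σ₀) (ξ : ℝ × ℝ) :
    ‖coherentLp hħ hσ₀ hσ ξ‖ = 1 := by
  have hσ0 : 0 < ‖σ‖ := norm_pos_iff.2 fun h => by simp [h] at hσ; exact hσ₀.ne hσ
  refine (pow_eq_one_iff_of_nonneg (norm_nonneg _) two_ne_zero).1 ?_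
  rw [norm_sq_eq_integral]
  have e : ∫ x, ‖coherentLp hħ hσ₀ hσ ξ x‖ ^ 2 = ∫ x : ℝ, (Real.sqrt (2 * Real.pi * ħ) * ‖σ‖)⁻¹ *
      Real.exp (-(1 / (2 * ħ * ‖σ‖ ^ 2)) * (x - ξ.1) ^ 2) := by
    refine integral_congr_ae ?_
    filter_upwards [coherentLp_coeFn hħ hσ₀ hσ ξ] with x hx
    rw [hx, norm_sq_coherentState hħ hσ₀ hσ]
  rw [e, integral_const_mul,
    integral_sub_right_eq_self (fun x => Real.exp (-(1 / (2 * ħ * ‖σ‖ ^ 2)) * x ^ 2)) ξ.1,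
    integral_gaussian]
  have : Real.pi / (1 / (2 * ħ * ‖σ‖ ^ 2)) = (2 * Real.pi * ħ) * ‖σ‖ ^ 2 := by
    field_simp
  rw [this, Real.sqrt_mul (by positivity : 0 ≤ 2 * Real.pi * ħ) (‖σ‖ ^ 2), Real.sqrt_sq hσ0.le]
  have : Real.sqrt (2 * Real.pi * ħ) ≠ 0 := by positivity
  field_simp

/-- Turns the phase-space reflection of the classical formula into the reflection `R` of the line.
-/
theorem coherentState_neg (ħ σ₀ : ℝ) (σ : ℂ) (ξ : ℝ × ℝ) (x : ℝ) :
    coherentState ħ σ₀ σ (-ξ) x = coherentState ħ σ₀ σ ξ (-x) := by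
  simp only [coherentState, Prod.fst_neg, Prod.snd_neg]
  congr 2
  push_cast
  ring

theorem refl_coherentLp (hħ : 0 < ħ) (hσ₀ : 0 < σ₀) (hσ : σ.re = σ₀) (ξ : ℝ × ℝ) :
    refl (coherentLp hħ hσ₀ hσ ξ) = coherentLp hħ hσ₀ hσ (-ξ) := by
  refine Lp.ext ?_
  filter_upwards [reflOp_coeFn (coherentLp hħ hσ₀ hσ ξ),
    ae_comp_neg (coherentLp_coeFn hħ hσ₀ hσ ξ), coherentLp_coeFn hħ hσ₀ hσ (-ξ)] with x h1 h2 h3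
  rw [h1, h2, h3, coherentState_neg]

/-! ### Estimates for coherent states -/

/-- If `q` and `x` have opposite signs, then `(x - q)² ≥ x² + q²`, and the Gaussian factor in `q`
splits off. -/
theorem norm_coherentState_le (hħ : 0 < ħ) (hσ₀ : 0 < σ₀) (hσ : σ.re = σ₀) {q p x : ℝ}
    (hqx : q * x ≤ 0) :
    ‖coherentState ħ σ₀ σ (q, p) x‖
      ≤ Real.exp (-(q ^ 2 / (4 * ħ * ‖σ‖ ^ 2))) * ‖coherentState ħ σ₀ σ (0, p) x‖ := by
  have hσ0 : 0 < ‖σ‖ := norm_pos_iff.2 fun h => by simp [h] at hσ; exact hσ₀.ne hσ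
  refine (pow_le_pow_iff_left₀ (norm_nonneg _) (by positivity) two_ne_zero).1 ?_
  rw [mul_pow, norm_sq_coherentState hħ hσ₀ hσ, norm_sq_coherentState hħ hσ₀ hσ, mul_left_comm,
    ← Real.exp_nat_mul, ← Real.exp_add]
  refine mul_le_mul_of_nonneg_left (Real.exp_le_exp.2 ?_) (by positivity)
  have e : ((2 : ℕ) : ℝ) * -(q ^ 2 / (4 * ħ * ‖σ‖ ^ 2)) + -(1 / (2 * ħ * ‖σ‖ ^ 2)) * (x - 0) ^ 2
      = -(1 / (2 * ħ * ‖σ‖ ^ 2)) * (q ^ 2 + x ^ 2) := by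
    push_cast
    field_simp
    ring
  rw [e, neg_mul, neg_mul, neg_le_neg_iff]
  refine mul_le_mul_of_nonneg_left ?_ (by positivity)
  simp only
  nlinarith

theorem norm_halfProj_coherentLp_le (hħ : 0 < ħ) (hσ₀ : 0 < σ₀) (hσ : σ.re = σ₀) {q p : ℝ}
    (hq : q ≤ 0) :
    ‖halfProj (coherentLp hħ hσ₀ hσ (q, p))‖ ≤ Real.exp (-(q ^ 2 / (4 * ħ * ‖σ‖ ^ 2))) := by
  have h : ‖halfProj (coherentLp hħ hσ₀ hσ (q, p))‖ ≤ Real.exp (-(q ^ 2 / (4 * ħ * ‖σ‖ ^ 2)))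
      * ‖coherentLp hħ hσ₀ hσ (0, p)‖ := by
    refine Lp.norm_le_mul_norm_of_ae_le_mul ?_
    filter_upwards [halfProj_coeFn (coherentLp hħ hσ₀ hσ (q, p)),
      coherentLp_coeFn hħ hσ₀ hσ (q, p), coherentLp_coeFn hħ hσ₀ hσ (0, p)] with x h1 h2 h3
    rw [h1, h2, h3]
    split_ifs with hx
    · exact norm_coherentState_le hħ hσ₀ hσ (mul_nonpos_of_nonpos_of_nonneg hq hx.le)
    · rw [norm_zero]
      positivity
  rwa [norm_coherentLp, mul_one] at h

theorem norm_sub_halfProj_coherentLp_le (hħ : 0 < ħ) (hσ₀ : 0 < σ₀) (hσ : σ.re = σ₀) {q p : ℝ}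
    (hq : 0 ≤ q) :
    ‖coherentLp hħ hσ₀ hσ (q, p) - halfProj (coherentLp hħ hσ₀ hσ (q, p))‖
      ≤ Real.exp (-(q ^ 2 / (4 * ħ * ‖σ‖ ^ 2))) := by
  have h := norm_halfProj_coherentLp_le hħ hσ₀ hσ (q := -q) (p := -p) (by linarith)
  rw [neg_sq, ← Prod.neg_mk, ← refl_coherentLp] at h
  have e := refl_halfProj (refl (coherentLp hħ hσ₀ hσ (q, p)))
  rw [reflOp_reflOp] at e
  rwa [← e, norm_reflOp]

/-- In momentum space the free phase is Gaussian in `k`: completing the square at `k = p/ħ` moves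
its quadratic part into `σ_t`, its linear part into `q_t` and its constant into `A_t`. -/
theorem schrodingerGroup_coherentLp (hħ : 0 < ħ) {m : ℝ} (hm : 0 < m) (hσ₀ : 0 < σ₀)
    (t : ℝ) (hσ : (sigmaT m σ₀ t).re = σ₀) (q p : ℝ) :
    schrodingerGroup (ħ ^ 2 / (2 * m)) (t / ħ) (coherentLp hħ hσ₀ (ofReal_re σ₀) (q, p))
      = cexp (I / ħ * (p ^ 2 * t / (2 * m))) • coherentLp hħ hσ₀ hσ (q + p * t / m, p) := by
  apply fourierOp_injective
  rw [fourierOp_schrodingerGroup, map_smul]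
  refine Lp.ext ?_
  filter_upwards [fourierOp_coherentLp hħ hσ₀ (ofReal_re σ₀) (q, p),
    fourierOp_coherentLp hħ hσ₀ hσ (q + p * t / m, p),
    Lp.coeFn_smul (cexp (I / ħ * (p ^ 2 * t / (2 * m))))
      (fourierOp (coherentLp hħ hσ₀ hσ (q + p * t / m, p))),
    mulOp_coeFn (measurable_phase (measurable_dispersion (ħ ^ 2 / (2 * m))) (t / ħ))
      (norm_phase_le (dispersion (ħ ^ 2 / (2 * m))) (t / ħ))
      (fourierOp (coherentLp hħ hσ₀ (ofReal_re σ₀) (q, p)))] with ζ h1 h2 h3 h4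
  rw [phaseOp, h4, h1, h3, Pi.smul_apply, h2, phase, smul_eq_mul, mul_left_comm,
    mul_left_comm (cexp _), ← Complex.exp_add, ← Complex.exp_add, dispersion, sigmaT]
  congr 2
  have hħ' : (ħ : ℂ) ≠ 0 := ofReal_ne_zero.2 hħ.ne'
  have hσ₀' : (σ₀ : ℂ) ≠ 0 := ofReal_ne_zero.2 hσ₀.ne'
  have hm' : (m : ℂ) ≠ 0 := ofReal_ne_zero.2 hm.ne'
  push_cast
  field_simp
  ring

end CoherentState

end DeltaPrime

end


open MeasureTheory Filter Topology Complex

noncomputable section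

namespace DeltaPrime

section Estimates

variable {ħ σ₀ : ℝ} {σ : ℂ}

/-! ### Freezing the symbol at the central momentum -/

/-- The difference of two values of the symbol is `2iκ(k - k₁)/((ik + κ)(ik₁ + κ))`. The
denominators are at least `|k| ≥ (1 - η)k₀` and `|k₁| = k₀`. -/
theorem norm_symbol_sub_symbol_le (κ : ℝ) {ζ ζ₁ η k₀ : ℝ} (hη : η < 1) (hk₀ : 0 < k₀)
    (h₁ : |2 * Real.pi * ζ₁| = k₀) (h : |2 * Real.pi * ζ - 2 * Real.pi * ζ₁| ≤ η * k₀) :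
    ‖symbol κ ζ - symbol κ ζ₁‖ ≤ 2 * (η / (1 - η) * (|κ| / k₀)) := by
  have hη' : 0 < 1 - η := by linarith
  have hk : (1 - η) * k₀ ≤ |2 * Real.pi * ζ| := by
    have := abs_sub_abs_le_abs_sub (2 * Real.pi * ζ₁) (2 * Real.pi * ζ)
    rw [abs_sub_comm (2 * Real.pi * ζ₁), h₁] at this
    linarith
  have hpos : 0 < (1 - η) * k₀ := by positivity
  have hζ : ζ ≠ 0 := fun h0 => by
    rw [h0, mul_zero, abs_zero] at hk
    linarith
  have hζ₁ : ζ₁ ≠ 0 := fun h0 => by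
    rw [h0, mul_zero, abs_zero] at h₁
    linarith
  have lower : ∀ x : ℝ, |2 * Real.pi * x| ≤ ‖(2 * Real.pi * x * I + κ : ℂ)‖ := by
    intro x
    have := Complex.abs_im_le_norm (2 * Real.pi * x * I + κ : ℂ)
    simpa using this
  have d := symbol_denominator_ne_zero (κ := κ) hζ
  have d₁ := symbol_denominator_ne_zero (κ := κ) hζ₁
  have e : symbol κ ζ - symbol κ ζ₁
      = ((2 * κ * (2 * Real.pi * ζ - 2 * Real.pi * ζ₁) : ℝ) : ℂ) * I
        / ((2 * Real.pi * ζ * I + κ) * (2 * Real.pi * ζ₁ * I + κ)) := by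
    rw [symbol, symbol, div_sub_div _ _ d d₁]
    congr 1
    push_cast
    ring
  rw [e, norm_div, norm_mul, norm_mul, norm_I, mul_one, Complex.norm_real, Real.norm_eq_abs,
    abs_mul, abs_mul, abs_two]
  calc 2 * |κ| * |2 * Real.pi * ζ - 2 * Real.pi * ζ₁|
        / (‖(2 * Real.pi * ζ * I + κ : ℂ)‖ * ‖(2 * Real.pi * ζ₁ * I + κ : ℂ)‖)
      ≤ 2 * |κ| * (η * k₀) / ((1 - η) * k₀ * k₀) := by
        have h1 := hk.trans (lower ζ)
        have h2 := h₁ ▸ lower ζ₁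
        have h3 : 0 ≤ η * k₀ := (abs_nonneg _).trans h
        gcongr
    _ = 2 * (η / (1 - η) * (|κ| / k₀)) := by
        field_simp

theorem norm_fourierOp_coherentLp (hħ : 0 < ħ) (hσ₀ : 0 < σ₀) (hσ : σ.re = σ₀) (ξ : ℝ × ℝ) :
    ∀ᵐ ζ : ℝ, ‖fourierOp (coherentLp hħ hσ₀ hσ ξ) ζ‖ = momentumAmplitude ħ σ₀ *
      Real.exp (-(ħ * σ₀ ^ 2 * (ξ.2 / ħ - 2 * Real.pi * ζ) ^ 2)) := by
  filter_upwards [fourierOp_coherentLp hħ hσ₀ hσ ξ] with ζ hζ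
  have hA : 0 ≤ momentumAmplitude ħ σ₀ := by
    unfold momentumAmplitude
    positivity
  have e1 : (-(ħ * σ₀ * σ * (ξ.2 / ħ - 2 * Real.pi * ζ) ^ 2) - 2 * Real.pi * ζ * ξ.1 * I : ℂ)
      = ((-(ħ * σ₀ * (ξ.2 / ħ - 2 * Real.pi * ζ) ^ 2) : ℝ) : ℂ) * σ
        - ((2 * Real.pi * ζ * ξ.1 : ℝ) : ℂ) * I := by
    push_cast
    ring
  rw [hζ, norm_mul, Complex.norm_real, Real.norm_of_nonneg hA, norm_exp, e1, sub_re,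
    re_ofReal_mul, re_ofReal_mul, I_re, hσ]
  congr 2
  ring

theorem momentumAmplitude_le (hħ : 0 < ħ) (hσ₀ : 0 < σ₀) :
    momentumAmplitude ħ σ₀ ≤ 2 * momentumAmplitude ħ (σ₀ / Real.sqrt 2) := by
  unfold momentumAmplitude
  rw [← mul_div_assoc]
  gcongr
  have h2 : Real.sqrt 2 ≤ 4 := by
    rw [Real.sqrt_le_left (by norm_num)]
    norm_num
  refine Real.sqrt_le_iff.2 ⟨by positivity, ?_⟩
  rw [mul_pow, Real.sq_sqrt (by positivity)]
  have hs : 0 < Real.sqrt 2 := by positivity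
  rw [mul_div_assoc', mul_div_assoc', le_div_iff₀ hs]
  have : 0 ≤ 4 * Real.pi * ħ * σ₀ := by positivity
  nlinarith

/-- Near the central momentum the symbol is almost constant. Away from it the difference of symbols
is at most `2`, and half of the Gaussian exponent is spent on the factor `e^{-η²σ₀²p²/(2ħ)}`; the
other half is the momentum profile of a normalized coherent state of width `σ₀/√2`. -/
theorem norm_symbolOp_coherentLp_sub_le (hħ : 0 < ħ) (hσ₀ : 0 < σ₀) (hσ : σ.re = σ₀) (κ : ℝ)
    {η : ℝ} (hη : 0 < η) (hη1 : η < 1) (q : ℝ) {p : ℝ} (hp : p ≠ 0) :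
    ‖symbolOp κ (coherentLp hħ hσ₀ hσ (q, p))
        - symbol κ (p / (2 * Real.pi * ħ)) • coherentLp hħ hσ₀ hσ (q, p)‖
      ≤ 2 * (η / (1 - η) * (|κ| / (|p| / ħ)))
        + 4 * Real.exp (-(η ^ 2 * (σ₀ ^ 2 * p ^ 2 / (2 * ħ)))) := by
  have hs : 0 < Real.sqrt 2 := by positivity
  have hσ₁ : 0 < σ₀ / Real.sqrt 2 := by positivity
  have hk₀ : 0 < |p| / ħ := div_pos (abs_pos.2 hp) hħ
  set f := coherentLp hħ hσ₀ hσ (q, p) with hf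
  set g := coherentLp hħ hσ₁ (ofReal_re (σ₀ / Real.sqrt 2)) (q, p) with hg
  set s₁ := symbol κ (p / (2 * Real.pi * ħ)) with hs₁
  set α := 2 * (η / (1 - η) * (|κ| / (|p| / ħ))) with hα
  set ε := Real.exp (-(η ^ 2 * (σ₀ ^ 2 * p ^ 2 / (2 * ħ)))) with hε
  have hη' : 0 < 1 - η := by linarith
  have hα0 : 0 ≤ α := by positivity
  have key : ∀ᵐ ζ : ℝ, ‖fourierOp (symbolOp κ f - s₁ • f) ζ‖
      ≤ ‖((α : ℂ) • (‖fourierOp f ζ‖ : ℂ) + (4 * ε : ℂ) • (‖fourierOp g ζ‖ : ℂ))‖ := by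
    rw [map_sub, map_smul, fourierOp_symbolOp]
    filter_upwards [Lp.coeFn_sub (mulOp (symbol κ) (measurable_symbol κ) (norm_symbol_le κ)
        (fourierOp f)) (s₁ • fourierOp f), Lp.coeFn_smul s₁ (fourierOp f),
      mulOp_coeFn (measurable_symbol κ) (norm_symbol_le κ) (fourierOp f),
      norm_fourierOp_coherentLp hħ hσ₀ hσ (q, p),
      norm_fourierOp_coherentLp hħ hσ₁ (ofReal_re (σ₀ / Real.sqrt 2)) (q, p)] with ζ h1 h2 h3 h4 h5
    rw [h1, Pi.sub_apply, h2, h3, Pi.smul_apply, smul_eq_mul, ← sub_mul, norm_mul]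
    have e : (α : ℂ) • (‖fourierOp f ζ‖ : ℂ) + (4 * ε : ℂ) • (‖fourierOp g ζ‖ : ℂ)
        = ((α * ‖fourierOp f ζ‖ + 4 * ε * ‖fourierOp g ζ‖ : ℝ) : ℂ) := by
      rw [smul_eq_mul, smul_eq_mul]
      push_cast
      rfl
    rw [e, Complex.norm_real, Real.norm_of_nonneg (by positivity)]
    have h₁ : 2 * Real.pi * (p / (2 * Real.pi * ħ)) = p / ħ := by field_simp
    have h₁' : |2 * Real.pi * (p / (2 * Real.pi * ħ))| = |p| / ħ := by
      rw [h₁, abs_div, abs_of_pos hħ]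
    rcases le_or_gt |2 * Real.pi * ζ - 2 * Real.pi * (p / (2 * Real.pi * ħ))| (η * (|p| / ħ))
      with h | h
    · have := mul_le_mul_of_nonneg_right (norm_symbol_sub_symbol_le κ hη1 hk₀ h₁' h)
        (norm_nonneg (fourierOp f ζ))
      rw [← hα, ← hs₁] at this
      have h0 : 0 ≤ 4 * ε * ‖fourierOp g ζ‖ := by positivity
      linarith
    · have hs2 : ‖symbol κ ζ - s₁‖ ≤ 2 := by
        have := norm_sub_le (symbol κ ζ) s₁
        linarith [norm_symbol_le κ ζ, norm_symbol_le κ (p / (2 * Real.pi * ħ))]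
      have hfg : ‖fourierOp f ζ‖ ≤ 2 * ε * ‖fourierOp g ζ‖ := by
        have hexp : Real.exp (-(ħ * σ₀ ^ 2 * (p / ħ - 2 * Real.pi * ζ) ^ 2))
            ≤ ε * Real.exp (-(ħ * (σ₀ / Real.sqrt 2) ^ 2 * (p / ħ - 2 * Real.pi * ζ) ^ 2)) := by
          rw [hε, ← Real.exp_add, Real.exp_le_exp, div_pow, Real.sq_sqrt (by norm_num)]
          have hsq : (η * (|p| / ħ)) ^ 2 ≤ (p / ħ - 2 * Real.pi * ζ) ^ 2 := by
            rw [h₁, abs_sub_comm] at h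
            rw [← sq_abs (p / ħ - 2 * Real.pi * ζ)]
            gcongr
          have hc : 0 ≤ ħ * σ₀ ^ 2 / 2 := by positivity
          have e2 : η ^ 2 * (σ₀ ^ 2 * p ^ 2 / (2 * ħ)) = ħ * σ₀ ^ 2 / 2 * (η * (|p| / ħ)) ^ 2 := by
            rw [mul_pow, div_pow, sq_abs]
            field_simp
          rw [e2]
          nlinarith [mul_le_mul_of_nonneg_left hsq hc]
        rw [h4, h5]
        calc _ ≤ (2 * momentumAmplitude ħ (σ₀ / Real.sqrt 2)) *
              (ε * Real.exp (-(ħ * (σ₀ / Real.sqrt 2) ^ 2 * (p / ħ - 2 * Real.pi * ζ) ^ 2))) := by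
              refine mul_le_mul (momentumAmplitude_le hħ hσ₀) hexp (Real.exp_nonneg _) ?_
              unfold momentumAmplitude
              positivity
          _ = _ := by ring
      have h0 : 0 ≤ α * ‖fourierOp f ζ‖ := by positivity
      calc _ ≤ 2 * (2 * ε * ‖fourierOp g ζ‖) :=
            mul_le_mul hs2 hfg (norm_nonneg _) (by norm_num)
        _ ≤ _ := by linarith
  have hF : MemLp (fun ζ => (‖fourierOp f ζ‖ : ℂ)) 2 volume := (Lp.memLp (fourierOp f)).norm.ofReal
  have hG : MemLp (fun ζ => (‖fourierOp g ζ‖ : ℂ)) 2 volume := (Lp.memLp (fourierOp g)).norm.ofReal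
  have hFn : ‖hF.toLp _‖ = 1 := by
    rw [Lp.norm_toLp, eLpNorm_congr_norm_ae (g := fourierOp f)
      (Eventually.of_forall fun ζ => by simp), ← Lp.norm_def, norm_fourierOp, hf, norm_coherentLp]
  have hGn : ‖hG.toLp _‖ = 1 := by
    rw [Lp.norm_toLp, eLpNorm_congr_norm_ae (g := fourierOp g)
      (Eventually.of_forall fun ζ => by simp), ← Lp.norm_def, norm_fourierOp, hg, norm_coherentLp]
  have hle : ‖fourierOp (symbolOp κ f - s₁ • f)‖
      ≤ ‖(α : ℂ) • hF.toLp _ + (4 * ε : ℂ) • hG.toLp _‖ := by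
    refine Lp.norm_le_norm_of_ae_le ?_
    filter_upwards [key, Lp.coeFn_add ((α : ℂ) • hF.toLp _) ((4 * ε : ℂ) • hG.toLp _),
      Lp.coeFn_smul (α : ℂ) (hF.toLp _), Lp.coeFn_smul (4 * ε : ℂ) (hG.toLp _), hF.coeFn_toLp,
      hG.coeFn_toLp] with ζ h1 h2 h3 h4 h5 h6
    rw [h2, Pi.add_apply, h3, h4, Pi.smul_apply, Pi.smul_apply, h5, h6]
    exact h1
  rw [norm_fourierOp] at hle
  refine hle.trans ((norm_add_le _ _).trans ?_)
  rw [norm_smul, norm_smul, hFn, hGn, Complex.norm_real, Real.norm_of_nonneg hα0, norm_mul,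
    Complex.norm_real, Real.norm_of_nonneg (Real.exp_nonneg _), mul_one, mul_one, RCLike.norm_ofNat]

/-! ### Overlap with the bound state -/

/-- The integral over `x > 0` is the one over the line minus the one over `x ≤ 0`. The first is an
explicit Gaussian integral, small in `p`. In the second the factor in `q` splits off and a state
centred at `0` remains. -/
theorem norm_inner_boundState_coherentLp_le (hħ : 0 < ħ) (hσ₀ : 0 < σ₀) (κ : ℝ) {q p : ℝ}
    (hq : 0 ≤ q) :
    ‖inner ℂ (boundState κ) (coherentLp hħ hσ₀ (ofReal_re σ₀) (q, p))‖
      ≤ 4 * ((ħ * σ₀ ^ 2 * κ ^ 2) ^ (1 / 4 : ℝ) * Real.exp (ħ * σ₀ ^ 2 * κ ^ 2) *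
        (Real.exp (-(σ₀ ^ 2 * p ^ 2 / ħ)) + Real.exp (-(q ^ 2 / (4 * ħ * σ₀ ^ 2))))) := by
  rcases le_or_gt 0 κ with hκ | hκ
  · rw [boundState_of_nonneg hκ, inner_zero_left, norm_zero]
    positivity
  set F : ℝ → ℂ := fun x => cexp (κ * x) * coherentState ħ σ₀ σ₀ (q, p) x with hF
  set G : ℝ → ℂ := fun x => cexp (κ * x) * coherentState ħ σ₀ σ₀ (0, 0) x with hG
  have hFi : Integrable F := integrable_exp_mul_coherentState hħ hσ₀ (ofReal_re σ₀) (q, p) κ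
  have hGi : Integrable G := integrable_exp_mul_coherentState hħ hσ₀ (ofReal_re σ₀) (0, 0) κ
  have hA : 0 ≤ momentumAmplitude ħ σ₀ := by
    unfold momentumAmplitude
    positivity
  have hħ' : (ħ : ℂ) ≠ 0 := ofReal_ne_zero.2 hħ.ne'
  have h1 : inner ℂ (boundState κ) (coherentLp hħ hσ₀ (ofReal_re σ₀) (q, p))
      = Real.sqrt (-2 * κ) * ∫ x in Set.Ioi 0, F x := by
    rw [L2.inner_def, ← integral_indicator measurableSet_Ioi, ← integral_const_mul]
    refine integral_congr_ae ?_
    filter_upwards [boundState_coeFn κ, coherentLp_coeFn hħ hσ₀ (ofReal_re σ₀) (q, p)]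
      with x e1 e2
    rw [e1, e2, boundFun_eq_indicator hκ]
    by_cases hx : 0 < x
    · simp only [Set.indicator_of_mem (show x ∈ Set.Ioi 0 from hx)]
      rw [RCLike.inner_apply, Complex.conj_ofReal, hF]
      push_cast
      ring
    · simp only [Set.indicator_of_notMem (show x ∉ Set.Ioi 0 from hx)]
      simp
  have h2 : ∫ x in Set.Ioi 0, F x = (∫ x, F x) - ∫ x in Set.Iic 0, F x := by
    rw [← intervalIntegral.integral_Iic_add_Ioi hFi.integrableOn hFi.integrableOn, add_sub_cancel_left]
  have h3 : ‖∫ x, F x‖ ≤ momentumAmplitude ħ σ₀ *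
      (Real.exp (ħ * σ₀ ^ 2 * κ ^ 2) * Real.exp (-(σ₀ ^ 2 * p ^ 2 / ħ))) := by
    rw [hF, integral_exp_mul_coherentState hħ hσ₀ (ofReal_re σ₀), norm_mul, Complex.norm_real,
      Real.norm_of_nonneg hA, ← Real.exp_add, norm_exp]
    refine mul_le_mul_of_nonneg_left (Real.exp_le_exp.2 ?_) hA
    have e : (ħ * σ₀ * σ₀ * (I / ħ * p + κ) ^ 2 + κ * q : ℂ)
        = ((ħ * σ₀ ^ 2 * κ ^ 2 + -(σ₀ ^ 2 * p ^ 2 / ħ) + κ * q : ℝ) : ℂ)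
          + ((2 * σ₀ ^ 2 * p * κ : ℝ) : ℂ) * I := by
      push_cast
      field_simp
      linear_combination ((σ₀ : ℂ) ^ 2 * p ^ 2) * I_sq
    rw [e, add_re, ofReal_re, re_ofReal_mul, I_re]
    nlinarith
  have hGn : ∫ x, ‖G x‖ = momentumAmplitude ħ σ₀ * Real.exp (ħ * σ₀ ^ 2 * κ ^ 2) := by
    have e : ∀ x, ((‖G x‖ : ℝ) : ℂ) = G x := by
      intro x
      have e1 : (σ₀ : ℂ) ^ (1 / 2 : ℂ) = ((σ₀ ^ (1 / 2 : ℝ) : ℝ) : ℂ) := by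
        rw [Complex.ofReal_cpow hσ₀.le]
        push_cast
        rfl
      have e2 : G x = ((Real.exp (κ * x) * (1 / ((2 * Real.pi * ħ) ^ (1 / 4 : ℝ)
          * σ₀ ^ (1 / 2 : ℝ)) * Real.exp (-(1 / (4 * ħ * σ₀ * σ₀)) * x ^ 2)) : ℝ) : ℂ) := by
        simp only [hG, coherentState, e1]
        push_cast
        simp
      rw [e2, Complex.norm_real, Real.norm_of_nonneg (by positivity)]
    have e3 : ((∫ x, ‖G x‖ : ℝ) : ℂ) = ∫ x, G x := by
      rw [← integral_complex_ofReal]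
      exact integral_congr_ae (Eventually.of_forall e)
    rw [hG, integral_exp_mul_coherentState hħ hσ₀ (ofReal_re σ₀)] at e3
    apply ofReal_injective
    rw [e3]
    push_cast
    congr 2
    ring
  have h4 : ‖∫ x in Set.Iic 0, F x‖ ≤ momentumAmplitude ħ σ₀ *
      (Real.exp (ħ * σ₀ ^ 2 * κ ^ 2) * Real.exp (-(q ^ 2 / (4 * ħ * σ₀ ^ 2)))) := by
    calc ‖∫ x in Set.Iic 0, F x‖
        ≤ ∫ x in Set.Iic 0, Real.exp (-(q ^ 2 / (4 * ħ * σ₀ ^ 2))) * ‖G x‖ := by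
          refine norm_integral_le_of_norm_le (hGi.norm.const_mul _).integrableOn ?_
          filter_upwards [ae_restrict_mem measurableSet_Iic] with x hx
          have e := norm_coherentState_le hħ hσ₀ (ofReal_re σ₀) (p := p)
            (mul_nonpos_of_nonneg_of_nonpos hq hx)
          have e' : ‖coherentState ħ σ₀ σ₀ (0, p) x‖ = ‖coherentState ħ σ₀ σ₀ (0, 0) x‖ := by
            refine (pow_left_inj₀ (norm_nonneg _) (norm_nonneg _) two_ne_zero).1 ?_
            rw [norm_sq_coherentState hħ hσ₀ (ofReal_re σ₀),
              norm_sq_coherentState hħ hσ₀ (ofReal_re σ₀)]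
          rw [e', Complex.norm_real, Real.norm_of_nonneg hσ₀.le] at e
          simp only [hF, hG, norm_mul]
          rw [mul_left_comm]
          exact mul_le_mul_of_nonneg_left e (norm_nonneg _)
      _ ≤ ∫ x, Real.exp (-(q ^ 2 / (4 * ħ * σ₀ ^ 2))) * ‖G x‖ :=
          setIntegral_le_integral (hGi.norm.const_mul _)
            (Eventually.of_forall fun x => by positivity)
      _ = _ := by
          rw [integral_const_mul, hGn]
          ring
  -- After squaring, the constant `4` reduces to `π ≤ 2 √(2π)`.
  have h5 : Real.sqrt (-2 * κ) * momentumAmplitude ħ σ₀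
      ≤ 4 * (ħ * σ₀ ^ 2 * κ ^ 2) ^ (1 / 4 : ℝ) := by
    refine (pow_le_pow_iff_left₀ (by positivity) (by positivity) two_ne_zero).1 ?_
    have hq1 : Real.sqrt (ħ * σ₀ ^ 2 * κ ^ 2) = Real.sqrt ħ * σ₀ * -κ := by
      rw [Real.sqrt_mul (by positivity), Real.sqrt_mul hħ.le, Real.sqrt_sq hσ₀.le,
        Real.sqrt_sq_eq_abs, abs_of_neg hκ]
    have hsp : 0 < Real.sqrt (2 * Real.pi) := by positivity
    have hsh : 0 < Real.sqrt ħ := by positivity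
    have e1 : Real.sqrt (2 * Real.pi * ħ) = Real.sqrt (2 * Real.pi) * Real.sqrt ħ :=
      Real.sqrt_mul (by positivity) _
    rw [mul_pow, mul_pow, momentumAmplitude, div_pow, rpow_quarter_sq (by positivity),
      rpow_quarter_sq (by positivity), Real.sq_sqrt (by nlinarith), Real.sq_sqrt (by positivity),
      hq1, e1, ← mul_div_assoc, div_le_iff₀ (by positivity)]
    have h6 : Real.pi ≤ 2 * Real.sqrt (2 * Real.pi) := by
      have := Real.le_sqrt' (x := Real.pi / 2) (y := 2 * Real.pi) (by positivity)
      have h7 : Real.pi / 2 ≤ Real.sqrt (2 * Real.pi) := by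
        rw [this]
        nlinarith [Real.pi_pos, Real.pi_lt_four]
      linarith
    have hsq : Real.sqrt ħ * Real.sqrt ħ = ħ := Real.mul_self_sqrt hħ.le
    have hc : 0 ≤ 8 * ħ * σ₀ * -κ := by
      have : 0 < -κ := by linarith
      positivity
    calc -2 * κ * (4 * Real.pi * ħ * σ₀) = 8 * ħ * σ₀ * -κ * Real.pi := by ring
      _ ≤ 8 * ħ * σ₀ * -κ * (2 * Real.sqrt (2 * Real.pi)) := mul_le_mul_of_nonneg_left h6 hc
      _ = 4 ^ 2 * (Real.sqrt ħ * σ₀ * -κ) * (Real.sqrt (2 * Real.pi) * Real.sqrt ħ) := by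
        linear_combination (-16 * σ₀ * -κ * Real.sqrt (2 * Real.pi)) * hsq
  rw [h1, h2, norm_mul, Complex.norm_real, Real.norm_of_nonneg (Real.sqrt_nonneg _)]
  calc Real.sqrt (-2 * κ) * ‖(∫ x, F x) - ∫ x in Set.Iic 0, F x‖
      ≤ Real.sqrt (-2 * κ) * (momentumAmplitude ħ σ₀ *
          (Real.exp (ħ * σ₀ ^ 2 * κ ^ 2) * Real.exp (-(σ₀ ^ 2 * p ^ 2 / ħ)))
        + momentumAmplitude ħ σ₀ *
          (Real.exp (ħ * σ₀ ^ 2 * κ ^ 2) * Real.exp (-(q ^ 2 / (4 * ħ * σ₀ ^ 2))))) :=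
        mul_le_mul_of_nonneg_left ((norm_sub_le _ _).trans (add_le_add h3 h4))
          (Real.sqrt_nonneg _)
    _ = Real.sqrt (-2 * κ) * momentumAmplitude ħ σ₀ * (Real.exp (ħ * σ₀ ^ 2 * κ ^ 2) *
        (Real.exp (-(σ₀ ^ 2 * p ^ 2 / ħ)) + Real.exp (-(q ^ 2 / (4 * ħ * σ₀ ^ 2))))) := by ring
    _ ≤ 4 * (ħ * σ₀ ^ 2 * κ ^ 2) ^ (1 / 4 : ℝ) * (Real.exp (ħ * σ₀ ^ 2 * κ ^ 2) *
        (Real.exp (-(σ₀ ^ 2 * p ^ 2 / ħ)) + Real.exp (-(q ^ 2 / (4 * ħ * σ₀ ^ 2))))) :=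
        mul_le_mul_of_nonneg_right h5 (by positivity)
    _ = _ := by ring

end Estimates

end DeltaPrime

end


open MeasureTheory Filter Topology Complex

noncomputable section

namespace DeltaPrime

/-! ### Comparison of the perturbed and the free evolution -/

theorem norm_sub_refl_le (f : L2Line) : ‖f - refl f‖ ≤ 2 * ‖f‖ := by
  refine (norm_sub_le _ _).trans ?_
  rw [norm_reflOp, two_mul]

theorem norm_halfProj_le (f : L2Line) : ‖halfProj f‖ ≤ ‖f‖ := norm_mulOp_apply_le _ _ f

theorem norm_boundaryOp (κ : ℝ) (f : L2Line) : ‖boundaryOp κ f‖ = ‖f‖ := by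
  rw [← sq_eq_sq₀ (norm_nonneg _) (norm_nonneg _), ← @inner_self_eq_norm_sq ℂ,
    ← @inner_self_eq_norm_sq ℂ, inner_boundaryOp, boundaryOp_boundaryOp]

theorem norm_boundState_le (κ : ℝ) : ‖boundState κ‖ ≤ 1 := by
  rcases lt_or_ge κ 0 with hκ | hκ
  · refine (sq_le_one_iff₀ (norm_nonneg _)).1 ?_
    rw [← @inner_self_eq_norm_sq ℂ, inner_boundState_self hκ]
    simp
  · rw [boundState_of_nonneg hκ, norm_zero]
    exact zero_le_one

theorem halfProj_sub_refl (f : L2Line) :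
    halfProj (f - refl f) - refl (halfProj (f - refl f)) = f - refl f := by
  rw [refl_halfProj, map_sub refl, reflOp_reflOp, ← neg_sub f (refl f), map_neg]
  abel

/-- If `f` lived on `x > 0`, the image term `Θ J f` would be exactly minus the bound-state
component. The defect of `f` accounts for the rest. -/
theorem norm_sub_oddRestriction_le (κ : ℝ) (f : L2Line) :
    ‖f - refl f - (halfProj (f + boundaryOp κ f) - refl (halfProj (f + boundaryOp κ f)))‖
      ≤ 4 * ‖f - halfProj f‖ + 2 * ‖inner ℂ (boundState κ) f‖ := by
  set d := f - halfProj f with hd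
  set a : ℂ := inner ℂ (boundState κ) f with ha
  have h1 : halfProj (boundaryOp κ f) = halfProj (boundaryOp κ d) - a • boundState κ := by
    rw [hd, map_sub, map_sub, halfProj_boundaryOp_halfProj]
    abel
  have h2 : f - refl f - (halfProj (f + boundaryOp κ f) - refl (halfProj (f + boundaryOp κ f)))
      = (d - refl d) - (halfProj (boundaryOp κ d) - refl (halfProj (boundaryOp κ d)))
        + a • (boundState κ - refl (boundState κ)) := by
    rw [map_add halfProj, h1, hd]
    simp only [map_add, map_sub, map_smul, smul_sub]
    abel
  have h3 : ‖halfProj (boundaryOp κ d)‖ ≤ ‖d‖ :=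
    (norm_halfProj_le _).trans (norm_boundaryOp κ d).le
  have h4 := norm_sub_refl_le d
  have h5 := norm_sub_refl_le (halfProj (boundaryOp κ d))
  have h6 : ‖a • (boundState κ - refl (boundState κ))‖ ≤ 2 * ‖a‖ := by
    rw [norm_smul, mul_comm]
    refine mul_le_mul_of_nonneg_right ?_ (norm_nonneg _)
    linarith [norm_sub_refl_le (boundState κ), norm_boundState_le κ]
  rw [h2]
  refine (norm_add_le _ _).trans ?_
  linarith [norm_sub_le (d - refl d)
    (halfProj (boundaryOp κ d) - refl (halfProj (boundaryOp κ d)))]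

section Comparison

variable {ħ m : ℝ} {β : OnePoint ℝ}

theorem hamiltonianGroup_restriction (s : ℝ) (f : L2Line) :
    hamiltonianGroup ħ m β s (halfProj (f + boundaryOp (robin ħ m β) f)
        - refl (halfProj (f + boundaryOp (robin ħ m β) f)))
      = halfProj (schrodingerGroup (ħ ^ 2 / (2 * m)) s f
          + boundaryOp (robin ħ m β) (schrodingerGroup (ħ ^ 2 / (2 * m)) s f))
        - refl (halfProj (schrodingerGroup (ħ ^ 2 / (2 * m)) s f
          + boundaryOp (robin ħ m β) (schrodingerGroup (ħ ^ 2 / (2 * m)) s f))) := by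
  have h := DFunLike.congr_fun (halfLineGroup_restriction
    (e := -(ħ ^ 2 / (2 * m)) * robin ħ m β ^ 2) (halfLineData (robin ħ m β))
    (isCommuting (robin ħ m β) (ħ ^ 2 / (2 * m))) s) f
  change hamiltonianGroup ħ m β s ((1 / 2 : ℂ) • (halfProj (f + boundaryOp (robin ħ m β) f)
      - refl (halfProj (f + boundaryOp (robin ħ m β) f)))) = (1 / 2 : ℂ) • _ at h
  rw [map_smul] at h
  exact smul_right_injective L2Line (by norm_num : (1 / 2 : ℂ) ≠ 0) h

theorem hamiltonianGroup_add_refl (s : ℝ) (f : L2Line) :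
    hamiltonianGroup ħ m β s (f + refl f) = schrodingerGroup (ħ ^ 2 / (2 * m)) s (f + refl f) := by
  have h := DFunLike.congr_fun (halfLineGroup_even (U₀ := schrodingerGroup (ħ ^ 2 / (2 * m)))
    (e := -(ħ ^ 2 / (2 * m)) * robin ħ m β ^ 2) (halfLineData (robin ħ m β)) s) f
  change hamiltonianGroup ħ m β s ((1 / 2 : ℂ) • (f + refl f))
    = schrodingerGroup (ħ ^ 2 / (2 * m)) s ((1 / 2 : ℂ) • (f + refl f)) at h
  rw [map_smul, map_smul] at h
  exact smul_right_injective L2Line (by norm_num : (1 / 2 : ℂ) ≠ 0) h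

theorem refl_hamiltonianGroup (s : ℝ) (f : L2Line) :
    refl (hamiltonianGroup ħ m β s f) = hamiltonianGroup ħ m β s (refl f) :=
  DFunLike.congr_fun (reflection_halfLineGroup (halfLineData (robin ħ m β))
    (isCommuting (robin ħ m β) (ħ ^ 2 / (2 * m))) s) f

variable {s : ℝ} {ψ φ : L2Line} {a s₁ : ℂ}

/-- The even part evolves freely. The odd part is replaced by the odd restriction of `ψ`, whose
evolution is the odd restriction of the free one; there `Jφ` is replaced by `s₁ Rφ`. -/
theorem norm_hamiltonianGroup_sub_le (ha : ‖a‖ = 1)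
    (hφ : schrodingerGroup (ħ ^ 2 / (2 * m)) s ψ = a • φ) (s₁ : ℂ) :
    ‖hamiltonianGroup ħ m β s ψ - a • ((1 / 2 : ℂ) • (φ + refl φ)
        + (1 / 2 : ℂ) • (halfProj (φ + s₁ • refl φ) - refl (halfProj (φ + s₁ • refl φ))))‖
      ≤ 2 * ‖ψ - halfProj ψ‖ + ‖inner ℂ (boundState (robin ħ m β)) ψ‖
        + ‖symbolOp (robin ħ m β) φ - s₁ • φ‖ := by
  set κ := robin ħ m β with hκ
  set e := symbolOp κ φ - s₁ • φ with he
  set Y := halfProj (ψ + boundaryOp κ ψ) - refl (halfProj (ψ + boundaryOp κ ψ)) with hY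
  have hJ : boundaryOp κ φ = s₁ • refl φ + refl e := by
    rw [boundaryOp_apply, he, map_sub, map_smul]
    abel
  have h1 : hamiltonianGroup ħ m β s ψ = (1 / 2 : ℂ) • hamiltonianGroup ħ m β s (ψ + refl ψ)
      + (1 / 2 : ℂ) • hamiltonianGroup ħ m β s (ψ - refl ψ) := by
    rw [map_add, map_sub]
    module
  have h2 : hamiltonianGroup ħ m β s (ψ + refl ψ) = a • (φ + refl φ) := by
    rw [hamiltonianGroup_add_refl, map_add, ← refl_schrodingerGroup, hφ, map_smul, smul_add]
  have h3 : hamiltonianGroup ħ m β s Y = a • (halfProj (φ + s₁ • refl φ)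
      - refl (halfProj (φ + s₁ • refl φ)) + (halfProj (refl e) - refl (halfProj (refl e)))) := by
    rw [hY, hamiltonianGroup_restriction, hφ, ← hκ, map_smul, hJ]
    simp only [map_add, map_smul, smul_add, smul_sub]
    abel
  have h4 : hamiltonianGroup ħ m β s ψ - a • ((1 / 2 : ℂ) • (φ + refl φ)
        + (1 / 2 : ℂ) • (halfProj (φ + s₁ • refl φ) - refl (halfProj (φ + s₁ • refl φ))))
      = (1 / 2 : ℂ) • hamiltonianGroup ħ m β s (ψ - refl ψ - Y)
        + (1 / 2 : ℂ) • a • (halfProj (refl e) - refl (halfProj (refl e))) := by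
    rw [h1, h2, map_sub _ _ Y, h3]
    module
  have h5 := norm_sub_oddRestriction_le κ ψ
  have h6 : ‖halfProj (refl e) - refl (halfProj (refl e))‖ ≤ 2 * ‖e‖ := by
    have := norm_halfProj_le (refl e)
    rw [norm_reflOp] at this
    linarith [norm_sub_refl_le (halfProj (refl e))]
  rw [h4]
  refine (norm_add_le _ _).trans ?_
  rw [norm_smul, norm_smul, norm_smul a, ha, one_mul,
    (isIsometryGroup_hamiltonianGroup ħ m β).norm_map, norm_div, norm_one, RCLike.norm_ofNat]
  linarith

/-- Used while the centre of `φ` is on the initial side: dropping the part of `Rφ` in `x > 0` leaves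
`φ`. -/
theorem norm_hamiltonianGroup_sub_transmitted_le (ha : ‖a‖ = 1) (hs₁ : ‖s₁‖ ≤ 1)
    (hφ : schrodingerGroup (ħ ^ 2 / (2 * m)) s ψ = a • φ) :
    ‖hamiltonianGroup ħ m β s ψ - a • φ‖
      ≤ 2 * ‖ψ - halfProj ψ‖ + ‖inner ℂ (boundState (robin ħ m β)) ψ‖
        + ‖symbolOp (robin ħ m β) φ - s₁ • φ‖ + 2 * ‖halfProj (refl φ)‖ := by
  have h := norm_hamiltonianGroup_sub_le (β := β) ha hφ s₁
  set W := a • ((1 / 2 : ℂ) • (φ + refl φ)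
    + (1 / 2 : ℂ) • (halfProj (φ + s₁ • refl φ) - refl (halfProj (φ + s₁ • refl φ)))) with hW
  have e : hamiltonianGroup ħ m β s ψ - a • φ = (hamiltonianGroup ħ m β s ψ - W)
      + a • ((1 + s₁) / 2) • (halfProj (refl φ) - refl (halfProj (refl φ))) := by
    have e1 : φ = (1 / 2 : ℂ) • (φ + refl φ)
        + (1 / 2 : ℂ) • (halfProj (φ - refl φ) - refl (halfProj (φ - refl φ))) := by
      rw [halfProj_sub_refl]
      module
    conv_lhs => rw [e1]
    rw [hW]
    simp only [map_add, map_sub, map_smul]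
    module
  have h2 : ‖a • ((1 + s₁) / 2) • (halfProj (refl φ) - refl (halfProj (refl φ)))‖
      ≤ 2 * ‖halfProj (refl φ)‖ := by
    rw [norm_smul, ha, one_mul, norm_smul]
    have h3 : ‖(1 + s₁) / 2‖ ≤ 1 := by
      rw [norm_div, RCLike.norm_ofNat, div_le_one (by norm_num)]
      refine (norm_add_le _ _).trans ?_
      rw [norm_one]
      linarith
    calc _ ≤ 1 * (2 * ‖halfProj (refl φ)‖) :=
          mul_le_mul h3 (norm_sub_refl_le _) (norm_nonneg _) zero_le_one
      _ = _ := one_mul _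
  rw [e]
  exact (norm_add_le _ _).trans (add_le_add h h2)

/-- Used once the centre of `φ` has crossed: dropping the part of `φ` in `x > 0` leaves `(φ + Rφ)/2
- (s₁/2)(φ - Rφ)`. -/
theorem norm_hamiltonianGroup_sub_reflected_le (ha : ‖a‖ = 1) (hs₁ : ‖s₁‖ ≤ 1)
    (hφ : schrodingerGroup (ħ ^ 2 / (2 * m)) s ψ = a • φ) :
    ‖hamiltonianGroup ħ m β s ψ - a • (φ - ((1 + s₁) / 2) • (φ - refl φ))‖
      ≤ 2 * ‖ψ - halfProj ψ‖ + ‖inner ℂ (boundState (robin ħ m β)) ψ‖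
        + ‖symbolOp (robin ħ m β) φ - s₁ • φ‖ + 2 * ‖halfProj φ‖ := by
  have h := norm_hamiltonianGroup_sub_le (β := β) ha hφ s₁
  set W := a • ((1 / 2 : ℂ) • (φ + refl φ)
    + (1 / 2 : ℂ) • (halfProj (φ + s₁ • refl φ) - refl (halfProj (φ + s₁ • refl φ)))) with hW
  have e : hamiltonianGroup ħ m β s ψ - a • (φ - ((1 + s₁) / 2) • (φ - refl φ))
      = (hamiltonianGroup ħ m β s ψ - W)
        + a • ((1 + s₁) / 2) • (halfProj φ - refl (halfProj φ)) := by
    have e1 : φ - ((1 + s₁) / 2) • (φ - refl φ) = (1 / 2 : ℂ) • (φ + refl φ)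
        - (s₁ / 2) • (halfProj (φ - refl φ) - refl (halfProj (φ - refl φ))) := by
      rw [halfProj_sub_refl]
      module
    rw [e1, hW]
    simp only [map_add, map_sub, map_smul]
    module
  have h2 : ‖a • ((1 + s₁) / 2) • (halfProj φ - refl (halfProj φ))‖ ≤ 2 * ‖halfProj φ‖ := by
    rw [norm_smul, ha, one_mul, norm_smul]
    have h3 : ‖(1 + s₁) / 2‖ ≤ 1 := by
      rw [norm_div, RCLike.norm_ofNat, div_le_one (by norm_num)]
      refine (norm_add_le _ _).trans ?_
      rw [norm_one]
      linarith
    calc _ ≤ 1 * (2 * ‖halfProj φ‖) :=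
          mul_le_mul h3 (norm_sub_refl_le _) (norm_nonneg _) zero_le_one
      _ = _ := one_mul _
  rw [e]
  exact (norm_add_le _ _).trans (add_le_add h h2)

end Comparison

/-! ### The semiclassical approximation -/

theorem sigmaT_re (m σ₀ t : ℝ) : (sigmaT m σ₀ t).re = σ₀ := by
  have e : sigmaT m σ₀ t = (σ₀ : ℂ) + ((t / (2 * m * σ₀) : ℝ) : ℂ) * I := by
    rw [sigmaT]
    push_cast
    ring
  rw [e, add_re, ofReal_re, re_ofReal_mul, I_re, mul_zero, add_zero]

/-- The weight of the reflected part in the classical evolution. -/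
def reflectionWeight (m : ℝ) (B : ℝ → OnePoint ℝ) (t : ℝ) (ξ : ℝ × ℝ) : ℂ :=
  heaviside (-(t * ξ.1 * ξ.2)) * heaviside (|ξ.2 * t| / m - |ξ.1|) /
    (1 - Real.sign t * (2 * I * |ξ.2| / m * recip (B ξ.2)))

theorem reflectionWeight_neg {m : ℝ} {B : ℝ → OnePoint ℝ} (hB : ∀ p, B (-p) = B p) (t : ℝ)
    (ξ : ℝ × ℝ) : reflectionWeight m B t (-ξ) = reflectionWeight m B t ξ := by
  simp only [reflectionWeight, Prod.fst_neg, Prod.snd_neg, hB, abs_neg, neg_mul, mul_neg, neg_neg]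

theorem reflectionWeight_of_nonneg {m : ℝ} (B : ℝ → OnePoint ℝ) {t q p : ℝ}
    (hq : 0 < q) (hqt : 0 ≤ q + p * t / m) : reflectionWeight m B t (q, p) = 0 := by
  have h : heaviside (-(t * q * p)) * heaviside (|p * t| / m - |q|) = 0 := by
    rcases le_or_gt 0 (p * t) with h | h
    · have : ¬ 0 < -(t * q * p) := by
        have := mul_nonneg h hq.le
        nlinarith
      rw [heaviside, if_neg this, zero_mul]
    · have : ¬ 0 < |p * t| / m - |q| := by
        rw [abs_of_neg h, abs_of_pos hq, neg_div]
        linarith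
      rw [mul_comm, heaviside, if_neg this, zero_mul]
  rw [reflectionWeight, ← ofReal_mul, h, ofReal_zero, zero_div]

theorem recip_coupling (ħ : ℝ) (β : OnePoint ℝ) (p : ℝ) :
    recip (coupling ħ β p) = -(ħ ^ 3 / (2 * p ^ 2)) * recip β := by
  induction β using OnePoint.rec with
  | infty => exact (mul_zero _).symm
  | coe b =>
    change (-(2 * b / ħ ^ 3) * p ^ 2)⁻¹ = -(ħ ^ 3 / (2 * p ^ 2)) * b⁻¹
    rw [neg_mul, inv_neg, mul_inv, inv_div, neg_mul]
    congr 1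
    rw [div_eq_mul_inv, div_eq_mul_inv, mul_inv, mul_inv]
    ring

/-- A crossing from `q > 0` has `pt < 0`, hence `sgn(t)|p| = -p`. With `k = p/ħ` the choice of `B`
makes the denominator `(ik + κ)/(ik)`, and `ik/(ik + κ) = (1 + s)/2`. -/
theorem reflectionWeight_of_neg {ħ m : ℝ} (hħ : 0 < ħ) (hm : 0 < m) (β : OnePoint ℝ) {t q p : ℝ}
    (hq : 0 < q) (hqt : q + p * t / m < 0) :
    reflectionWeight m (coupling ħ β) t (q, p)
      = (1 + symbol (robin ħ m β) (p / (2 * Real.pi * ħ))) / 2 := by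
  have hpt : p * t < 0 := by
    have : p * t / m < 0 := by linarith
    by_contra h
    exact absurd this (not_lt.2 (div_nonneg (not_lt.1 h) hm.le))
  have hp : p ≠ 0 := fun h => by simp [h] at hpt
  have h1 : heaviside (-(t * q * p)) = 1 := if_pos (by nlinarith)
  have h2 : heaviside (|p * t| / m - |q|) = 1 := by
    refine if_pos ?_
    rw [abs_of_neg hpt, abs_of_pos hq, neg_div]
    linarith
  have h3 : Real.sign t * |p| = -p := by
    rcases lt_trichotomy t 0 with ht | ht | ht
    · have : 0 < p := by nlinarith
      rw [Real.sign_of_neg ht, abs_of_pos this, neg_one_mul]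
    · simp [ht] at hpt
    · have : p < 0 := by nlinarith
      rw [Real.sign_of_pos ht, abs_of_neg this, one_mul]
  have h3' : (Real.sign t : ℂ) * |p| = -p := by
    rw [← ofReal_mul, h3, ofReal_neg]
  have hζ : p / (2 * Real.pi * ħ) ≠ 0 := div_ne_zero hp (by positivity)
  have hd := symbol_denominator_ne_zero (κ := robin ħ m β) hζ
  have hk : (2 * Real.pi * ((p / (2 * Real.pi * ħ) : ℝ) : ℂ) : ℂ) = p / ħ := by
    have : (Real.pi : ℂ) ≠ 0 := ofReal_ne_zero.2 Real.pi_ne_zero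
    push_cast
    field_simp
  have hħ' : (ħ : ℂ) ≠ 0 := ofReal_ne_zero.2 hħ.ne'
  have hm' : (m : ℂ) ≠ 0 := ofReal_ne_zero.2 hm.ne'
  have hp' : (p : ℂ) ≠ 0 := ofReal_ne_zero.2 hp
  rw [hk] at hd
  have e : (1 - Real.sign t * (2 * I * |p| / m * recip (coupling ħ β p)) : ℂ)
      = (p / ħ * I + robin ħ m β) / (p / ħ * I) := by
    have e1 : (1 - Real.sign t * (2 * I * |p| / m * recip (coupling ħ β p)) : ℂ)
        = 1 - (Real.sign t * |p|) * (2 * I / m * recip (coupling ħ β p)) := by ring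
    rw [e1, h3', recip_coupling, robin]
    push_cast
    field_simp
    linear_combination (-(recip β : ℂ) * ħ ^ 3) * I_sq
  simp only [reflectionWeight, h1, h2, symbol, hk, e, ofReal_one, mul_one]
  generalize (p / ħ * I : ℂ) = y at hd ⊢
  rw [one_div_div]
  field_simp
  ring

section Approximation

variable {ħ σ₀ : ℝ}

/-- The semiclassical approximation as an element of `L²(ℝ)`. -/
def approximationLp (hħ : 0 < ħ) (hσ₀ : 0 < σ₀) (m : ℝ) (β : OnePoint ℝ) (t : ℝ) (ξ : ℝ × ℝ) :
    L2Line :=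
  cexp (I / ħ * (ξ.2 ^ 2 * t / (2 * m))) •
    (coherentLp hħ hσ₀ (sigmaT_re m σ₀ t) (ξ.1 + ξ.2 * t / m, ξ.2)
      - reflectionWeight m (coupling ħ β) t ξ •
        (coherentLp hħ hσ₀ (sigmaT_re m σ₀ t) (ξ.1 + ξ.2 * t / m, ξ.2)
          - refl (coherentLp hħ hσ₀ (sigmaT_re m σ₀ t) (ξ.1 + ξ.2 * t / m, ξ.2))))

theorem approximationLp_coeFn (hħ : 0 < ħ) (hσ₀ : 0 < σ₀) (m : ℝ) (β : OnePoint ℝ) (t : ℝ)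
    (ξ : ℝ × ℝ) :
    approximationLp hħ hσ₀ m β t ξ =ᵐ[volume] approximation ħ m σ₀ β t ξ := by
  set φ := coherentLp hħ hσ₀ (sigmaT_re m σ₀ t) (ξ.1 + ξ.2 * t / m, ξ.2) with hφ
  set w := reflectionWeight m (coupling ħ β) t ξ with hw
  filter_upwards [Lp.coeFn_smul (cexp (I / ħ * (ξ.2 ^ 2 * t / (2 * m)))) (φ - w • (φ - refl φ)),
    Lp.coeFn_sub φ (w • (φ - refl φ)), Lp.coeFn_smul w (φ - refl φ), Lp.coeFn_sub φ (refl φ),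
    coherentLp_coeFn hħ hσ₀ (sigmaT_re m σ₀ t) (ξ.1 + ξ.2 * t / m, ξ.2), reflOp_coeFn φ,
    ae_comp_neg (coherentLp_coeFn hħ hσ₀ (sigmaT_re m σ₀ t) (ξ.1 + ξ.2 * t / m, ξ.2))]
    with x h1 h2 h3 h4 h5 h6 h7
  rw [approximationLp, ← hφ, ← hw, h1, Pi.smul_apply, h2, Pi.sub_apply, h3, Pi.smul_apply, h4,
    Pi.sub_apply, h6, h7, h5, ← coherentState_neg]
  rfl

theorem refl_approximationLp (hħ : 0 < ħ) (hσ₀ : 0 < σ₀) (m : ℝ) (β : OnePoint ℝ) (t : ℝ)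
    (ξ : ℝ × ℝ) :
    refl (approximationLp hħ hσ₀ m β t ξ) = approximationLp hħ hσ₀ m β t (-ξ) := by
  have e : ((-ξ).1 + (-ξ).2 * t / m, (-ξ).2) = -(ξ.1 + ξ.2 * t / m, ξ.2) := by
    rw [Prod.neg_mk]
    refine congrArg (·, -ξ.2) ?_
    change -ξ.1 + -ξ.2 * t / m = _
    ring
  rw [approximationLp, approximationLp, reflectionWeight_neg (coupling_neg ħ β), e,
    ← refl_coherentLp]
  simp only [map_smul, map_sub, Prod.snd_neg, ofReal_neg, neg_sq]

theorem norm_hamiltonianGroup_sub_approximationLp_le_of_pos (hħ : 0 < ħ) (hσ₀ : 0 < σ₀) {m : ℝ}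
    (hm : 0 < m) (β : OnePoint ℝ) {η : ℝ} (hη : 0 < η) (hη1 : η < 1) (t : ℝ) {q p : ℝ}
    (hq : 0 < q) (hp : p ≠ 0) :
    ‖hamiltonianGroup ħ m β (t / ħ) (initialState hħ hσ₀ (q, p))
        - approximationLp hħ hσ₀ m β t (q, p)‖ ≤ 4 * errorBound ħ m σ₀ (recip β) η t q p := by
  have hσ := sigmaT_re m σ₀ t
  set φ := coherentLp hħ hσ₀ hσ (q + p * t / m, p) with hφ
  set s₁ := symbol (robin ħ m β) (p / (2 * Real.pi * ħ)) with hs₁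
  have hs₁' : ‖s₁‖ ≤ 1 := norm_symbol_le _ _
  have ha : ‖cexp (I / ħ * (p ^ 2 * t / (2 * m)))‖ = 1 := by
    have : (I / ħ * (p ^ 2 * t / (2 * m)) : ℂ) = ((p ^ 2 * t / (2 * m) / ħ : ℝ) : ℂ) * I := by
      push_cast
      ring
    rw [this, Complex.norm_exp_ofReal_mul_I]
  have hfree := schrodingerGroup_coherentLp hħ hm hσ₀ t hσ q p
  have h1 := norm_sub_halfProj_coherentLp_le hħ hσ₀ (ofReal_re σ₀) (p := p) hq.le
  rw [Complex.norm_real, Real.norm_of_nonneg hσ₀.le] at h1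
  have h2 := norm_inner_boundState_coherentLp_le hħ hσ₀ (robin ħ m β) (p := p) hq.le
  have h3 := norm_symbolOp_coherentLp_sub_le hħ hσ₀ hσ (robin ħ m β) hη hη1 (q + p * t / m) hp
  have e1 : |robin ħ m β| / (|p| / ħ) = ħ ^ 3 * |recip β| / (m * |p|) := by
    rw [robin, abs_mul, abs_of_pos (by positivity : 0 < ħ ^ 2 / m)]
    have : |p| ≠ 0 := abs_ne_zero.2 hp
    field_simp
  have e2 : ħ * σ₀ ^ 2 * robin ħ m β ^ 2 = ħ ^ 5 * σ₀ ^ 2 * recip β ^ 2 / m ^ 2 := by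
    rw [robin]
    field_simp
  rw [e1] at h3
  rw [e2] at h2
  have h4 : ‖hamiltonianGroup ħ m β (t / ħ) (initialState hħ hσ₀ (q, p))
        - approximationLp hħ hσ₀ m β t (q, p)‖
      ≤ 2 * ‖coherentLp hħ hσ₀ (ofReal_re σ₀) (q, p)
          - halfProj (coherentLp hħ hσ₀ (ofReal_re σ₀) (q, p))‖
        + ‖inner ℂ (boundState (robin ħ m β)) (coherentLp hħ hσ₀ (ofReal_re σ₀) (q, p))‖
        + ‖symbolOp (robin ħ m β) φ - s₁ • φ‖
        + 2 * Real.exp (-((q + p * t / m) ^ 2 / (4 * ħ * ‖sigmaT m σ₀ t‖ ^ 2))) := by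
    rw [initialState_eq_coherentLp, approximationLp, ← hφ]
    rcases le_or_gt 0 (q + p * t / m) with hqt | hqt
    · rw [reflectionWeight_of_nonneg _ hq hqt, zero_smul, sub_zero]
      refine (norm_hamiltonianGroup_sub_transmitted_le ha hs₁' hfree).trans ?_
      have := norm_halfProj_coherentLp_le hħ hσ₀ hσ (q := -(q + p * t / m)) (p := -p)
        (by linarith)
      rw [neg_sq, ← Prod.neg_mk, ← refl_coherentLp] at this
      linarith
    · rw [reflectionWeight_of_neg hħ hm β hq hqt]
      refine (norm_hamiltonianGroup_sub_reflected_le ha hs₁' hfree).trans ?_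
      have := norm_halfProj_coherentLp_le hħ hσ₀ hσ (p := p) hqt.le
      linarith
  -- The largest coefficient is `4`, from the bound-state overlap and the momentum tail.
  refine h4.trans ?_
  rw [errorBound]
  have p1 := Real.exp_nonneg (-(q ^ 2 / (4 * ħ * σ₀ ^ 2)))
  have p2 := Real.exp_nonneg (-(σ₀ ^ 2 * p ^ 2 / ħ))
  have p3 := Real.exp_nonneg (-((q + p * t / m) ^ 2 / (4 * ħ * ‖sigmaT m σ₀ t‖ ^ 2)))
  have p4 : 0 ≤ η / (1 - η) * (ħ ^ 3 * |recip β| / (m * |p|)) := by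
    have : 0 < 1 - η := by linarith
    positivity
  linarith

theorem errorBound_neg (ħ m σ₀ r η t q p : ℝ) :
    errorBound ħ m σ₀ r η t (-q) (-p) = errorBound ħ m σ₀ r η t q p := by
  have e : -q + -p * t / m = -(q + p * t / m) := by ring
  simp only [errorBound, e, neg_sq, abs_neg]

/-- The reflection commutes with both evolutions and sends `(q, p)` to `(-q, -p)`, so `q > 0`
suffices. -/
theorem norm_hamiltonianGroup_sub_approximationLp_le (hħ : 0 < ħ) (hσ₀ : 0 < σ₀) {m : ℝ}
    (hm : 0 < m) (β : OnePoint ℝ) {η : ℝ} (hη : 0 < η) (hη1 : η < 1) (t : ℝ) {q p : ℝ}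
    (hqp : q * p ≠ 0) :
    ‖hamiltonianGroup ħ m β (t / ħ) (initialState hħ hσ₀ (q, p))
        - approximationLp hħ hσ₀ m β t (q, p)‖ ≤ 4 * errorBound ħ m σ₀ (recip β) η t q p := by
  obtain ⟨hq, hp⟩ := mul_ne_zero_iff.1 hqp
  rcases lt_or_gt_of_ne hq with h | h
  · rw [← norm_reflOp, map_sub, refl_hamiltonianGroup, refl_approximationLp,
      initialState_eq_coherentLp, refl_coherentLp, ← errorBound_neg]
    exact norm_hamiltonianGroup_sub_approximationLp_le_of_pos hħ hσ₀ hm β hη hη1 t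
      (by linarith) (neg_ne_zero.2 hp)
  · exact norm_hamiltonianGroup_sub_approximationLp_le_of_pos hħ hσ₀ hm β hη hη1 t h hp

end Approximation

end DeltaPrime

end

/-! ### The theorem, with `C = 4` -/

theorem theorem1p1 :
    ∃ C : ℝ, 0 < C ∧
      ∀ (ħ m σ₀ : ℝ) (hħ : 0 < ħ) (_hm : 0 < m) (hσ₀ : 0 < σ₀) (β : OnePoint ℝ),
        β ≠ ((0 : ℝ) : OnePoint ℝ) →
        ∃ (U : ℝ → DeltaPrime.L2Line →L[ℂ] DeltaPrime.L2Line)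
          (V : ℝ → DeltaPrime.L2Phase →L[ℂ] DeltaPrime.L2Phase),
          DeltaPrime.IsUnitaryGroup (DeltaPrime.hamiltonian ħ m β) U ∧
          DeltaPrime.IsUnitaryGroup (DeltaPrime.liouvillian m (DeltaPrime.coupling ħ β)) V ∧
          (∀ (t : ℝ) (f : DeltaPrime.L2Phase), V (-t) f =ᵐ[volume]
            DeltaPrime.classicalEvolution m (DeltaPrime.coupling ħ β) t f) ∧
          ∀ (η t q p : ℝ), 0 < η → η < 1 → q * p ≠ 0 →
            eLpNorm (fun x => U (t / ħ) (DeltaPrime.initialState hħ hσ₀ (q, p)) x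
                - DeltaPrime.approximation ħ m σ₀ β t (q, p) x) 2 volume
              ≤ ENNReal.ofReal
                  (C * DeltaPrime.errorBound ħ m σ₀ (DeltaPrime.recip β) η t q p) := by
  refine ⟨4, by norm_num, fun ħ m σ₀ hħ hm hσ₀ β hβ => ?_⟩
  have hB := DeltaPrime.measurable_recip_coupling ħ β
  have hBe := DeltaPrime.coupling_neg ħ β
  refine ⟨DeltaPrime.hamiltonianGroup ħ m β, DeltaPrime.liouvilleGroup m hB,
    (DeltaPrime.isIsometryGroup_hamiltonianGroup ħ m β).isUnitaryGroup
      (DeltaPrime.hamiltonian_eq_generatorGraph hħ hm hβ),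
    (DeltaPrime.isIsometryGroup_liouvilleGroup m hB hBe).isUnitaryGroup
      (DeltaPrime.liouvillian_eq_generatorGraph hm hB hBe), fun t f => ?_,
    fun η t q p hη hη1 hqp => ?_⟩
  · have h := DeltaPrime.liouvilleGroup_coeFn hm hB hBe (-t) f
    rwa [neg_neg] at h
  · set ψ := DeltaPrime.hamiltonianGroup ħ m β (t / ħ) (DeltaPrime.initialState hħ hσ₀ (q, p))
    set φ := DeltaPrime.approximationLp hħ hσ₀ m β t (q, p)
    have h : (fun x => ψ x - DeltaPrime.approximation ħ m σ₀ β t (q, p) x)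
        =ᵐ[volume] ((ψ - φ : DeltaPrime.L2Line) : ℝ → ℂ) := by
      filter_upwards [Lp.coeFn_sub ψ φ, DeltaPrime.approximationLp_coeFn hħ hσ₀ m β t (q, p)]
        with x h1 h2
      rw [h1, Pi.sub_apply, h2]
    rw [eLpNorm_congr_ae h, ← Lp.enorm_def, ← ofReal_norm]
    exact ENNReal.ofReal_le_ofReal
      (DeltaPrime.norm_hamiltonianGroup_sub_approximationLp_le hħ hσ₀ hm β hη hη1 t hqp)
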